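/- \textbf{Setting.} Let $d\ge 1$ and $\gamma>0$, and let either $\kappa=1$ and $\beta>-1$ (the $\beta$-model) or $\kappa=-1$ and $\beta>\frac d2+1$ (the $\beta'$-model). Put $$c=\frac{\Gamma(\frac{d+1}{2}+\beta+1)}{\pi^{\frac{d+1}{2}}\Gamma(\beta+1)}\ \text{ if }\kappa=1,\qquad c=\frac{\Gamma(\beta)}{\pi^{\frac{d+1}{2}}\Gamma(\beta-\frac{d+1}{2})}\ \text{ if }\kappa=-1,$$ and let $\eta$ be a Poisson point process in $\mathbb R^d\times\mathbb R$ with intensity measure $\mu(dv,dh)=\gamma c\,(\kappa h)^{\kappa\beta}\mathbf 1\{\kappa h>0\}\,dv\,dh$. The Laguerre cell of $x=(v,h)\in\eta$ is $$C_\eta(x)=\{w\in\mathbb R^d:\ \|w-v\|^2+h\le\|w-v'\|^2+h'\ \text{ for all }(v',h')\in\eta\}.$$ The weighted Delaunay triangulation of $\eta$ consists of the simplices $\operatorname{conv}\{v_0,\dots,v_d\}$ with $v_0,\dots,v_d$ affinely independent and $(v_i,h_i)\in\eta$, such that the interior of the unique paraboloid $\{(v,h): h\le s-\|v-w\|^2\}$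 having all $(v_i,h_i)$ on its boundary contains no point of $\eta$. Let $V$ be the set of its vertices and $\Lambda=\mathbb E|V\cap[0,1]^d|$. Let $\mathbb K$ be the space of convex bodies (nonempty compact convex sets) in $\mathbb R^d$ with the Hausdorff metric. The typical cell is a random pair $\widehat Z=((0,h_Z),Z)$ with $h_Z\in\mathbb R$, $Z\in\mathbb K$, such that $$\mathbb P(\widehat Z\in D)=\frac{\mathbb E\,\bigl|\{x=(v,h)\in\eta:\ v\in B,\ ((0,h),\,C_\eta(x)-v)\in D\}\bigr|}{\mathbb E|V\cap B|}$$ for all Borel sets $D\subset\{0\}\times\mathbb R\times\mathbb K$ and all bounded Borel sets $B\subset\mathbb R^d$ of positive Lebesgue measure. For $u\in\mathbb S^{d-1}$, $t\in\mathbb R$ let $H^-(u,t)=\{w:\langle w,u\rangle\le t\}$. For $x=(v,h)$ and $x'=(v',h')$ let $b(x,x')=\{w:\ 2\langle w,v'-v\rangle\le h'+\|v'\|^2-h-\|v\|^2\}$. Define $$\operatorname{arc}(x,H^-(u,t))=\{(v+\alpha u,\ h+(t-\langle v,u\rangle)^2-(t-\langle v,u\rangle-\alpha)^2):\alpha>0\},$$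 $\operatorname{arc}(x,\emptyset)=\{(v,h'):h'\le h\}$ and $\operatorname{arc}(x,\mathbb R^d)=\{(v,h'):h'>h\}$. The flower $\mathcal F(x,K)$ of a pair $(x,K)$ with $K\in\mathbb K$ is the union of $\operatorname{arc}(x,H)$ over all $H$ that are half-spaces, $\emptyset$ or $\mathbb R^d$ and satisfy $K\not\subset H$. The $\Phi$-content is $\Phi(x,K)=\mu(\mathcal F(x,K))$. Let $\widetilde\mu_x$ be the image of $\mu$ under $b(x,\cdot)$. For an integer $n\ge d+1$ let $\mathcal P_n\subset\mathbb K$ be the set of polytopes that are intersections of $n$ half-spaces and have exactly $n$ facets. Let $\widehat{\mathcal P}_n$ be the set of all $((0,h),P)$ with $P\in\mathcal P_n$ such that $h\ge0$ if $\kappa=1$, and such that $h<0$ and $P\subset\{\|w\|<\sqrt{-h}\}$ if $\kappa=-1$. Let $\mathcal S_n=\mathcal P_n$ if $\kappa=1$ and $\mathcal S_n=\{P\in\mathcal P_n:P\subset\{\|w\|<1\}\}$ if $\kappa=-1$. The shape is $\mathfrak s((0,h),P)=(\kappa h)^{-1/2}P$. Define the measure $\nu_n$ on $\widehat{\mathcal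 P}_n$ and the measure $\widetilde\nu_n$ on $\mathcal S_n$ by $$\nu_n(A)=\frac{\gamma c}{\Lambda}\int_{\{\kappa h>0\}}\frac1{n!}\int\mathbf 1\Bigl\{\bigl((0,h),\textstyle\bigcap_{i=1}^nH_i\bigr)\in A\Bigr\}\,\widetilde\mu_{(0,h)}^{\otimes n}(dH_1,\dots,dH_n)\,(\kappa h)^{\kappa\beta}\,dh,$$ $$\widetilde\nu_n(S)=\nu_n\{\widehat P\in\widehat{\mathcal P}_n:\ 0<\Phi(\widehat P)<1,\ \mathfrak s(\widehat P)\in S\}.$$ Finally put $q=n+\dfrac{2\kappa\beta+2}{2\kappa\beta+d+2}$. \textbf{Theorem (Complementary theorem).} Let $n\ge d+1$ be an integer. \begin{enumerate} \item For every Borel set $S\subset\mathcal S_n$, $$\mathbb P\bigl(Z\in\mathcal P_n,\ \mathfrak s(\widehat Z)\in S\bigr)=\Gamma(q+1)\int_{\widehat{\mathcal P}_n}\mathbf 1\{\mathfrak s(\widehat P)\in S\}\,\mathbf 1\{\Phi(\widehat P)<1\}\,\nu_n(d\widehat P).$$ \item Suppose that $\mathbb P(Z\in\mathcal P_n)>0$.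 Then, conditionally on $Z\in\mathcal P_n$: \begin{enumerate} \item the shape $\mathfrak s(\widehat Z)$ and the $\Phi$-content $\Phi(\widehat Z)$ are independent; \item $\Phi(\widehat Z)$ is Gamma-distributed with shape parameter $q$ and rate $1$, that is, it has density $t^{q-1}e^{-t}/\Gamma(q)$ on $(0,\infty)$; \item $\mathfrak s(\widehat Z)$ has law $\widetilde\nu_n(\cdot)/\widetilde\nu_n(\mathcal S_n)$. \end{enumerate} \end{enumerate} -/

import Mathlib

open MeasureTheory ProbabilityTheory Set
open scoped ENNReal

namespace BetaVoronoi

/-- Euclidean space `ℝ^d`. -/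
abbrev Vec (d : ℕ) := EuclideanSpace ℝ (Fin d)

/-- The space `ℝ^d × ℝ` of weighted points `x = (v, h)`; `h` is the weight (height). -/
abbrev Pt (d : ℕ) := Vec d × ℝ

/-- Convex bodies carry the Borel σ-algebra of the Hausdorff metric. -/
noncomputable instance instMeasurableSpaceBody (d : ℕ) : MeasurableSpace (ConvexBody (Vec d)) := borel _

instance instBorelSpaceBody (d : ℕ) : BorelSpace (ConvexBody (Vec d)) := ⟨rfl⟩

/-- Pairs `(x, K)` of a weighted point and a convex body. -/
abbrev Marked (d : ℕ) := Pt d × ConvexBody (Vec d)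

/-- The pairs `((v, h), K)` with `v = 0`. -/
def centered (d : ℕ) : Set (Marked d) := {p | p.1.1 = 0}

/-! ### Half-spaces, faces, polytopes -/

/-- The set `{w | ⟨w, u⟩ ≤ t}`. -/
def halfSpace {d : ℕ} (u : Vec d) (t : ℝ) : Set (Vec d) := {w | inner ℝ w u ≤ t}

/-- The set `{w | ⟨w, u⟩ = t}`, a hyperplane when `u ≠ 0`. -/
def hyperplane {d : ℕ} (u : Vec d) (t : ℝ) : Set (Vec d) := {w | inner ℝ w u = t}

/-- The half-spaces of `ℝ^d` are parametrised bijectively by a unit normal and an offset. -/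
abbrev HalfSpace (d : ℕ) := Metric.sphere (0 : Vec d) 1 × ℝ

/-- Half-spaces together with the two improper ones: `inr false` is `∅`, `inr true` is `ℝ^d`. -/
abbrev ExtHalfSpace (d : ℕ) := HalfSpace d ⊕ Bool

/-- The subset of `ℝ^d` that a proper or improper half-space is. -/
def ExtHalfSpace.toSet {d : ℕ} : ExtHalfSpace d → Set (Vec d)
  | .inl (u, t) => halfSpace (u : Vec d) t
  | .inr false => ∅
  | .inr true => univ

/-- The `k`-dimensional faces of `P`: the nonempty intersections with hyperplanes that miss the
interior, of affine dimension `k`. -/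
def faces {d : ℕ} (k : ℕ) (P : Set (Vec d)) : Set (Set (Vec d)) :=
  {F | ∃ (u : Vec d) (t : ℝ), u ≠ 0 ∧ F = P ∩ hyperplane u t ∧ F.Nonempty ∧
    interior P ∩ hyperplane u t = ∅ ∧ Module.finrank ℝ (vectorSpan ℝ F) = k}

/-- Polytopes in `ℝ^d` that are intersections of `n` half-spaces and have exactly `n` facets. -/
def polytopes (d n : ℕ) : Set (ConvexBody (Vec d)) :=
  {P | (∃ H : Fin n → HalfSpace d, (P : Set (Vec d)) = ⋂ i, halfSpace ((H i).1 : Vec d) (H i).2) ∧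
    (faces (d - 1) (P : Set (Vec d))).encard = n}

/-! ### Laguerre diagrams and weighted Delaunay triangulations -/

/-- The downward paraboloid with apex `a`, i.e. `{(v, h) | h ≤ -‖v‖²} + a`. -/
def paraboloid {d : ℕ} (a : Pt d) : Set (Pt d) := {y | y.2 - a.2 ≤ -‖y.1 - a.1‖ ^ 2}

/-- The weighted Delaunay triangulation of `X`: the simplices spanned by the spatial parts of `d + 1`
points of `X` whose circumscribed downward paraboloid (it is unique, by affine independence) has no
point of `X` in its interior. -/
def weightedDelaunay {d : ℕ} (X : Set (Pt d)) : Set (Set (Vec d)) :=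
  {T | ∃ x : Fin (d + 1) → Pt d, (∀ i, x i ∈ X) ∧ AffineIndependent ℝ (fun i => (x i).1) ∧
    (∃ a : Pt d, (∀ i, x i ∈ frontier (paraboloid a)) ∧ X ∩ interior (paraboloid a) = ∅) ∧
    T = convexHull ℝ (range fun i => (x i).1)}

/-- The vertices of the weighted Delaunay triangulation of `X`. -/
def delaunayVertices {d : ℕ} (X : Set (Pt d)) : Set (Vec d) :=
  {v | ∃ T ∈ weightedDelaunay X, {v} ∈ faces 0 T}

/-- The Laguerre cell of `x` in `X`. -/
def laguerreCell {d : ℕ} (X : Set (Pt d)) (x : Pt d) : Set (Vec d) :=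
  {w | ∀ y ∈ X, ‖w - x.1‖ ^ 2 + x.2 ≤ ‖w - y.1‖ ^ 2 + y.2}

/-! ### The two models -/

/-- The two families: the `β`-model and the `β'`-model. -/
inductive Model
  | beta
  | betaPrime

/-- The sign `κ` of the model: `1` for `β`, `-1` for `β'`. -/
def Model.kappa : Model → ℝ
  | .beta => 1
  | .betaPrime => -1

/-- The range of `β`: `β > -1` in the `β`-model, `β > d/2 + 1` in the `β'`-model. -/
def Model.Admissible (M : Model) (d : ℕ) (β : ℝ) : Prop :=
  match M with
  | .beta => -1 < β
  | .betaPrime => (d : ℝ) / 2 + 1 < β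

/-- The normalising constants `c_{d+1,β}` and `c'_{d+1,β}`. -/
noncomputable def Model.normConst (M : Model) (d : ℕ) (β : ℝ) : ℝ :=
  match M with
  | .beta => Real.Gamma (((d : ℝ) + 1) / 2 + β + 1) /
      (Real.pi ^ (((d : ℝ) + 1) / 2) * Real.Gamma (β + 1))
  | .betaPrime => Real.Gamma β /
      (Real.pi ^ (((d : ℝ) + 1) / 2) * Real.Gamma (β - ((d : ℝ) + 1) / 2))

/-- The weight `(κ h)^{κ β}` on `κ h > 0`, extended by zero. -/
noncomputable def Model.weight (M : Model) (β h : ℝ) : ℝ≥0∞ :=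
  if 0 < M.kappa * h then ENNReal.ofReal ((M.kappa * h) ^ (M.kappa * β)) else 0

/-- The intensity measure `γ c (κ h)^{κ β} 1{κ h > 0} dv dh` on `ℝ^d × ℝ`. -/
noncomputable def intensity (M : Model) (d : ℕ) (β γ : ℝ) : Measure (Pt d) :=
  ENNReal.ofReal (γ * M.normConst d β) • (volume : Measure (Pt d)).withDensity
    (fun x => M.weight β x.2)

/-- The random set `X` is a Poisson point process with (diffuse) intensity measure `μ`: the numbers of
points in Borel sets are random variables, Poisson distributed with mean `μ A` (infinite almost surely
if `μ A = ∞`), and independent for disjoint sets. -/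
structure IsPoissonProcess {E Ω : Type*} [MeasurableSpace E] [MeasurableSpace Ω]
    (X : Ω → Set E) (μ : Measure E) (Pr : Measure Ω) : Prop where
  measurable_count : ∀ A : Set E, MeasurableSet A → Measurable fun ω => (X ω ∩ A).encard
  map_count : ∀ A : Set E, MeasurableSet A → μ A ≠ ∞ →
    Pr.map (fun ω => (X ω ∩ A).encard) = (poissonMeasure (μ A).toNNReal).map (fun k : ℕ => (k : ℕ∞))
  count_eq_top : ∀ A : Set E, MeasurableSet A → μ A = ∞ → ∀ᵐ ω ∂Pr, (X ω ∩ A).encard = ⊤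
  indep : ∀ (m : ℕ) (A : Fin m → Set E), (∀ i, MeasurableSet (A i)) →
    Pairwise (fun i j => Disjoint (A i) (A j)) → iIndepFun (fun i ω => (X ω ∩ A i).encard) Pr

/-- The mean number of vertices of the weighted Delaunay triangulation of `X` in `B`. -/
noncomputable def meanVertices {d : ℕ} {Ω : Type*} [MeasurableSpace Ω] (X : Ω → Set (Pt d))
    (Pr : Measure Ω) (B : Set (Vec d)) : ℝ≥0∞ :=
  ∫⁻ ω, ((delaunayVertices (X ω) ∩ B).encard : ℝ≥0∞) ∂Pr

/-- The vertex density `Λ`: the mean number of vertices in `[0,1]^d`. -/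
noncomputable def vertexDensity {d : ℕ} {Ω : Type*} [MeasurableSpace Ω] (X : Ω → Set (Pt d))
    (Pr : Measure Ω) : ℝ≥0∞ :=
  meanVertices X Pr {v | ∀ i, v i ∈ Icc (0 : ℝ) 1}

/-- The points `x = (v, h)` of `X` with `v ∈ B` such that `(x, C_X(x))` lies in `D + v`, where `C_X(x)`
is the Laguerre cell. Here `D` consists of pairs `((0, h), K)`, so the last condition says that
`C_X(x) = K + v` for a convex body `K` with `((0, h), K) ∈ D`. -/
def cellsIn {d : ℕ} (X : Set (Pt d)) (B : Set (Vec d)) (D : Set (Marked d)) : Set (Pt d) :=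
  {x | x ∈ X ∧ x.1 ∈ B ∧ ∃ K : ConvexBody (Vec d),
    laguerreCell X x = (fun w => w + x.1) '' (K : Set (Vec d)) ∧ (((0 : Vec d), x.2), K) ∈ D}

/-- The random element `C` (on its own probability space) is a typical cell, together with its nucleus,
of the Laguerre tessellation generated by the random set `X`. -/
structure IsTypicalCell {d : ℕ} {Ω Ω' : Type*} [MeasurableSpace Ω] [MeasurableSpace Ω']
    (X : Ω → Set (Pt d)) (Pr : Measure Ω) (C : Ω' → Marked d) (Pr' : Measure Ω') : Prop where
  measurable : Measurable C
  mem_centered : ∀ ω, C ω ∈ centered d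
  law : ∀ B : Set (Vec d), Bornology.IsBounded B → MeasurableSet B → volume B ≠ 0 →
    ∀ D : Set (Marked d), MeasurableSet D → D ⊆ centered d →
      Pr' (C ⁻¹' D) = (∫⁻ ω, ((cellsIn (X ω) B D).encard : ℝ≥0∞) ∂Pr) / meanVertices X Pr B

/-! ### Arcs, flowers and the `Φ`-content -/

/-- The bounding half-space `{w | ⟨w, 2 v' - 2 v⟩ ≤ h' + ‖v'‖² - h - ‖v‖²}` of `x = (v, h)` and
`x' = (v', h')`, written with a unit normal if `v' ≠ v`. -/
noncomputable def bound {d : ℕ} (x x' : Pt d) : ExtHalfSpace d :=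
  if hv : x'.1 - x.1 = 0 then
    .inr (decide (0 ≤ x'.2 + ‖x'.1‖ ^ 2 - x.2 - ‖x.1‖ ^ 2))
  else
    .inl (⟨‖x'.1 - x.1‖⁻¹ • (x'.1 - x.1), by
        simp [norm_smul, inv_mul_cancel₀ (norm_ne_zero_iff.mpr hv)]⟩,
      (x'.2 + ‖x'.1‖ ^ 2 - x.2 - ‖x.1‖ ^ 2) / (2 * ‖x'.1 - x.1‖))

/-- The arc of the parabola attached to the point `x = (v, h)` and a half-space. -/
def arc {d : ℕ} (x : Pt d) : ExtHalfSpace d → Set (Pt d)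
  | .inl (u, t) => {y | ∃ α : ℝ, 0 < α ∧ y = (x.1 + α • (u : Vec d),
      x.2 + (t - inner ℝ x.1 (u : Vec d)) ^ 2 - (t - inner ℝ x.1 (u : Vec d) - α) ^ 2)}
  | .inr false => {y | y.1 = x.1 ∧ y.2 ≤ x.2}
  | .inr true => {y | y.1 = x.1 ∧ x.2 < y.2}

/-- The (Voronoi) flower of the pair `(x, K)`. -/
def flower {d : ℕ} (p : Marked d) : Set (Pt d) :=
  ⋃ H ∈ {H : ExtHalfSpace d | ¬ (p.2 : Set (Vec d)) ⊆ H.toSet}, arc p.1 H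

/-- The `Φ`-content: the intensity measure of the flower. -/
noncomputable def phiContent (M : Model) {d : ℕ} (β γ : ℝ) (p : Marked d) : ℝ≥0∞ :=
  intensity M d β γ (flower p)

/-! ### Measures on half-spaces and on polytopes -/

/-- The image of the intensity measure under `bound x`, a measure on half-spaces. -/
noncomputable def halfSpaceMeasure (M : Model) {d : ℕ} (β γ : ℝ) (x : Pt d) :
    Measure (ExtHalfSpace d) :=
  (intensity M d β γ).map (bound x)

/-- The `n`-fold product `m ⊗ ⋯ ⊗ m`. The measures `halfSpaceMeasure` are s-finite but need not be
σ-finite, so the product is formed with `Measure.prod`, which is the right one in that generality. -/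
noncomputable def prodPow {α : Type*} [MeasurableSpace α] (m : Measure α) :
    (n : ℕ) → Measure (Fin n → α)
  | 0 => Measure.dirac fun i => i.elim0
  | n + 1 => (m.prod (prodPow m n)).map fun p => (Fin.cons p.1 p.2 : Fin (n + 1) → α)

open Classical in
/-- The intersection of half-spaces as a convex body (`{0}` if it is not a convex body). -/
noncomputable def interBody {d n : ℕ} (H : Fin n → ExtHalfSpace d) : ConvexBody (Vec d) :=
  if h : ∃ K : ConvexBody (Vec d), (K : Set (Vec d)) = ⋂ i, (H i).toSet then h.choose else 0

/-- The measure `A ↦ (1 / n!) ∫ 1{H₁ ∩ ⋯ ∩ Hₙ ∈ A} d(m ⊗ ⋯ ⊗ m)` on polytopes with `n` facets, where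
`m` is the half-space measure at `x`. -/
noncomputable def polytopeMeasure (M : Model) {d : ℕ} (β γ : ℝ) (x : Pt d) (n : ℕ) :
    Measure (ConvexBody (Vec d)) :=
  (n.factorial : ℝ≥0∞)⁻¹ •
    ((prodPow (halfSpaceMeasure M β γ x) n).restrict
      {H | ∃ K ∈ polytopes d n, (K : Set (Vec d)) = ⋂ i, (H i).toSet}).map interBody

/-- The space of pairs `((0, h), P)`, `P` a polytope with `n` facets, with `h ≥ 0` in the `β`-model,
and with `h < 0` and `P` inside the open ball of radius `√(-h)` in the `β'`-model. -/
def markedPolytopes (M : Model) (d n : ℕ) : Set (Marked d) :=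
  match M with
  | .beta => {p | p.1.1 = 0 ∧ 0 ≤ p.1.2 ∧ p.2 ∈ polytopes d n}
  | .betaPrime => {p | p.1.1 = 0 ∧ p.1.2 < 0 ∧ p.2 ∈ polytopes d n ∧
      (p.2 : Set (Vec d)) ⊆ Metric.ball 0 (Real.sqrt (-p.1.2))}

/-- The space of shapes of cells with `n` facets. -/
def shapes (M : Model) (d n : ℕ) : Set (ConvexBody (Vec d)) :=
  match M with
  | .beta => polytopes d n
  | .betaPrime => {P | P ∈ polytopes d n ∧ (P : Set (Vec d)) ⊆ Metric.ball 0 1}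

/-- The shape `(κ h)^{-1/2} P` of `((v, h), P)`. -/
noncomputable def shape (M : Model) {d : ℕ} (p : Marked d) : ConvexBody (Vec d) :=
  (Real.sqrt (M.kappa * p.1.2))⁻¹ • p.2

/-- The measure `ν` on `markedPolytopes M d n`: with `Λ` the vertex density,
`ν(A) = (γ c / Λ) ∫ ∫ 1{((0, h), P) ∈ A} polytopeMeasure (0, h) (dP) (κ h)^{κ β} dh`. -/
noncomputable def nu (M : Model) (d : ℕ) (β γ : ℝ) (n : ℕ) (Λ : ℝ≥0∞) : Measure (Marked d) :=
  (ENNReal.ofReal (γ * M.normConst d β) / Λ) •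
    (((volume : Measure ℝ).withDensity (M.weight β)).bind fun h =>
      (polytopeMeasure M β γ ((0 : Vec d), h) n).map fun P => (((0 : Vec d), h), P)).restrict
        (markedPolytopes M d n)

/-- The measure `ν̃` on shapes: `ν̃(S) = ν {p | Φ(p) ∈ (0, 1), shape p ∈ S}`. -/
noncomputable def nuTilde (M : Model) (d : ℕ) (β γ : ℝ) (n : ℕ) (Λ : ℝ≥0∞) :
    Measure (ConvexBody (Vec d)) :=
  ((nu M d β γ n Λ).restrict {p | phiContent M β γ p ∈ Ioo 0 1}).map (shape M)

/-- The exponent `n + (2 κ β + 2) / (2 κ β + d + 2)`. -/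
noncomputable def gammaShape (M : Model) (d : ℕ) (β : ℝ) (n : ℕ) : ℝ :=
  n + (2 * M.kappa * β + 2) / (2 * M.kappa * β + d + 2)

/-! ### Consistency of `bound`, `arc` and `halfSpaceMeasure` -/

theorem mem_arc_iff {d : ℕ} (x x' : Pt d) (hne : x' ≠ x) (H : ExtHalfSpace d) :
    x' ∈ arc x H ↔ bound x x' = H := by
  obtain ⟨v, h⟩ := x
  obtain ⟨v', h'⟩ := x'
  by_cases hv : v' - v = 0
  · have hvv : v' = v := sub_eq_zero.mp hv
    subst hvv
    have hh : h' ≠ h := fun e => hne (by rw [e])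
    rcases H with ⟨u, t⟩ | b
    · simp only [arc, bound, mem_ofPred_eq, Prod.mk.injEq, sub_self, dite_true]
      constructor
      · rintro ⟨α, hα, h1, -⟩
        have h0 : α • (u : Vec d) = 0 := by simpa using h1
        have hu : ‖(u : Vec d)‖ = 1 := by simp
        have := congrArg norm h0
        rw [norm_smul, hu, norm_zero, mul_one, norm_eq_zero] at this
        exact absurd this hα.ne'
      · intro e
        simp at e
    · have hb : bound (v', h) (v', h') = .inr (decide (h ≤ h')) := by
        have e : (0 ≤ h' + ‖v'‖ ^ 2 - h - ‖v'‖ ^ 2) ↔ h ≤ h' := by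
          constructor <;> intro _ <;> linarith
        simp only [bound, sub_self, dite_true, e]
      rw [hb]
      cases b
      · simp only [arc, mem_ofPred_eq, true_and, Sum.inr.injEq, decide_eq_false_iff_not, not_le]
        exact ⟨fun e => lt_of_le_of_ne e hh, le_of_lt⟩
      · simp only [arc, mem_ofPred_eq, true_and, Sum.inr.injEq, decide_eq_true_eq]
        exact ⟨le_of_lt, fun e => lt_of_le_of_ne e hh.symm⟩
  · have hn : 0 < ‖v' - v‖ := norm_pos_iff.mpr hv
    rcases H with ⟨u, t⟩ | b
    · have hu : ‖(u : Vec d)‖ = 1 := by simp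
      simp only [arc, bound, mem_ofPred_eq, Prod.mk.injEq, hv, dite_false, Sum.inl.injEq]
      constructor
      · rintro ⟨α, hα, rfl, rfl⟩
        have e1 : v + α • (u : Vec d) - v = α • (u : Vec d) := by abel
        have e2 : ‖α • (u : Vec d)‖ = α := by rw [norm_smul, hu, mul_one, Real.norm_of_nonneg hα.le]
        have e3 : ‖v + α • (u : Vec d)‖ ^ 2 = ‖v‖ ^ 2 + 2 * (α * inner ℝ v (u : Vec d)) + α ^ 2 := by
          rw [norm_add_sq_real, e2, real_inner_smul_right]
        refine ⟨Subtype.ext ?_, ?_⟩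
        · change ‖v + α • (u : Vec d) - v‖⁻¹ • (v + α • (u : Vec d) - v) = u
          rw [e1, e2, smul_smul, inv_mul_cancel₀ hα.ne', one_smul]
        · rw [e1, e2, e3]
          field_simp
          ring
      · rintro ⟨hu', rfl⟩
        have hu2 : (u : Vec d) = ‖v' - v‖⁻¹ • (v' - v) := (congrArg Subtype.val hu').symm
        refine ⟨‖v' - v‖, hn, ?_, ?_⟩
        · rw [hu2, smul_smul, mul_inv_cancel₀ hn.ne', one_smul]
          abel
        · have e4 : ‖v' - v‖ * inner ℝ v (u : Vec d) = inner ℝ v v' - ‖v‖ ^ 2 := by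
            rw [hu2, real_inner_smul_right, ← mul_assoc, mul_inv_cancel₀ hn.ne', one_mul,
              inner_sub_right, real_inner_self_eq_norm_sq]
          have e5 : ‖v' - v‖ ^ 2 = ‖v'‖ ^ 2 - 2 * inner ℝ v v' + ‖v‖ ^ 2 := by
            rw [norm_sub_sq_real, real_inner_comm]
          have e6 : ∀ a t : ℝ, h + (t - a) ^ 2 - (t - a - ‖v' - v‖) ^ 2
              = h + 2 * (‖v' - v‖ * t) - 2 * (‖v' - v‖ * a) - ‖v' - v‖ ^ 2 := by
            intro a t
            ring
          have e7 : ∀ q : ℝ, ‖v' - v‖ * (q / (2 * ‖v' - v‖)) = q / 2 := by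
            intro q
            field_simp
          rw [e6, e4, e7, e5]
          ring
    · cases b
      · simp only [arc, bound, mem_ofPred_eq, hv, dite_false, reduceCtorEq, iff_false, not_and]
        exact fun e => absurd (sub_eq_zero.mpr e) hv
      · simp only [arc, bound, mem_ofPred_eq, hv, dite_false, reduceCtorEq, iff_false, not_and]
        exact fun e => absurd (sub_eq_zero.mpr e) hv

theorem measurable_bound {d : ℕ} (x : Pt d) : Measurable (bound x) := by
  have hs : MeasurableSet {x' : Pt d | x'.1 - x.1 = 0} :=
    (measurable_fst.sub_const x.1) (measurableSet_singleton 0)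
  refine measurable_of_restrict_of_restrict_compl hs ?_ ?_
  · have e : ({x' : Pt d | x'.1 - x.1 = 0}.domRestrict (bound x)) = fun y => Sum.inr
        (decide (0 ≤ y.1.2 + ‖y.1.1‖ ^ 2 - x.2 - ‖x.1‖ ^ 2)) := by
      funext y
      have hy : y.1.1 - x.1 = 0 := y.2
      change bound x y.1 = _
      simp only [bound, hy, dite_true]
    rw [e]
    refine measurable_inr.comp (measurable_to_bool ?_)
    have : MeasurableSet {y : {x' : Pt d | x'.1 - x.1 = 0} |
        0 ≤ y.1.2 + ‖y.1.1‖ ^ 2 - x.2 - ‖x.1‖ ^ 2} :=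
      measurableSet_le measurable_const (by fun_prop)
    convert this using 1
    ext y
    simp
  · have e : ({x' : Pt d | x'.1 - x.1 = 0}ᶜ.domRestrict (bound x)) = fun y => Sum.inl
        ((⟨‖y.1.1 - x.1‖⁻¹ • (y.1.1 - x.1), by
          have hy : ¬ (y.1.1 - x.1 = 0) := y.2
          simp [norm_smul, inv_mul_cancel₀ (norm_ne_zero_iff.mpr hy)]⟩ :
          Metric.sphere (0 : Vec d) 1),
          (y.1.2 + ‖y.1.1‖ ^ 2 - x.2 - ‖x.1‖ ^ 2) / (2 * ‖y.1.1 - x.1‖)) := by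
      funext y
      have hy : ¬ (y.1.1 - x.1 = 0) := y.2
      change bound x y.1 = _
      simp only [bound, hy, dite_false]
    rw [e]
    refine measurable_inl.comp (Measurable.prodMk (Measurable.subtype_mk ?_) ?_)
    · fun_prop
    · fun_prop

theorem halfSpaceMeasure_apply (M : Model) {d : ℕ} (β γ : ℝ) (x : Pt d)
    {A : Set (ExtHalfSpace d)} (hA : MeasurableSet A) :
    halfSpaceMeasure M β γ x A = intensity M d β γ (⋃ H ∈ A, arc x H) := by
  have hx : intensity M d β γ {x} = 0 := by
    have h0 : (volume : Measure (Pt d)) {x} = 0 := by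
      rw [Measure.volume_eq_prod, ← singleton_prod_singleton, Measure.prod_prod,
        measure_singleton x.2, mul_zero]
    rw [intensity, Measure.smul_apply, withDensity_absolutelyContinuous _ _ h0, smul_zero]
  rw [halfSpaceMeasure, Measure.map_apply (measurable_bound x) hA]
  refine measure_congr (Filter.eventuallyEq_set.mpr ?_)
  have : ∀ᵐ y ∂(intensity M d β γ), y ≠ x := by
    rw [ae_iff]
    simpa using hx
  filter_upwards [this] with y hy
  simp only [mem_preimage, mem_iUnion, exists_prop, mem_arc_iff x y hy]
  exact ⟨fun h => ⟨_, h, rfl⟩, fun ⟨_, h, e⟩ => e ▸ h⟩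

end BetaVoronoi

open BetaVoronoi

/-! The theorem combines two facts about ν: the typical cell has density e^{-Φ} with respect to it,
and it is homogeneous under parabolic scaling.

Density. A bounded cell of x with n facets is cut out by the bounding half-spaces of n points y₁, …,
yₙ of η, and it is the cell of x exactly when no point of η lies in the flower of the resulting
body. Almost surely distinct points give distinct half-spaces, so each such cell arises from exactly
n! ordered families. The multivariate Mecke formula for x, y₁, …, yₙ turns the mean number of cells
into an integral in which the empty flower contributes its void probability e^{-Φ}. Translation
invariance splits off the volume of the window, and division by the mean number of vertices leaves ∫
e^{-Φ} dν (`lintegral_encard_cellsIn`, `IsTypicalCell.measure_eq_lintegral_nu`). In the β'-model,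
polytopes not contained in the ball of radius √(-h) lie outside the support of ν, but their flower
contains a region of infinite measure, so e^{-Φ} = 0 and nothing is lost
(`phiContent_eq_top_or_mem`).

Homogeneity. The map (v, h) ↦ (rv, r²h) multiplies the measure of sets by r^δ, δ = 2κβ + d + 2. It
carries bounding half-spaces and flowers to their dilates, so it multiplies Φ by r^δ and fixes the
shape. In ν the n half-spaces contribute r^{δn} and the height contributes r^{2κβ+2}, in total
r^{δq}. With r = t^{1/δ} this gives ν{Φ < t, shape ∈ S} = t^q ν{Φ < 1, shape ∈ S} (`nu_scaling`).

Conclusion. For fixed S the image of ν under Φ, on Φ < ∞, is therefore c(S) q t^{q-1} dt with c(S) =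
ν{Φ < 1, shape ∈ S}. Integrating e^{-t} gives c(S) Γ(q+1) times the Gamma(q, 1) law. This product
form of the joint law (`IsTypicalCell.joint_law`) contains all the claims. The constants are finite
because e^{-1} ν{Φ < 1} is at most a probability.

Two technical supports are needed. Convex geometry: a polytope with n facets has an irredundant
family of n half-spaces, unique up to order and depending continuously on the body's data; this
gives both the count n! and measurability. Probability: Mecke's formula is proved from the count
axioms of `IsPoissonProcess`, and almost every configuration is shown to be regular enough for
bounded cells to be determined by finitely many points (`GenericConfig`). -/

namespace BetaVoronoi

/-! ### Facets of finite intersections of half-spaces -/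

/-- The intersection of a family of half-spaces. -/
def polyInter {d : ℕ} {ι : Type*} (H : ι → HalfSpace d) : Set (Vec d) :=
  ⋂ i, halfSpace ((H i).1 : Vec d) (H i).2

/-- The points that satisfy all the inequalities of a family of half-spaces strictly. -/
def polyStrict {d : ℕ} {ι : Type*} (H : ι → HalfSpace d) : Set (Vec d) :=
  {w | ∀ i, inner ℝ w ((H i).1 : Vec d) < (H i).2}

/-- No half-space of the family can be dropped, in a form that is visibly open. -/
def Irredundant {d : ℕ} {ι : Type*} (H : ι → HalfSpace d) : Prop :=
  ∀ i, ∃ w, (∀ j, j ≠ i → inner ℝ w ((H j).1 : Vec d) < (H j).2) ∧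
    (H i).2 < inner ℝ w ((H i).1 : Vec d)

theorem mem_polyInter {d : ℕ} {ι : Type*} {H : ι → HalfSpace d} {w : Vec d} :
    w ∈ polyInter H ↔ ∀ i, inner ℝ w ((H i).1 : Vec d) ≤ (H i).2 := by
  simp [polyInter, halfSpace]

theorem polyStrict_subset {d : ℕ} {ι : Type*} (H : ι → HalfSpace d) :
    polyStrict H ⊆ polyInter H := fun _ hw => mem_polyInter.2 fun i => (hw i).le

theorem convex_halfSpace {d : ℕ} (u : Vec d) (t : ℝ) : Convex ℝ (halfSpace u t) := by
  intro x hx y hy a b ha hb hab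
  simp only [halfSpace, mem_ofPred_eq, inner_add_left, real_inner_smul_left] at *
  have h1 := mul_le_mul_of_nonneg_left hx ha
  have h2 := mul_le_mul_of_nonneg_left hy hb
  have h3 : a * t + b * t = t := by rw [← add_mul, hab, one_mul]
  linarith

theorem isClosed_halfSpace {d : ℕ} (u : Vec d) (t : ℝ) : IsClosed (halfSpace u t) :=
  isClosed_le (by fun_prop) continuous_const

theorem convex_hyperplane {d : ℕ} (u : Vec d) (t : ℝ) : Convex ℝ (hyperplane u t) := by
  intro x hx y hy a b ha hb hab
  simp only [hyperplane, mem_ofPred_eq, inner_add_left, real_inner_smul_left] at *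
  rw [hx, hy, ← add_mul, hab, one_mul]

theorem convex_polyInter {d : ℕ} {ι : Type*} (H : ι → HalfSpace d) : Convex ℝ (polyInter H) :=
  convex_iInter fun _ => convex_halfSpace _ _

theorem isClosed_polyInter {d : ℕ} {ι : Type*} (H : ι → HalfSpace d) : IsClosed (polyInter H) :=
  isClosed_iInter fun _ => isClosed_halfSpace _ _

theorem isOpen_polyStrict {d : ℕ} {ι : Type*} [Finite ι] (H : ι → HalfSpace d) :
    IsOpen (polyStrict H) := by
  have : polyStrict H = ⋂ i, {w | inner ℝ w ((H i).1 : Vec d) < (H i).2} := by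
    ext w; simp [polyStrict]
  rw [this]
  exact isOpen_iInter_of_finite fun i => isOpen_lt (by fun_prop) continuous_const

theorem norm_normal {d : ℕ} (H : HalfSpace d) : ‖(H.1 : Vec d)‖ = 1 := by simp

theorem normal_ne_zero {d : ℕ} (H : HalfSpace d) : (H.1 : Vec d) ≠ 0 := by
  rw [← norm_ne_zero_iff, norm_normal]; exact one_ne_zero

/-- A point at which a nonconstant functional attains its maximum on a set is not interior. -/
theorem inner_lt_of_mem_interior {d : ℕ} {K : Set (Vec d)} {u : Vec d} {t : ℝ} (hu : u ≠ 0)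
    (hK : K ⊆ halfSpace u t) {p : Vec d} (hp : p ∈ interior K) : inner ℝ p u < t := by
  have hc : Continuous fun s : ℝ => p + s • u := by fun_prop
  have h0 : (fun s : ℝ => p + s • u) 0 ∈ interior K := by simpa using hp
  have hev : ∀ᶠ s in nhds (0 : ℝ), p + s • u ∈ interior K :=
    hc.continuousAt.eventually (isOpen_interior.mem_nhds h0)
  obtain ⟨ε, hε, h⟩ := Metric.eventually_nhds_iff.1 hev
  have h1 := hK (interior_subset (h (y := ε / 2) (by
    rw [Real.dist_eq, sub_zero, abs_of_pos (by linarith)]; linarith)))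
  simp only [halfSpace, mem_ofPred_eq, inner_add_left, real_inner_smul_left,
    real_inner_self_eq_norm_sq] at h1
  have : 0 < ε / 2 * ‖u‖ ^ 2 := by
    have := norm_pos_iff.2 hu
    positivity
  linarith

theorem polyInter_subset {d : ℕ} {ι : Type*} (H : ι → HalfSpace d) (i : ι) :
    polyInter H ⊆ halfSpace ((H i).1 : Vec d) (H i).2 := iInter_subset _ i

theorem interior_polyInter {d : ℕ} {ι : Type*} [Finite ι] (H : ι → HalfSpace d) :
    interior (polyInter H) = polyStrict H := by
  refine subset_antisymm (fun p hp i => ?_)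
    (interior_maximal (polyStrict_subset H) (isOpen_polyStrict H))
  exact inner_lt_of_mem_interior (normal_ne_zero _) (polyInter_subset H i) hp

theorem finrank_orthogonal_singleton {d : ℕ} {u : Vec d} (hu : u ≠ 0) :
    Module.finrank ℝ (Submodule.span ℝ {u})ᗮ = d - 1 := by
  have h1 := Submodule.finrank_add_finrank_orthogonal (Submodule.span ℝ {u})
  rw [finrank_span_singleton hu, finrank_euclideanSpace_fin] at h1
  omega

theorem vectorSpan_le_orthogonal {d : ℕ} {F : Set (Vec d)} {u : Vec d} {t : ℝ}
    (hF : F ⊆ hyperplane u t) : vectorSpan ℝ F ≤ (Submodule.span ℝ {u})ᗮ := by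
  rw [vectorSpan_def, Submodule.span_le]
  rintro _ ⟨a, ha, b, hb, rfl⟩
  have h1 : inner ℝ a u = t := hF ha
  have h2 : inner ℝ b u = t := hF hb
  rw [SetLike.mem_coe, Submodule.mem_orthogonal_singleton_iff_inner_left]
  simp [inner_sub_left, h1, h2]

/-- Two hyperplanes that share a nonempty set of dimension `d - 1` coincide. -/
theorem hyperplane_unique {d : ℕ} {F : Set (Vec d)} {u v : Vec d} {s t : ℝ} (hu : u ≠ 0)
    (hv : v ≠ 0) (hFu : F ⊆ hyperplane u s) (hFv : F ⊆ hyperplane v t) (hne : F.Nonempty)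
    (hrank : Module.finrank ℝ (vectorSpan ℝ F) = d - 1) :
    ∃ c : ℝ, c ≠ 0 ∧ u = c • v ∧ s = c * t := by
  have e1 : vectorSpan ℝ F = (Submodule.span ℝ {u})ᗮ :=
    Submodule.eq_of_le_of_finrank_eq (vectorSpan_le_orthogonal hFu)
      (by rw [hrank, finrank_orthogonal_singleton hu])
  have e2 : vectorSpan ℝ F = (Submodule.span ℝ {v})ᗮ :=
    Submodule.eq_of_le_of_finrank_eq (vectorSpan_le_orthogonal hFv)
      (by rw [hrank, finrank_orthogonal_singleton hv])
  have e3 : Submodule.span ℝ {u} = Submodule.span ℝ {v} := by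
    rw [← Submodule.orthogonal_orthogonal (Submodule.span ℝ {u}), ← e1, e2,
      Submodule.orthogonal_orthogonal]
  obtain ⟨c, hc⟩ := Submodule.mem_span_singleton.1
    (e3 ▸ Submodule.mem_span_singleton_self u : u ∈ Submodule.span ℝ {v})
  obtain ⟨w, hw⟩ := hne
  refine ⟨c, fun h => hu (by rw [← hc, h, zero_smul]), hc.symm, ?_⟩
  have h1 : inner ℝ w u = s := hFu hw
  have h2 : inner ℝ w v = t := hFv hw
  rw [← h1, ← h2, ← hc, real_inner_smul_right]

/-- A convex subset of the boundary of a polyhedron lies in one of its bounding hyperplanes. -/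
theorem exists_subset_hyperplane {d : ℕ} {ι : Type*} [Finite ι] (H : ι → HalfSpace d)
    {F : Set (Vec d)} (hF : Convex ℝ F) (hne : F.Nonempty) (hFK : F ⊆ polyInter H)
    (hint : F ∩ polyStrict H = ∅) : ∃ i, F ⊆ hyperplane ((H i).1 : Vec d) (H i).2 := by
  classical
  have := Fintype.ofFinite ι
  by_contra! hcon
  have hex : ∀ i, ∃ w ∈ F, inner ℝ w ((H i).1 : Vec d) < (H i).2 := by
    intro i
    obtain ⟨w, hw, hw'⟩ := not_subset.1 (hcon i)
    exact ⟨w, hw, lt_of_le_of_ne (mem_polyInter.1 (hFK hw) i) hw'⟩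
  choose w hw hlt using hex
  rcases isEmpty_or_nonempty ι with hι | hι
  · obtain ⟨x, hx⟩ := hne
    have : x ∈ F ∩ polyStrict H := ⟨hx, fun i => hι.elim i⟩
    rw [hint] at this
    exact this
  have hcard : (0 : ℝ) < Fintype.card ι := by exact_mod_cast Fintype.card_pos
  -- Each w i satisfies the i-th inequality strictly and all others weakly, so the average of the w
  -- i satisfies every inequality strictly.
  set a : Vec d := ∑ i, (Fintype.card ι : ℝ)⁻¹ • w i with ha
  have haF : a ∈ F := hF.sum_mem (fun _ _ => by positivity)
    (by simp [hcard.ne']) fun i _ => hw i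
  have : a ∈ F ∩ polyStrict H := by
    refine ⟨haF, fun i => ?_⟩
    have e : inner ℝ a ((H i).1 : Vec d)
        = ∑ j, (Fintype.card ι : ℝ)⁻¹ * inner ℝ (w j) ((H i).1 : Vec d) := by
      rw [ha, sum_inner]
      simp [real_inner_smul_left]
    have e2 : (H i).2 = ∑ j : ι, (Fintype.card ι : ℝ)⁻¹ * (H i).2 := by
      simp [hcard.ne']
    rw [e, e2]
    refine Finset.sum_lt_sum (fun j _ => ?_) ⟨i, Finset.mem_univ _, ?_⟩
    · exact mul_le_mul_of_nonneg_left (mem_polyInter.1 (hFK (hw j)) i) (by positivity)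
    · exact mul_lt_mul_of_pos_left (hlt i) (by positivity)
  rw [hint] at this
  exact this

/-- A facet is convex and misses the interior, so it lies in one bounding hyperplane; having
dimension d - 1, it determines that hyperplane. -/
theorem faces_subset_range {d : ℕ} {ι : Type*} [Finite ι] (H : ι → HalfSpace d) :
    faces (d - 1) (polyInter H) ⊆
      range fun i => polyInter H ∩ hyperplane ((H i).1 : Vec d) (H i).2 := by
  rintro F ⟨u, t, hu, rfl, hne, hint, hrank⟩
  obtain ⟨i, hi⟩ := exists_subset_hyperplane H
    ((convex_polyInter H).inter (convex_hyperplane u t)) hne inter_subset_left (by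
      rw [← interior_polyInter]
      refine eq_empty_of_forall_notMem fun x hx => ?_
      have : x ∈ interior (polyInter H) ∩ hyperplane u t := ⟨hx.2, hx.1.2⟩
      rw [hint] at this
      exact this)
  obtain ⟨c, hc, h1, h2⟩ := hyperplane_unique hu (normal_ne_zero (H i)) inter_subset_right hi
    hne hrank
  refine ⟨i, ?_⟩
  have : hyperplane ((H i).1 : Vec d) (H i).2 = hyperplane u t := by
    ext w
    simp only [hyperplane, mem_ofPred_eq, h1, h2, real_inner_smul_right]
    exact ⟨fun h => by rw [h], fun h => mul_left_cancel₀ hc h⟩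
  simp only [this]

theorem encard_faces_le {d : ℕ} {ι : Type*} [Fintype ι] (H : ι → HalfSpace d) :
    (faces (d - 1) (polyInter H)).encard ≤ Fintype.card ι := by
  classical
  refine (encard_le_encard (faces_subset_range H)).trans ?_
  rw [← image_univ]
  refine (encard_image_le _ _).trans ?_
  simp

/-- The segment from an interior point p to a point w violating only the i-th inequality crosses the
i-th hyperplane, and all other inequalities are strict along it. -/
theorem Irredundant.exists_facet_point {d : ℕ} {ι : Type*} {H : ι → HalfSpace d}
    (hH : Irredundant H) (hs : (polyStrict H).Nonempty) (i : ι) :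
    ∃ z, (∀ j, j ≠ i → inner ℝ z ((H j).1 : Vec d) < (H j).2) ∧
      inner ℝ z ((H i).1 : Vec d) = (H i).2 := by
  obtain ⟨w, hw, hwi⟩ := hH i
  obtain ⟨p, hp⟩ := hs
  set a := inner ℝ w ((H i).1 : Vec d)
  set b := inner ℝ p ((H i).1 : Vec d) with hb
  have hpi : b < (H i).2 := hp i
  set s := ((H i).2 - b) / (a - b)
  have hab : 0 < a - b := by linarith
  have hs0 : 0 < s := div_pos (by linarith) hab
  have hs1 : s < 1 := (div_lt_one hab).2 (by linarith)
  refine ⟨s • w + (1 - s) • p, fun j hj => ?_, ?_⟩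
  · rw [inner_add_left, real_inner_smul_left, real_inner_smul_left]
    nlinarith [mul_lt_mul_of_pos_left (hw j hj) hs0,
      mul_lt_mul_of_pos_left (hp j) (sub_pos.2 hs1)]
  · rw [inner_add_left, real_inner_smul_left, real_inner_smul_left]
    have : s * (a - b) = (H i).2 - b := div_mul_cancel₀ _ hab.ne'
    change s * a + (1 - s) * b = _
    linarith

theorem Irredundant.facet_mem {d : ℕ} {ι : Type*} [Finite ι] {H : ι → HalfSpace d}
    (hH : Irredundant H) (hs : (polyStrict H).Nonempty) (i : ι) :
    polyInter H ∩ hyperplane ((H i).1 : Vec d) (H i).2 ∈ faces (d - 1) (polyInter H) := by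
  obtain ⟨z, hz, hzi⟩ := hH.exists_facet_point hs i
  have hzK : z ∈ polyInter H := mem_polyInter.2 fun j => by
    by_cases h : j = i
    · subst h; exact hzi.le
    · exact (hz j h).le
  refine ⟨(H i).1, (H i).2, normal_ne_zero _, rfl, ⟨z, hzK, hzi⟩, ?_, ?_⟩
  · refine eq_empty_of_forall_notMem fun x hx => ?_
    rw [interior_polyInter] at hx
    exact (hx.1 i).ne hx.2
  · rw [← finrank_orthogonal_singleton (normal_ne_zero (H i))]
    have : vectorSpan ℝ (polyInter H ∩ hyperplane ((H i).1 : Vec d) (H i).2)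
        = (Submodule.span ℝ {((H i).1 : Vec d)})ᗮ := by
      -- Since the other inequalities are strict at z, a small move from z in any direction
      -- orthogonal to the i-th normal stays in the facet.
      refine le_antisymm (vectorSpan_le_orthogonal inter_subset_right) fun v hv => ?_
      rw [Submodule.mem_orthogonal_singleton_iff_inner_left] at hv
      have hev : ∀ᶠ s in nhds (0 : ℝ), ∀ j, j ≠ i →
          inner ℝ (z + s • v) ((H j).1 : Vec d) < (H j).2 := by
        rw [Filter.eventually_all]
        intro j
        by_cases hj : j = i
        · simp [hj]
        · have hc : Continuous fun s : ℝ => inner ℝ (z + s • v) ((H j).1 : Vec d) := by fun_prop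
          filter_upwards [hc.continuousAt.eventually_lt (x₀ := 0) 
            (continuousAt_const (y := (H j).2)) (by simpa using hz j hj)]
            with s hs _ using hs
      obtain ⟨ε, hε, h⟩ := Metric.eventually_nhds_iff.1 hev
      have hε2 := h (y := ε / 2) (by
        rw [Real.dist_eq, sub_zero, abs_of_pos (by linarith)]; linarith)
      have hmem : z + (ε / 2) • v ∈ polyInter H ∩ hyperplane ((H i).1 : Vec d) (H i).2 := by
        have h1 : inner ℝ (z + (ε / 2) • v) ((H i).1 : Vec d) = (H i).2 := by
          rw [inner_add_left, real_inner_smul_left, hv, mul_zero, add_zero, hzi]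
        refine ⟨mem_polyInter.2 fun j => ?_, h1⟩
        by_cases h' : j = i
        · subst h'; exact h1.le
        · exact (hε2 j h').le
      have h3 := vsub_mem_vectorSpan ℝ hmem (⟨hzK, hzi⟩ :
        z ∈ polyInter H ∩ hyperplane ((H i).1 : Vec d) (H i).2)
      rw [vsub_eq_sub, add_sub_cancel_left] at h3
      have h4 := Submodule.smul_mem _ (ε / 2)⁻¹ h3
      rwa [smul_smul, inv_mul_cancel₀ (by positivity), one_smul] at h4
    rw [this]

theorem Irredundant.encard_faces {d : ℕ} {ι : Type*} [Fintype ι] {H : ι → HalfSpace d}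
    (hH : Irredundant H) (hs : (polyStrict H).Nonempty) :
    (faces (d - 1) (polyInter H)).encard = Fintype.card ι := by
  refine le_antisymm (encard_faces_le H) ?_
  have hinj : Function.Injective
      fun i => polyInter H ∩ hyperplane ((H i).1 : Vec d) (H i).2 := by
    intro i j hij
    by_contra hne
    obtain ⟨z, hz, hzi⟩ := hH.exists_facet_point hs i
    have hzK : z ∈ polyInter H := mem_polyInter.2 fun j => by
      by_cases h : j = i
      · subst h; exact hzi.le
      · exact (hz j h).le
    have : z ∈ polyInter H ∩ hyperplane ((H j).1 : Vec d) (H j).2 := by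
      have h := (⟨hzK, hzi⟩ : z ∈ polyInter H ∩ hyperplane ((H i).1 : Vec d) (H i).2)
      exact (show _ = polyInter H ∩ hyperplane ((H j).1 : Vec d) (H j).2 from hij) ▸ h
    exact (hz j (Ne.symm hne)).ne this.2
  have h1 := hinj.encard_image (univ : Set ι)
  rw [encard_univ, ENat.card_eq_coe_fintype_card] at h1
  rw [← h1]
  refine encard_le_encard ?_
  rintro _ ⟨i, -, rfl⟩
  exact hH.facet_mem hs i

/-- A redundancy tested on strict inequalities only suffices: a point w violating just the j-th
inequality can be moved slightly towards an interior point, which makes the others strict. -/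
theorem polyInter_drop {d : ℕ} {ι : Type*} {H : ι → HalfSpace d} (hs : (polyStrict H).Nonempty)
    (i : ι) (hi : ∀ w, (∀ j, j ≠ i → inner ℝ w ((H j).1 : Vec d) < (H j).2) →
      inner ℝ w ((H i).1 : Vec d) ≤ (H i).2) :
    polyInter (fun j : {j // j ≠ i} => H j) = polyInter H := by
  refine subset_antisymm (fun w hw => mem_polyInter.2 ?_)
    fun w hw => mem_polyInter.2 fun j => mem_polyInter.1 hw j
  intro j
  by_cases hj : j = i
  swap
  · exact mem_polyInter.1 hw ⟨j, hj⟩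
  subst hj
  by_contra! hlt
  obtain ⟨p, hp⟩ := hs
  set a := inner ℝ w ((H j).1 : Vec d)
  set b := inner ℝ p ((H j).1 : Vec d) with hb
  have hpi : b < (H j).2 := hp j
  have hab : 0 < a - b := by linarith
  -- Half the parameter at which the segment from w to p reaches the hyperplane, so the new point
  -- still violates the j-th inequality.
  set s := (a - (H j).2) / (2 * (a - b))
  have hs0 : 0 < s := div_pos (by linarith) (by linarith)
  have hs1 : s < 1 := (div_lt_one (by linarith)).2 (by linarith)
  have h1 := hi ((1 - s) • w + s • p) (fun k hk => by
    rw [inner_add_left, real_inner_smul_left, real_inner_smul_left]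
    nlinarith [mul_lt_mul_of_pos_left (hp k) hs0,
      mul_le_mul_of_nonneg_left (mem_polyInter.1 hw ⟨k, hk⟩) (sub_pos.2 hs1).le])
  rw [inner_add_left, real_inner_smul_left, real_inner_smul_left] at h1
  have h2 : s * (2 * (a - b)) = a - (H j).2 := div_mul_cancel₀ _ (by linarith)
  have h3 : (1 - s) * a + s * b ≤ (H j).2 := h1
  linarith

/-- Dropping a redundant half-space would describe the same set by fewer half-spaces than it has
facets. -/
theorem irredundant_of_encard {d : ℕ} {ι : Type*} [Fintype ι] {H : ι → HalfSpace d}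
    (hs : (polyStrict H).Nonempty)
    (hc : (Fintype.card ι : ℕ∞) ≤ (faces (d - 1) (polyInter H)).encard) : Irredundant H := by
  classical
  intro i
  by_contra! hcon
  rw [← polyInter_drop hs i hcon] at hc
  have h1 := hc.trans (encard_faces_le _)
  have h2 : Fintype.card {j // j ≠ i} < Fintype.card ι :=
    Fintype.card_subtype_lt (x := i) (by simp)
  exact absurd (by exact_mod_cast h1) (not_le.2 h2)

/-- A convex set with at least two facets has interior points. -/
theorem interior_nonempty_of_encard_faces {d : ℕ} {K : Set (Vec d)} (hK : Convex ℝ K)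
    (hc : 2 ≤ (faces (d - 1) K).encard) : (interior K).Nonempty := by
  by_contra hint
  have hsub : (faces (d - 1) K).Subsingleton := by
    -- Without interior points K has dimension at most d - 1, so a facet spans the same directions
    -- as K and its hyperplane contains all of K.
    have key : ∀ F ∈ faces (d - 1) K, F = K := by
      rintro F ⟨u, t, hu, rfl, ⟨x, hx⟩, -, hrank⟩
      have hspan : vectorSpan ℝ (K ∩ hyperplane u t) = vectorSpan ℝ K := by
        refine Submodule.eq_of_le_of_finrank_le (vectorSpan_mono ℝ inter_subset_left) ?_
        rw [hrank]
        by_contra! hlt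
        have hle : Module.finrank ℝ (vectorSpan ℝ K) = Module.finrank ℝ (Vec d) := by
          refine le_antisymm (Submodule.finrank_le _) ?_
          rw [finrank_euclideanSpace_fin]; omega
        have htop := Submodule.eq_top_of_finrank_eq hle
        refine hint (hK.interior_nonempty_iff_affineSpan_eq_top.2 ?_)
        exact (AffineSubspace.affineSpan_eq_top_iff_vectorSpan_eq_top_of_nonempty ℝ (Vec d) (Vec d)
          ⟨x, hx.1⟩).2 htop
      refine inter_eq_left.2 fun y hy => ?_
      have h1 : y - x ∈ vectorSpan ℝ (K ∩ hyperplane u t) := by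
        rw [hspan]; exact vsub_mem_vectorSpan ℝ hy hx.1
      have h2 := vectorSpan_le_orthogonal inter_subset_right h1
      rw [Submodule.mem_orthogonal_singleton_iff_inner_left, inner_sub_left] at h2
      have h3 : inner ℝ x u = t := hx.2
      change inner ℝ y u = t
      linarith
    exact fun F hF G hG => (key F hF).trans (key G hG).symm
  have h1 := encard_le_one_iff_subsingleton.2 hsub
  exact absurd (hc.trans h1) (by norm_num)

/-- An irredundant half-space description of a full-dimensional polyhedron is contained in every
finite half-space description. -/
theorem Irredundant.mem_range {d : ℕ} {ι ι' : Type*} [Finite ι] [Finite ι'] {H : ι → HalfSpace d}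
    {H' : ι' → HalfSpace d} (hH : Irredundant H) (hs : (polyStrict H).Nonempty)
    (he : polyInter H = polyInter H') (i : ι) : H i ∈ range H' := by
  obtain ⟨u, t, hu, hF, hne, hint, hrank⟩ := hH.facet_mem hs i
  set F := polyInter H ∩ hyperplane ((H i).1 : Vec d) (H i).2 with hFdef
  have hss : polyStrict H = polyStrict H' := by
    rw [← interior_polyInter, ← interior_polyInter, he]
  obtain ⟨j, hj⟩ := exists_subset_hyperplane H' (F := F)
    ((convex_polyInter H).inter (convex_hyperplane _ _)) hne
    (he ▸ inter_subset_left) (by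
      rw [← hss]
      exact eq_empty_of_forall_notMem fun x hx => (hx.2 i).ne hx.1.2)
  obtain ⟨c, hc, h1, h2⟩ := hyperplane_unique (normal_ne_zero (H i)) (normal_ne_zero (H' j))
    inter_subset_right hj hne hrank
  -- The normals are unit vectors, so c = ±1; the common interior point satisfies both inequalities
  -- strictly, which excludes c = -1.
  have hcabs : |c| = 1 := by
    have := congrArg norm h1
    rw [norm_smul, norm_normal, norm_normal, mul_one] at this
    simpa using this.symm
  obtain ⟨p, hp⟩ := hs
  have hp1 := hp i
  have hp2 := (hss ▸ hp : p ∈ polyStrict H') j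
  rw [h1, h2, real_inner_smul_right] at hp1
  have hc0 : 0 < c := by
    by_contra! hle
    nlinarith
  rw [abs_of_pos hc0] at hcabs
  subst hcabs
  refine ⟨j, ?_⟩
  rw [one_smul] at h1
  rw [one_mul] at h2
  exact (Prod.ext (Subtype.ext h1) h2).symm

/-- Every finite half-space description of a full-dimensional polyhedron contains an irredundant
one. -/
theorem exists_irredundant_subset {d : ℕ} {ι : Type*} [Finite ι] (H : ι → HalfSpace d)
    (hs : (polyStrict H).Nonempty) :
    ∃ s : Set ι, Irredundant (fun i : s => H i) ∧ polyInter (fun i : s => H i) = polyInter H := by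
  classical
  -- An inclusion-minimal index set with the same intersection is irredundant, since a redundant
  -- index could be removed by `polyInter_drop`.
  obtain ⟨s, hs1, hmin⟩ := (Set.toFinite
    {s : Set ι | polyInter (fun i : s => H i) = polyInter H}).exists_minimal ⟨univ, by
      ext w; simp [mem_polyInter]⟩
  refine ⟨s, fun i => ?_, hs1⟩
  by_contra! hcon
  have hst : (polyStrict (fun i : s => H i)).Nonempty := by
    obtain ⟨p, hp⟩ := hs
    exact ⟨p, fun i => hp i⟩
  have hdrop := polyInter_drop hst i hcon
  have hmem : polyInter (fun j : (s \ {i.1} : Set ι) => H j) = polyInter H := by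
    rw [← show polyInter (fun i : s => H i) = polyInter H from hs1, ← hdrop]
    ext w
    simp only [mem_polyInter, Subtype.forall, mem_sdiff, mem_singleton_iff]
    constructor
    · intro h j hj hne
      exact h j ⟨hj, fun e => hne (Subtype.ext e)⟩
    · intro h j hj
      exact h j hj.1 fun e => hj.2 (congrArg Subtype.val e)
  have := hmin hmem sdiff_subset i.2
  exact this.2 rfl

/-! ### Continuous dependence of a polytope on its half-spaces -/

/-- The irredundant families of half-spaces that bound a full-dimensional polytope. -/
def facetFamilies (d n : ℕ) : Set (Fin n → HalfSpace d) :=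
  {H | Bornology.IsBounded (polyInter H) ∧ (polyStrict H).Nonempty ∧ Irredundant H}

theorem eventually_mem_polyStrict {d n : ℕ} {H : Fin n → HalfSpace d} {w : Vec d}
    (hw : w ∈ polyStrict H) :
    ∀ᶠ q : (Fin n → HalfSpace d) × Vec d in nhds (H, w), q.2 ∈ polyStrict q.1 := by
  simp only [polyStrict, mem_ofPred_eq, Filter.eventually_all]
  intro i
  have h1 : Continuous fun q : (Fin n → HalfSpace d) × Vec d =>
      inner ℝ q.2 ((q.1 i).1 : Vec d) := by fun_prop
  have h2 : Continuous fun q : (Fin n → HalfSpace d) × Vec d => (q.1 i).2 := by fun_prop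
  exact h1.continuousAt.eventually_lt h2.continuousAt (hw i)

theorem eventually_polyStrict {d n : ℕ} {H : Fin n → HalfSpace d} {w : Vec d}
    (hw : w ∈ polyStrict H) : ∀ᶠ H' in nhds H, w ∈ polyStrict H' :=
  (Continuous.tendsto (f := fun H' : Fin n → HalfSpace d => (H', w)) (by fun_prop) H).eventually
    (eventually_mem_polyStrict hw)

/-- Every point of the compact frontier of V violates an inequality of H, and by compactness this
persists for all H' near H. The connected set `polyInter H'` meets V and avoids its frontier, so it
stays in V. -/
theorem eventually_polyInter_subset {d n : ℕ} {H : Fin n → HalfSpace d}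
    (hs : (polyStrict H).Nonempty) {V : Set (Vec d)} (hV : IsOpen V)
    (hb : Bornology.IsBounded V) (hHV : polyInter H ⊆ V) :
    ∀ᶠ H' in nhds H, polyInter H' ⊆ V := by
  obtain ⟨p, hp⟩ := hs
  have hcomp : IsCompact (frontier V) :=
    Metric.isCompact_of_isClosed_isBounded isClosed_frontier
      (hb.closure.subset frontier_subset_closure)
  have h1 : ∀ᶠ H' in nhds H, ∀ w ∈ frontier V, w ∉ polyInter H' := by
    refine hcomp.eventually_forall_of_forall_eventually fun w hw => ?_
    have hwn : w ∉ polyInter H := fun h => by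
      have := hHV h
      rw [hV.frontier_eq] at hw
      exact hw.2 this
    rw [mem_polyInter] at hwn
    push Not at hwn
    obtain ⟨i, hi⟩ := hwn
    have c1 : Continuous fun q : (Fin n → HalfSpace d) × Vec d =>
        inner ℝ q.2 ((q.1 i).1 : Vec d) := by fun_prop
    have c2 : Continuous fun q : (Fin n → HalfSpace d) × Vec d => (q.1 i).2 := by fun_prop
    filter_upwards [c2.continuousAt.eventually_lt c1.continuousAt hi] with q hq hmem
    exact (mem_polyInter.1 hmem i).not_gt hq
  filter_upwards [h1, eventually_polyStrict hp] with H' h2 h3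
  refine (convex_polyInter H').isPreconnected.subset_left_of_subset_union hV
    (isClosed_closure (s := V)).isOpen_compl
    (disjoint_compl_right.mono_left subset_closure) (fun w hw => ?_)
    ⟨p, polyStrict_subset _ h3, hHV (polyStrict_subset _ hp)⟩
  by_cases hwV : w ∈ V
  · exact Or.inl hwV
  · refine Or.inr fun hcl => h2 w ?_ hw
    rw [hV.frontier_eq]
    exact ⟨hcl, hwV⟩

theorem polyInter_subset_closure {d n : ℕ} {H : Fin n → HalfSpace d}
    (hs : (polyStrict H).Nonempty) : polyInter H ⊆ closure (polyStrict H) := by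
  have h := (convex_polyInter H).closure_interior_eq_closure_of_nonempty_interior
    (by rwa [interior_polyInter])
  rw [← interior_polyInter, h]
  exact subset_closure

/-- Points of the polyhedron are limits of strictly interior points, and strict inequalities survive
a perturbation of H; compactness makes the choice uniform. -/
theorem eventually_subset_thickening_polyInter {d n : ℕ} {H : Fin n → HalfSpace d}
    (hs : (polyStrict H).Nonempty) (hb : Bornology.IsBounded (polyInter H)) {ε : ℝ} (hε : 0 < ε) :
    ∀ᶠ H' in nhds H, ∀ w ∈ polyInter H, ∃ z ∈ polyInter H', dist w z < ε := by
  have hcomp : IsCompact (polyInter H) :=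
    Metric.isCompact_of_isClosed_isBounded (isClosed_polyInter H) hb
  refine hcomp.eventually_forall_of_forall_eventually fun w hw => ?_
  obtain ⟨z, hz, hwz⟩ := Metric.mem_closure_iff.1 (polyInter_subset_closure hs hw) ε hε
  have c1 : Continuous fun q : (Fin n → HalfSpace d) × Vec d => dist q.2 z := by fun_prop
  have h2 : ∀ᶠ q : (Fin n → HalfSpace d) × Vec d in nhds (H, w), z ∈ polyStrict q.1 :=
    (continuous_fst.tendsto (H, w)).eventually (eventually_polyStrict hz)
  filter_upwards [h2, c1.continuousAt.eventually_lt continuousAt_const hwz] with q h3 h4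
  exact ⟨z, polyStrict_subset _ h3, h4⟩

theorem coe_interBody {d n : ℕ} {H : Fin n → ExtHalfSpace d} {K : ConvexBody (Vec d)}
    (hK : (K : Set (Vec d)) = ⋂ i, (H i).toSet) : interBody H = K := by
  have h : ∃ K : ConvexBody (Vec d), (K : Set (Vec d)) = ⋂ i, (H i).toSet := ⟨K, hK⟩
  rw [interBody, dif_pos h]
  exact ConvexBody.ext (h.choose_spec.trans hK.symm)

theorem iInter_toSet_inl {d n : ℕ} (H : Fin n → HalfSpace d) :
    (⋂ i, ExtHalfSpace.toSet (Sum.inl (H i))) = polyInter H := rfl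

theorem coe_interBody_inl {d n : ℕ} {H : Fin n → HalfSpace d}
    (hb : Bornology.IsBounded (polyInter H)) (hne : (polyInter H).Nonempty) :
    (interBody (fun i => Sum.inl (H i)) : Set (Vec d)) = polyInter H := by
  rw [coe_interBody (K := ⟨polyInter H, convex_polyInter H,
    Metric.isCompact_of_isClosed_isBounded (isClosed_polyInter H) hb, hne⟩) rfl]
  rfl

theorem eventually_isBounded {d n : ℕ} {H : Fin n → HalfSpace d}
    (hb : Bornology.IsBounded (polyInter H)) (hs : (polyStrict H).Nonempty) :
    ∀ᶠ H' in nhds H, Bornology.IsBounded (polyInter H') := by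
  obtain ⟨R, hR⟩ := hb.subset_ball 0
  filter_upwards [eventually_polyInter_subset hs Metric.isOpen_ball Metric.isBounded_ball hR]
    with H' h
  exact Metric.isBounded_ball.subset h

/-- The two preceding perturbation results bound the two halves of the Hausdorff distance. -/
theorem continuousAt_interBody_inl {d n : ℕ} {H : Fin n → HalfSpace d}
    (hb : Bornology.IsBounded (polyInter H)) (hs : (polyStrict H).Nonempty) :
    ContinuousAt (fun H' : Fin n → HalfSpace d => interBody fun i => Sum.inl (H' i)) H := by
  rw [Metric.continuousAt_iff']
  intro ε hε
  have hε2 : 0 < ε / 2 := by linarith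
  obtain ⟨p, hp⟩ := hs
  filter_upwards [eventually_isBounded hb ⟨p, hp⟩, eventually_polyStrict hp,
    eventually_subset_thickening_polyInter ⟨p, hp⟩ hb hε2,
    eventually_polyInter_subset ⟨p, hp⟩ (Metric.isOpen_thickening (δ := ε / 2)) (hb.thickening)
      (Metric.self_subset_thickening hε2 _)] with H' h1 h2 h3 h4
  rw [← ConvexBody.hausdorffDist_coe, coe_interBody_inl hb ⟨p, polyStrict_subset _ hp⟩,
    coe_interBody_inl h1 ⟨p, polyStrict_subset _ h2⟩]
  refine lt_of_le_of_lt (Metric.hausdorffDist_le_of_mem_dist hε2.le (fun x hx => ?_)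
    fun x hx => ?_) (by linarith : ε / 2 < ε)
  · obtain ⟨z, hz, hd⟩ := Metric.mem_thickening_iff.1 (h4 hx)
    exact ⟨z, hz, hd.le⟩
  · obtain ⟨z, hz, hd⟩ := h3 x hx
    exact ⟨z, hz, hd.le⟩

/-- Interior points and irredundancy are witnessed by finitely many points satisfying strict
inequalities, which stay valid nearby with the same witnesses. -/
theorem isOpen_facetFamilies (d n : ℕ) : IsOpen (facetFamilies d n) := by
  rw [isOpen_iff_mem_nhds]
  rintro H ⟨hb, ⟨p, hp⟩, hirr⟩
  have h1 : ∀ᶠ H' in nhds H, Irredundant H' := by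
    simp only [Irredundant, Filter.eventually_all]
    intro i
    obtain ⟨w, hw, hwi⟩ := hirr i
    have h2 : ∀ᶠ H' : Fin n → HalfSpace d in nhds H,
        ∀ j, j ≠ i → inner ℝ w ((H' j).1 : Vec d) < (H' j).2 := by
      simp only [Filter.eventually_all]
      intro j hj
      have c1 : Continuous fun H' : Fin n → HalfSpace d => inner ℝ w ((H' j).1 : Vec d) := by
        fun_prop
      have c2 : Continuous fun H' : Fin n → HalfSpace d => (H' j).2 := by fun_prop
      exact c1.continuousAt.eventually_lt c2.continuousAt (hw j hj)
    have h3 : ∀ᶠ H' : Fin n → HalfSpace d in nhds H, (H' i).2 < inner ℝ w ((H' i).1 : Vec d) := by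
      have c1 : Continuous fun H' : Fin n → HalfSpace d => inner ℝ w ((H' i).1 : Vec d) := by
        fun_prop
      have c2 : Continuous fun H' : Fin n → HalfSpace d => (H' i).2 := by fun_prop
      exact c2.continuousAt.eventually_lt c1.continuousAt hwi
    filter_upwards [h2, h3] with H' h4 h5 using ⟨w, h4, h5⟩
  filter_upwards [eventually_isBounded hb ⟨p, hp⟩, eventually_polyStrict hp, h1]
    with H' h2 h3 h4 using ⟨h2, ⟨p, h3⟩, h4⟩

/-! ### Polytopes with n facets and the families that describe them -/

theorem two_le_encard_of {n : ℕ} (hn : 2 ≤ n) : (2 : ℕ∞) ≤ (n : ℕ∞) := by exact_mod_cast hn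

/-- The families of extended half-spaces whose intersection is a polytope with `n` facets. -/
def goodFamilies (d n : ℕ) : Set (Fin n → ExtHalfSpace d) :=
  {H | ∃ K ∈ polytopes d n, (K : Set (Vec d)) = ⋂ i, (H i).toSet}

theorem interior_nonempty_of_mem_polytopes {d n : ℕ} (hn : 2 ≤ n) {K : ConvexBody (Vec d)}
    (hK : K ∈ polytopes d n) : (interior (K : Set (Vec d))).Nonempty :=
  interior_nonempty_of_encard_faces K.convex (by rw [hK.2]; exact two_le_encard_of hn)

theorem mem_polytopes_of_facetFamilies {d n : ℕ} {H : Fin n → HalfSpace d}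
    (hH : H ∈ facetFamilies d n) {K : ConvexBody (Vec d)} (hK : (K : Set (Vec d)) = polyInter H) :
    K ∈ polytopes d n := by
  refine ⟨⟨H, hK⟩, ?_⟩
  rw [hK, hH.2.2.encard_faces hH.2.1, Fintype.card_fin]

theorem facetFamilies_of_polytopes {d n : ℕ} (hn : 2 ≤ n) {K : ConvexBody (Vec d)}
    (hK : K ∈ polytopes d n) {H : Fin n → HalfSpace d} (hH : (K : Set (Vec d)) = polyInter H) :
    H ∈ facetFamilies d n := by
  have hs : (polyStrict H).Nonempty := by
    rw [← interior_polyInter, ← hH]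
    exact interior_nonempty_of_mem_polytopes hn hK
  refine ⟨hH ▸ K.isBounded, hs, irredundant_of_encard hs ?_⟩
  rw [← hH, hK.2, Fintype.card_fin]

/-- The improper half-space ∅ cannot occur because the body is nonempty, and ℝ^d imposes no
condition. The proper members alone thus cut out the body, and n facets require n of them. -/
theorem exists_left_of_goodFamilies {d n : ℕ} (hn : 2 ≤ n) {H : Fin n → ExtHalfSpace d}
    (hH : H ∈ goodFamilies d n) : ∃ G ∈ facetFamilies d n, H = fun i => Sum.inl (G i) := by
  classical
  obtain ⟨K, hK, hKH⟩ := hH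
  suffices h : ∀ i, ∃ g, H i = Sum.inl g by
    choose G hG using h
    have e : H = fun i => Sum.inl (G i) := funext hG
    refine ⟨G, facetFamilies_of_polytopes hn hK ?_, e⟩
    rw [hKH, e, iInter_toSet_inl]
  let ι := {i // ∃ g, H i = Sum.inl g}
  let G : ι → HalfSpace d := fun i => i.2.choose
  have hG : ∀ i : ι, H i = Sum.inl (G i) := fun i => i.2.choose_spec
  have hKG : (K : Set (Vec d)) = polyInter G := by
    rw [hKH]
    refine subset_antisymm (fun w hw => mem_iInter.2 fun i => ?_) fun w hw => mem_iInter.2 fun i => ?_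
    · have := mem_iInter.1 hw i.1
      rwa [hG] at this
    · rcases hi : H i with g | b
      · have h2 := mem_iInter.1 hw ⟨i, g, hi⟩
        have h3 : Sum.inl g = (Sum.inl (G ⟨i, g, hi⟩) : ExtHalfSpace d) :=
          hi.symm.trans (hG ⟨i, g, hi⟩)
        rw [Sum.inl_injective h3]
        exact h2
      · cases b
        · obtain ⟨z, hz⟩ := K.nonempty
          rw [hKH] at hz
          have := mem_iInter.1 hz i
          rw [hi] at this
          exact this.elim
        · exact mem_univ _
  have hle := encard_faces_le G
  rw [← hKG, hK.2] at hle
  have hle' : n ≤ Fintype.card ι := by exact_mod_cast hle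
  intro i
  by_contra hi
  have := Fintype.card_subtype_lt (p := fun i => ∃ g, H i = Sum.inl g) hi
  rw [Fintype.card_fin] at this
  exact absurd hle' (not_le.2 this)

theorem goodFamilies_eq {d n : ℕ} (hn : 2 ≤ n) :
    goodFamilies d n = (fun G i => Sum.inl (G i)) '' facetFamilies d n := by
  refine subset_antisymm (fun H hH => ?_) ?_
  · obtain ⟨G, hG, rfl⟩ := exists_left_of_goodFamilies hn hH
    exact ⟨G, hG, rfl⟩
  · rintro _ ⟨G, hG, rfl⟩
    have hc := coe_interBody_inl hG.1 (hG.2.1.mono (polyStrict_subset G))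
    exact ⟨_, mem_polytopes_of_facetFamilies hG hc, hc⟩

/-! ### Measurability of the set of polytopes and of the intersection map -/

theorem polytopes_eq_image {d n : ℕ} (hn : 2 ≤ n) :
    polytopes d n = (fun H : Fin n → HalfSpace d => interBody fun i => Sum.inl (H i)) ''
      facetFamilies d n := by
  refine subset_antisymm (fun K hK => ?_) ?_
  · obtain ⟨H, hH⟩ := hK.1
    exact ⟨H, facetFamilies_of_polytopes hn hK hH, coe_interBody hH⟩
  · rintro _ ⟨G, hG, rfl⟩
    exact mem_polytopes_of_facetFamilies hG
      (coe_interBody_inl hG.1 (hG.2.1.mono (polyStrict_subset G)))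

/-- The open set `facetFamilies` is a countable union of compact sets, and the intersection map is
continuous on it. The polytopes are therefore a countable union of compact sets. -/
theorem measurableSet_polytopes {d n : ℕ} (hn : 2 ≤ n) : MeasurableSet (polytopes d n) := by
  obtain ⟨F, hF, hFU, hFe, -⟩ := (isOpen_facetFamilies d n).exists_iUnion_isClosed
  rw [polytopes_eq_image hn, ← hFe, image_iUnion]
  refine MeasurableSet.iUnion fun k => ?_
  rw [← inter_univ (F k), ← iUnion_compactCovering (Fin n → HalfSpace d), inter_iUnion, image_iUnion]
  refine MeasurableSet.iUnion fun m => IsClosed.measurableSet (IsCompact.isClosed ?_)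
  refine ((isCompact_compactCovering _ m).inter_left (hF k)).image_of_continuousOn fun H hH => ?_
  have hHU := hFU k hH.1
  exact (continuousAt_interBody_inl hHU.1 hHU.2.1).continuousWithinAt

theorem nonempty_halfSpace {d : ℕ} (hd : 1 ≤ d) : Nonempty (HalfSpace d) := by
  have : Nontrivial (Vec d) := by
    refine Module.nontrivial_of_finrank_pos (R := ℝ) ?_
    rw [finrank_euclideanSpace_fin]
    omega
  exact ⟨⟨_, (NormedSpace.sphere_nonempty.2 zero_le_one :
    (Metric.sphere (0 : Vec d) 1).Nonempty).some_mem⟩, 0⟩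

/-- Recovers proper half-spaces from extended ones. The value at improper half-spaces is an
arbitrary half-space, which exists because d ≥ 1. -/
theorem exists_measurable_left {d : ℕ} (hd : 1 ≤ d) (n : ℕ) :
    ∃ f : (Fin n → ExtHalfSpace d) → (Fin n → HalfSpace d),
      Measurable f ∧ ∀ G, f (fun i => Sum.inl (G i)) = G := by
  obtain ⟨g⟩ := nonempty_halfSpace hd
  refine ⟨fun H i => Sum.elim id (fun _ => g) (H i), ?_, fun G => rfl⟩
  refine measurable_pi_lambda _ fun i => ?_
  exact (measurable_id.sumElim measurable_const).comp (measurable_pi_apply i)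

theorem measurableSet_goodFamilies {d n : ℕ} (hd : 1 ≤ d) (hn : 2 ≤ n) :
    MeasurableSet (goodFamilies d n) := by
  obtain ⟨f, hf, hfl⟩ := exists_measurable_left hd n
  have e : goodFamilies d n = f ⁻¹' facetFamilies d n ∩
      ⋂ i, (fun H : Fin n → ExtHalfSpace d => H i) ⁻¹' range Sum.inl := by
    rw [goodFamilies_eq hn]
    ext H
    simp only [mem_image, mem_inter_iff, mem_preimage, mem_iInter, mem_range]
    constructor
    · rintro ⟨G, hG, rfl⟩
      exact ⟨by rwa [hfl], fun i => ⟨_, rfl⟩⟩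
    · rintro ⟨h1, h2⟩
      choose G hG using h2
      have : H = fun i => Sum.inl (G i) := funext fun i => (hG i).symm
      subst this
      rw [hfl] at h1
      exact ⟨G, h1, rfl⟩
  rw [e]
  exact (hf (isOpen_facetFamilies d n).measurableSet).inter
    (MeasurableSet.iInter fun i => measurable_pi_apply i measurableSet_range_inl)

open Classical in
/-- The body `H₁ ∩ ⋯ ∩ Hₙ` if it is a polytope with `n` facets, and `{0}` otherwise. -/
noncomputable def polyBody {d n : ℕ} (H : Fin n → ExtHalfSpace d) : ConvexBody (Vec d) :=
  if H ∈ goodFamilies d n then interBody H else 0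

theorem coe_polyBody {d n : ℕ} {H : Fin n → ExtHalfSpace d} (hH : H ∈ goodFamilies d n) :
    (polyBody H : Set (Vec d)) = ⋂ i, (H i).toSet := by
  obtain ⟨K, hK, hKH⟩ := id hH
  rw [polyBody, if_pos hH, coe_interBody hKH, hKH]

theorem polyBody_mem {d n : ℕ} {H : Fin n → ExtHalfSpace d} (hH : H ∈ goodFamilies d n) :
    polyBody H ∈ polytopes d n := by
  obtain ⟨K, hK, hKH⟩ := id hH
  rwa [polyBody, if_pos hH, coe_interBody hKH]

/-- `polyBody` is continuous in the half-spaces on the good families and constant elsewhere; it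
replaces `interBody`, which is not controlled off the good families. -/
theorem measurable_polyBody {d n : ℕ} (hd : 1 ≤ d) (hn : 2 ≤ n) :
    Measurable (polyBody (d := d) (n := n)) := by
  classical
  obtain ⟨f, hf, hfl⟩ := exists_measurable_left hd n
  have h1 : Measurable ((facetFamilies d n).piecewise
      (fun H : Fin n → HalfSpace d => interBody fun i => Sum.inl (H i)) 0) :=
    ContinuousOn.measurable_piecewise
      (fun H hH => (continuousAt_interBody_inl hH.1 hH.2.1).continuousWithinAt)
      continuousOn_const (isOpen_facetFamilies d n).measurableSet
  have h2 : Measurable ((goodFamilies d n).piecewise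
      (((facetFamilies d n).piecewise
        (fun H : Fin n → HalfSpace d => interBody fun i => Sum.inl (H i)) 0) ∘ f)
      fun _ => (0 : ConvexBody (Vec d))) :=
    Measurable.piecewise (measurableSet_goodFamilies hd hn) (h1.comp hf) measurable_const
  convert h2 using 1
  funext H
  by_cases hH : H ∈ goodFamilies d n
  · rw [piecewise_eq_of_mem _ _ _ hH, polyBody, if_pos hH]
    obtain ⟨G, hG, rfl⟩ := exists_left_of_goodFamilies hn hH
    rw [Function.comp_apply, hfl, piecewise_eq_of_mem _ _ _ hG]
  · rw [piecewise_eq_of_notMem _ _ _ hH, polyBody, if_neg hH]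

/-! ### Bounding half-spaces and flowers -/

/-- The term ‖w‖² cancels in the comparison of the two power distances, which leaves an affine
inequality. The degenerate case of equal spatial parts gives the improper half-spaces. -/
theorem mem_toSet_bound {d : ℕ} (x y : Pt d) (w : Vec d) :
    w ∈ (bound x y).toSet ↔ ‖w - x.1‖ ^ 2 + x.2 ≤ ‖w - y.1‖ ^ 2 + y.2 := by
  have e1 : ‖w - x.1‖ ^ 2 = ‖w‖ ^ 2 - 2 * inner ℝ w x.1 + ‖x.1‖ ^ 2 := norm_sub_sq_real _ _
  have e2 : ‖w - y.1‖ ^ 2 = ‖w‖ ^ 2 - 2 * inner ℝ w y.1 + ‖y.1‖ ^ 2 := norm_sub_sq_real _ _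
  by_cases hv : y.1 - x.1 = 0
  · have hvv : y.1 = x.1 := sub_eq_zero.1 hv
    simp only [bound, hv, dite_true]
    rw [hvv]
    by_cases hb : (0 : ℝ) ≤ y.2 + ‖x.1‖ ^ 2 - x.2 - ‖x.1‖ ^ 2
    · simp only [hb, decide_true]
      exact ⟨fun _ => by linarith, fun _ => mem_univ _⟩
    · simp only [hb, decide_false]
      exact ⟨fun h => h.elim, fun h => hb (by linarith)⟩
  · have hn : 0 < ‖y.1 - x.1‖ := norm_pos_iff.mpr hv
    simp only [bound, hv, dite_false, ExtHalfSpace.toSet, halfSpace, mem_ofPred_eq]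
    rw [real_inner_smul_right, inner_sub_right, inv_mul_le_iff₀ hn, e1, e2]
    have : ‖y.1 - x.1‖ * ((y.2 + ‖y.1‖ ^ 2 - x.2 - ‖x.1‖ ^ 2) / (2 * ‖y.1 - x.1‖))
        = (y.2 + ‖y.1‖ ^ 2 - x.2 - ‖x.1‖ ^ 2) / 2 := by
      field_simp
    rw [this]
    constructor <;> intro h <;> linarith

/-- The points whose bounding half-space does not contain the body. -/
def openFlower {d : ℕ} (p : Marked d) : Set (Pt d) :=
  {y | ∃ w ∈ p.2, ‖w - y.1‖ ^ 2 + y.2 < ‖w - p.1.1‖ ^ 2 + p.1.2}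

theorem mem_openFlower {d : ℕ} {p : Marked d} {y : Pt d} :
    y ∈ openFlower p ↔ ∃ w ∈ p.2, ‖w - y.1‖ ^ 2 + y.2 < ‖w - p.1.1‖ ^ 2 + p.1.2 := Iff.rfl

theorem mem_openFlower_iff {d : ℕ} {p : Marked d} {y : Pt d} :
    y ∈ openFlower p ↔ ¬ (p.2 : Set (Vec d)) ⊆ (bound p.1 y).toSet := by
  rw [mem_openFlower, not_subset]
  simp only [mem_toSet_bound, not_le, SetLike.mem_coe]

/-- Apart from x itself, a point lies on the arc of exactly one half-space, namely its bounding
half-space with x. The two flowers hence differ by at most a null set. -/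
theorem openFlower_eq {d : ℕ} (p : Marked d) : openFlower p = flower p \ {p.1} := by
  ext y
  by_cases hy : y = p.1
  · subst hy
    simp [mem_openFlower]
  · simp only [mem_openFlower_iff, mem_sdiff, mem_singleton_iff, hy, not_false_iff, and_true, flower,
      mem_iUnion, exists_prop, mem_arc_iff _ _ hy, mem_ofPred_eq]
    exact ⟨fun h => ⟨_, h, rfl⟩, fun ⟨_, h, e⟩ => e ▸ h⟩

/-- Membership is a strict inequality at one point of the body, and a Hausdorff-close body has a
point close to it. Joint openness is what makes the Φ-content measurable in the marked body. -/
theorem isOpen_openFlower (d : ℕ) : IsOpen {q : Marked d × Pt d | q.2 ∈ openFlower q.1} := by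
  rw [isOpen_iff_mem_nhds]
  rintro ⟨⟨x, K⟩, y⟩ ⟨w, hw, hlt⟩
  have c1 : Continuous fun q : Vec d × Pt d × Pt d => ‖q.1 - q.2.2.1‖ ^ 2 + q.2.2.2 := by fun_prop
  have c2 : Continuous fun q : Vec d × Pt d × Pt d => ‖q.1 - q.2.1.1‖ ^ 2 + q.2.1.2 := by fun_prop
  have hev := c1.continuousAt.eventually_lt (x₀ := (w, x, y)) c2.continuousAt hlt
  obtain ⟨ε, hε, h⟩ := Metric.eventually_nhds_iff.1 hev
  refine Metric.mem_nhds_iff.2 ⟨ε, hε, ?_⟩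
  rintro ⟨⟨x', K'⟩, y'⟩ hq
  simp only [Metric.mem_ball, Prod.dist_eq, sup_lt_iff] at hq
  obtain ⟨⟨hx, hK⟩, hy⟩ := hq
  rw [← ConvexBody.hausdorffDist_coe] at hK
  obtain ⟨w', hw', hd⟩ := Metric.exists_dist_lt_of_hausdorffDist_lt' hw hK
    ConvexBody.hausdorffEDist_ne_top
  refine ⟨w', hw', h (y := (w', x', y')) ?_⟩
  simp only [Prod.dist_eq, sup_lt_iff]
  exact ⟨hd, hx, hy.1, hy.2⟩

theorem measurableSet_openFlower (d : ℕ) :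
    MeasurableSet {q : Marked d × Pt d | q.2 ∈ openFlower q.1} :=
  (isOpen_openFlower d).measurableSet

theorem measurable_bound_prod (d : ℕ) : Measurable fun q : Pt d × Pt d => bound q.1 q.2 := by
  have hs : MeasurableSet {q : Pt d × Pt d | q.2.1 - q.1.1 = 0} :=
    (Measurable.sub (by fun_prop) (by fun_prop) : Measurable fun q : Pt d × Pt d => q.2.1 - q.1.1)
      (measurableSet_singleton 0)
  refine measurable_of_restrict_of_restrict_compl hs ?_ ?_
  · have e : ({q : Pt d × Pt d | q.2.1 - q.1.1 = 0}.domRestrict fun q => bound q.1 q.2) =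
        fun y => Sum.inr
        (decide (0 ≤ y.1.2.2 + ‖y.1.2.1‖ ^ 2 - y.1.1.2 - ‖y.1.1.1‖ ^ 2)) := by
      funext y
      have hy : y.1.2.1 - y.1.1.1 = 0 := y.2
      change bound y.1.1 y.1.2 = _
      simp only [bound, hy, dite_true]
    rw [e]
    refine measurable_inr.comp (measurable_to_bool ?_)
    have : MeasurableSet {y : {q : Pt d × Pt d | q.2.1 - q.1.1 = 0} |
        0 ≤ y.1.2.2 + ‖y.1.2.1‖ ^ 2 - y.1.1.2 - ‖y.1.1.1‖ ^ 2} :=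
      measurableSet_le measurable_const (by fun_prop)
    convert this using 1
    ext y
    simp
  · have e : ({q : Pt d × Pt d | q.2.1 - q.1.1 = 0}ᶜ.domRestrict fun q => bound q.1 q.2) =
        fun y => Sum.inl
        ((⟨‖y.1.2.1 - y.1.1.1‖⁻¹ • (y.1.2.1 - y.1.1.1), by
          have hy : ¬ (y.1.2.1 - y.1.1.1 = 0) := y.2
          simp [norm_smul, inv_mul_cancel₀ (norm_ne_zero_iff.mpr hy)]⟩ :
          Metric.sphere (0 : Vec d) 1),
          (y.1.2.2 + ‖y.1.2.1‖ ^ 2 - y.1.1.2 - ‖y.1.1.1‖ ^ 2) / (2 * ‖y.1.2.1 - y.1.1.1‖)) := by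
      funext y
      have hy : ¬ (y.1.2.1 - y.1.1.1 = 0) := y.2
      change bound y.1.1 y.1.2 = _
      simp only [bound, hy, dite_false]
    rw [e]
    refine measurable_inl.comp (Measurable.prodMk (Measurable.subtype_mk ?_) ?_)
    · fun_prop
    · fun_prop

/-! ### Measurability of the shape and of the spaces of polytopes -/

theorem continuous_smul_body (d : ℕ) :
    Continuous fun q : ℝ × ConvexBody (Vec d) => q.1 • q.2 := by
  rw [continuous_iff_continuousAt]
  rintro ⟨a, K⟩
  obtain ⟨R, hR0, hR⟩ := K.isBounded.exists_pos_norm_le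
  -- The factor 2 makes the bound strictly larger than the Hausdorff distance, so that approximating
  -- points exist; distance zero is treated separately.
  have key : ∀ q : ℝ × ConvexBody (Vec d),
      dist (q.1 • q.2) (a • K) ≤ |q.1| * (2 * dist q.2 K) + |q.1 - a| * R := by
    rintro ⟨b, L⟩
    rw [← ConvexBody.hausdorffDist_coe]
    rcases (dist_nonneg (x := L) (y := K)).eq_or_lt with h0 | h0
    · have hLK : L = K := dist_eq_zero.1 h0.symm
      subst hLK
      simp only [dist_self, mul_zero, zero_add]
      refine Metric.hausdorffDist_le_of_mem_dist (by positivity) ?_ ?_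
      all_goals
        rintro _ ⟨w, hw, rfl⟩
      · refine ⟨a • w, ⟨w, hw, rfl⟩, ?_⟩
        change dist (b • w) (a • w) ≤ _
        rw [dist_eq_norm, ← sub_smul, norm_smul, Real.norm_eq_abs]
        gcongr
        exact hR w hw
      · refine ⟨b • w, ⟨w, hw, rfl⟩, ?_⟩
        change dist (a • w) (b • w) ≤ _
        rw [dist_comm, dist_eq_norm, ← sub_smul, norm_smul, Real.norm_eq_abs]
        gcongr
        exact hR w hw
    have hlt : Metric.hausdorffDist (L : Set (Vec d)) K < 2 * dist L K := by
      rw [ConvexBody.hausdorffDist_coe]; linarith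
    have main : ∀ w ∈ L, ∀ z ∈ K, dist w z < 2 * dist L K →
        dist (b • w) (a • z) ≤ |b| * (2 * dist L K) + |b - a| * R := by
      intro w hw z hz hwz
      refine (dist_triangle _ (b • z) _).trans (add_le_add ?_ ?_)
      · rw [dist_smul₀, Real.norm_eq_abs]
        gcongr
      · rw [dist_eq_norm, ← sub_smul, norm_smul, Real.norm_eq_abs]
        gcongr
        exact hR z hz
    refine Metric.hausdorffDist_le_of_mem_dist (by positivity) ?_ ?_
    · rintro _ ⟨w, hw, rfl⟩
      obtain ⟨z, hz, hd⟩ := Metric.exists_dist_lt_of_hausdorffDist_lt hw hlt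
        ConvexBody.hausdorffEDist_ne_top
      exact ⟨a • z, ⟨z, hz, rfl⟩, main w hw z hz hd⟩
    · rintro _ ⟨z, hz, rfl⟩
      obtain ⟨w, hw, hd⟩ := Metric.exists_dist_lt_of_hausdorffDist_lt' hz hlt
        ConvexBody.hausdorffEDist_ne_top
      exact ⟨b • w, ⟨w, hw, rfl⟩, by rw [dist_comm]; exact main w hw z hz hd⟩
  rw [ContinuousAt, tendsto_iff_dist_tendsto_zero]
  refine squeeze_zero (fun _ => dist_nonneg) key ?_
  have c : Continuous fun q : ℝ × ConvexBody (Vec d) =>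
      |q.1| * (2 * dist q.2 K) + |q.1 - a| * R := by fun_prop
  have := c.tendsto (a, K)
  simpa using this

theorem measurable_shape (M : Model) (d : ℕ) :
    Measurable fun p : Marked d => shape M p := by
  have h1 : Measurable fun p : Marked d => ((Real.sqrt (M.kappa * p.1.2))⁻¹, p.2) := by
    fun_prop
  exact (continuous_smul_body d).measurable.comp h1

theorem isOpen_subset_ball (d : ℕ) :
    IsOpen {q : ℝ × ConvexBody (Vec d) | (q.2 : Set (Vec d)) ⊆ Metric.ball 0 q.1} := by
  rw [isOpen_iff_mem_nhds]
  rintro ⟨r, K⟩ hK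
  obtain ⟨w, hw, hmax⟩ := K.isCompact.exists_isMaxOn K.nonempty
    (f := fun w : Vec d => ‖w‖) (by fun_prop)
  have hwr : ‖w‖ < r := by simpa using hK hw
  have hε : 0 < (r - ‖w‖) / 2 := by linarith
  refine Metric.mem_nhds_iff.2 ⟨(r - ‖w‖) / 2, hε, ?_⟩
  rintro ⟨s, L⟩ hq z hz
  simp only [Metric.mem_ball, Prod.dist_eq, sup_lt_iff] at hq
  obtain ⟨hs, hL⟩ := hq
  rw [← ConvexBody.hausdorffDist_coe] at hL
  obtain ⟨z', hz', hd⟩ := Metric.exists_dist_lt_of_hausdorffDist_lt hz hL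
    ConvexBody.hausdorffEDist_ne_top
  rw [Real.dist_eq, abs_lt] at hs
  have h1 : ‖z'‖ ≤ ‖w‖ := hmax hz'
  have h2 : ‖z‖ ≤ ‖z'‖ + dist z z' := by
    rw [dist_eq_norm]; exact norm_le_norm_add_norm_sub' z z'
  rw [mem_ball_zero_iff]
  linarith [hs.1]

theorem measurableSet_markedPolytopes (M : Model) (d : ℕ) {n : ℕ} (hn : 2 ≤ n) :
    MeasurableSet (markedPolytopes M d n) := by
  have h0 : MeasurableSet {p : Marked d | p.1.1 = 0} :=
    (measurable_fst.comp measurable_fst) (measurableSet_singleton 0)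
  have h1 : MeasurableSet {p : Marked d | p.2 ∈ polytopes d n} :=
    measurable_snd (measurableSet_polytopes hn)
  cases M with
  | beta =>
    have h2 : MeasurableSet {p : Marked d | 0 ≤ p.1.2} :=
      measurableSet_le measurable_const (by fun_prop)
    exact h0.inter (h2.inter h1)
  | betaPrime =>
    have h2 : MeasurableSet {p : Marked d | p.1.2 < 0} :=
      measurableSet_lt (by fun_prop) measurable_const
    have h3 : Measurable fun p : Marked d => (Real.sqrt (-p.1.2), p.2) := by fun_prop
    exact h0.inter (h2.inter (h1.inter (h3 (isOpen_subset_ball d).measurableSet)))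

theorem measurableSet_shapes (M : Model) (d : ℕ) {n : ℕ} (hn : 2 ≤ n) :
    MeasurableSet (shapes M d n) := by
  cases M with
  | beta => exact measurableSet_polytopes hn
  | betaPrime =>
    refine (measurableSet_polytopes hn).inter ?_
    have h2 : Measurable fun K : ConvexBody (Vec d) => ((1 : ℝ), K) := by fun_prop
    exact h2 (isOpen_subset_ball d).measurableSet

theorem measurableSet_centered (d : ℕ) : MeasurableSet (centered d) :=
  (measurable_fst.comp measurable_fst) (measurableSet_singleton 0)

/-! ### Point configurations as measures -/

section PointMeasure

variable {E : Type*} [MeasurableSpace E]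

/-- The counting measure of a set of points, as a sum of Dirac measures. -/
noncomputable def pointMeasure (A : Set E) : Measure E :=
  Measure.sum fun x : A => Measure.dirac (x : E)

theorem pointMeasure_apply (A : Set E) {s : Set E} (hs : MeasurableSet s) :
    pointMeasure A s = ((A ∩ s).encard : ℝ≥0∞) := by
  rw [pointMeasure, Measure.sum_apply _ hs, ← ENNReal.tsum_set_one]
  simp only [Measure.dirac_apply' _ hs]
  rw [tsum_subtype A (s.indicator (1 : E → ℝ≥0∞)), tsum_subtype (A ∩ s) (fun _ => (1 : ℝ≥0∞))]
  refine tsum_congr fun x => ?_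
  rw [indicator_indicator]
  rfl

/-- A kernel that sends a measure that is finite on the spanning sets of `μ` to itself. -/
noncomputable def regPiece (μ : Measure E) [SigmaFinite μ] (p : ℕ × ℕ) : Kernel (Measure E) E := by
  classical
  exact Kernel.piecewise
    (s := {m : Measure E | m (disjointed (spanningSets μ) p.1) ∈ Ico (p.2 : ℝ≥0∞) (p.2 + 1)})
    (Measure.measurable_coe (MeasurableSet.disjointed (measurableSet_spanningSets μ) p.1)
      measurableSet_Ico)
    (Kernel.restrict ⟨id, measurable_id⟩
      (MeasurableSet.disjointed (measurableSet_spanningSets μ) p.1)) 0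

/-- The sum of the kernels `regPiece`. -/
noncomputable def regKernel (μ : Measure E) [SigmaFinite μ] : Kernel (Measure E) E :=
  Kernel.sum (regPiece μ)

theorem regPiece_apply (μ : Measure E) [SigmaFinite μ] (p : ℕ × ℕ) (m : Measure E)
    [Decidable (m (disjointed (spanningSets μ) p.1) ∈ Ico (p.2 : ℝ≥0∞) (p.2 + 1))] :
    regPiece μ p m = if m (disjointed (spanningSets μ) p.1) ∈ Ico (p.2 : ℝ≥0∞) (p.2 + 1) then
      m.restrict (disjointed (spanningSets μ) p.1) else 0 := by
  classical
  rw [regPiece, Kernel.piecewise_apply]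
  simp only [mem_ofPred_eq]
  split_ifs
  · rw [Kernel.restrict_apply]; rfl
  · rfl

instance (μ : Measure E) [SigmaFinite μ] (p : ℕ × ℕ) : IsFiniteKernel (regPiece μ p) := by
  classical
  refine ⟨⟨p.2 + 1, by finiteness, fun m => ?_⟩⟩
  rw [regPiece_apply]
  split_ifs with h
  · rw [Measure.restrict_apply_univ]; exact h.2.le
  · simp

instance (μ : Measure E) [SigmaFinite μ] : IsSFiniteKernel (regKernel μ) :=
  Kernel.isSFiniteKernel_sum

/-- This kernel is an s-finite substitute for the identity m ↦ m. The space is cut into disjoint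
pieces and the mass on each piece is sorted into the intervals [i, i + 1), so every summand is a
finite kernel; a mass that is finite falls into exactly one interval. -/
theorem regKernel_apply (μ : Measure E) [SigmaFinite μ] (m : Measure E)
    (hm : ∀ k, m (spanningSets μ k) ≠ ∞) : regKernel μ m = m := by
  classical
  have hmd : ∀ k, m (disjointed (spanningSets μ) k) ≠ ∞ := fun k =>
    ne_top_of_le_ne_top (hm k) (measure_mono (disjointed_subset _ _))
  have hms : ∀ k, MeasurableSet (disjointed (spanningSets μ) k) := fun k =>
    MeasurableSet.disjointed (measurableSet_spanningSets μ) k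
  ext s hs
  rw [regKernel, Kernel.sum_apply' _ _ hs, ENNReal.tsum_prod (f := fun k i => regPiece μ (k, i) m s)]
  have e1 : ∀ k, ∑' i : ℕ, regPiece μ (k, i) m s = m (s ∩ disjointed (spanningSets μ) k) := by
    intro k
    set a := m (disjointed (spanningSets μ) k) with ha
    have hmem : ∀ i : ℕ, a ∈ Ico (i : ℝ≥0∞) (i + 1) ↔ i = ⌊a.toReal⌋₊ := by
      intro i
      have h1 : (i : ℝ≥0∞) ≤ a ↔ (i : ℝ) ≤ a.toReal := by
        rw [← ENNReal.ofReal_le_iff_le_toReal (hmd k), ENNReal.ofReal_natCast]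
      have h2 : a < (i : ℝ≥0∞) + 1 ↔ a.toReal < i + 1 := by
        rw [← ENNReal.lt_ofReal_iff_toReal_lt (hmd k)]
        rw [ENNReal.ofReal_add (by positivity) zero_le_one, ENNReal.ofReal_natCast,
          ENNReal.ofReal_one]
      rw [mem_Ico, h1, h2, eq_comm, Nat.floor_eq_iff ENNReal.toReal_nonneg]
    rw [tsum_eq_single ⌊a.toReal⌋₊]
    · rw [regPiece_apply, if_pos ((hmem _).2 rfl), Measure.restrict_apply hs]
    · intro i hi
      rw [regPiece_apply, if_neg fun h => hi ((hmem i).1 h)]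
      rfl
  simp only [e1]
  rw [← measure_iUnion (fun i j hij => ((disjoint_disjointed _ hij).mono inter_subset_right
    inter_subset_right)) fun k => hs.inter (hms k), ← inter_iUnion, iUnion_disjointed,
    iUnion_spanningSets, inter_univ]

end PointMeasure

/-! ### The Mecke formula -/

section Mecke

variable {E Ω : Type*} [MeasurableSpace E] [MeasurableSpace Ω] {X : Ω → Set E} {μ : Measure E}
  {Pr : Measure Ω}

theorem measurable_ENat_coe : Measurable fun k : ℕ∞ => (k : ℝ≥0∞) := measurable_from_top

theorem IsPoissonProcess.measurable_apply (hX : IsPoissonProcess X μ Pr) {A : Set E}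
    (hA : MeasurableSet A) : Measurable fun ω => pointMeasure (X ω) A := by
  simp only [pointMeasure_apply _ hA]
  exact measurable_ENat_coe.comp (hX.measurable_count A hA)

theorem IsPoissonProcess.measurable_pointMeasure (hX : IsPoissonProcess X μ Pr) :
    Measurable fun ω => pointMeasure (X ω) :=
  Measure.measurable_of_measurable_coe _ fun _ hA => hX.measurable_apply hA

theorem IsPoissonProcess.lintegral_count (hX : IsPoissonProcess X μ Pr) {A : Set E}
    (hA : MeasurableSet A) (hμ : μ A ≠ ∞) {g : ℝ≥0∞ → ℝ≥0∞} (hg : Measurable g) :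
    ∫⁻ ω, g (pointMeasure (X ω) A) ∂Pr =
      ∑' n : ℕ, ENNReal.ofReal (Real.exp (-(μ A).toNNReal) * (μ A).toNNReal ^ n / n.factorial)
        * g n := by
  simp only [pointMeasure_apply _ hA]
  have hg' : Measurable fun k : ℕ∞ => g k := hg.comp measurable_ENat_coe
  have h1 : ∫⁻ ω, g (((X ω ∩ A).encard : ℕ∞) : ℝ≥0∞) ∂Pr =
      ∫⁻ k : ℕ∞, g k ∂(Pr.map fun ω => (X ω ∩ A).encard) := by
    rw [lintegral_map hg' (hX.measurable_count A hA)]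
  rw [h1, hX.map_count A hA hμ, lintegral_map hg' measurable_from_top,
    poissonMeasure, lintegral_sum_measure]
  refine tsum_congr fun n => ?_
  rw [lintegral_smul_measure, lintegral_dirac]
  rfl

/-- The Poisson weights satisfy (n + 1) p(n + 1) = λ p(n). This is Mecke's formula for a single
count. -/
theorem IsPoissonProcess.lintegral_count_mul (hX : IsPoissonProcess X μ Pr) {A : Set E}
    (hA : MeasurableSet A) (hμ : μ A ≠ ∞) {g : ℝ≥0∞ → ℝ≥0∞} (hg : Measurable g) :
    ∫⁻ ω, pointMeasure (X ω) A * g (pointMeasure (X ω) A) ∂Pr =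
      μ A * ∫⁻ ω, g (pointMeasure (X ω) A + 1) ∂Pr := by
  rw [hX.lintegral_count hA hμ (g := fun t => t * g t) (measurable_id.mul hg),
    hX.lintegral_count hA hμ (g := fun t => g (t + 1)) (hg.comp (measurable_id.add_const 1)),
    tsum_eq_zero_add' ENNReal.summable, ← ENNReal.tsum_mul_left]
  simp only [Nat.cast_zero, zero_mul, mul_zero, zero_add]
  refine tsum_congr fun n => ?_
  have h2 : μ A = ENNReal.ofReal ((μ A).toNNReal : ℝ) := by
    rw [ENNReal.ofReal_coe_nnreal, ENNReal.coe_toNNReal hμ]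
  set l : ℝ := ((μ A).toNNReal : ℝ) with hl
  have hl0 : 0 ≤ l := NNReal.coe_nonneg _
  rw [← mul_assoc, ← mul_assoc, h2, ← ENNReal.ofReal_mul hl0]
  have h3 : ((n + 1 : ℕ) : ℝ≥0∞) = ENNReal.ofReal ((n : ℝ) + 1) := by
    rw [← ENNReal.ofReal_natCast]; push_cast; rfl
  rw [h3, ← ENNReal.ofReal_mul (by positivity)]
  congr 2
  · rw [Nat.factorial_succ, pow_succ]
    push_cast
    field_simp
  · rw [← h3]; push_cast; rfl

theorem IsPoissonProcess.iIndepFun_pointMeasure (hX : IsPoissonProcess X μ Pr) {σ : Type*}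
    [Fintype σ] {A : σ → Set E} (hA : ∀ s, MeasurableSet (A s))
    (hdisj : Pairwise fun i j => Disjoint (A i) (A j)) :
    iIndepFun (fun s ω => pointMeasure (X ω) (A s)) Pr := by
  classical
  let e := Fintype.equivFin σ
  have h1 := hX.indep (Fintype.card σ) (fun i => A (e.symm i)) (fun i => hA _)
    fun i j hij => hdisj fun h => hij (e.symm.injective h)
  have h2 := (h1.precomp (g := e) e.injective).comp (fun _ k => (k : ℝ≥0∞))
    fun _ => measurable_ENat_coe
  convert h2 using 1
  funext s ω
  simp [pointMeasure_apply _ (hA s)]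

/-- The Mecke formula for the counts of a finite measurable partition. -/
theorem IsPoissonProcess.lintegral_partition [IsProbabilityMeasure Pr]
    (hX : IsPoissonProcess X μ Pr) {σ : Type*} [Fintype σ] [DecidableEq σ] {A : σ → Set E}
    (hA : ∀ s, MeasurableSet (A s)) (hdisj : Pairwise fun i j => Disjoint (A i) (A j))
    {g : (σ → ℝ≥0∞) → ℝ≥0∞} (hg : Measurable g) (s₀ : σ) (hμ : μ (A s₀) ≠ ∞) :
    ∫⁻ ω, pointMeasure (X ω) (A s₀) * g (fun s => pointMeasure (X ω) (A s)) ∂Pr =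
      μ (A s₀) *
        ∫⁻ ω, g (fun s => pointMeasure (X ω) (A s) + if s = s₀ then 1 else 0) ∂Pr := by
  have hm : ∀ s, Measurable fun ω => pointMeasure (X ω) (A s) := fun s => hX.measurable_apply (hA s)
  set T : Finset σ := Finset.univ \ {s₀} with hT
  set Y : Ω → ℝ≥0∞ := fun ω => pointMeasure (X ω) (A s₀) with hY
  set Z : Ω → (T → ℝ≥0∞) := fun ω i => pointMeasure (X ω) (A i) with hZ
  have hYm : Measurable Y := hm s₀
  have hZm : Measurable Z := measurable_pi_lambda _ fun i => hm i
  -- The count of the distinguished cell is independent of the vector of the others, so the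
  -- one-variable identity can be applied with the others frozen.
  have hind : IndepFun Y Z Pr := by
    have h := (hX.iIndepFun_pointMeasure hA hdisj).indepFun_finset {s₀} T
      (Finset.disjoint_sdiff) hm
    exact h.comp (φ := fun v : ({s₀} : Finset σ) → ℝ≥0∞ => v ⟨s₀, Finset.mem_singleton_self _⟩)
      (ψ := id) (measurable_pi_apply _) measurable_id
  let G : ℝ≥0∞ → (T → ℝ≥0∞) → (σ → ℝ≥0∞) := fun y z s =>
    if h : s = s₀ then y else z ⟨s, by simp [hT, h]⟩
  have hG : Measurable fun q : ℝ≥0∞ × (T → ℝ≥0∞) => g (G q.1 q.2) := by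
    refine hg.comp (measurable_pi_lambda _ fun s => ?_)
    by_cases h : s = s₀
    · simp only [G, h, dite_true]; exact measurable_fst
    · simp only [G, h, dite_false]
      exact (measurable_pi_apply _).comp measurable_snd
  have e1 : ∀ ω, (fun s => pointMeasure (X ω) (A s)) = G (Y ω) (Z ω) := by
    intro ω; funext s
    by_cases h : s = s₀
    · simp [G, h, hY]
    · simp [G, h, hZ]
  have e2 : ∀ ω, (fun s => pointMeasure (X ω) (A s) + if s = s₀ then 1 else 0)
      = G (Y ω + 1) (Z ω) := by
    intro ω; funext s
    by_cases h : s = s₀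
    · simp [G, h, hY]
    · simp [G, h, hZ]
  have hfub : ∀ {F : ℝ≥0∞ × (T → ℝ≥0∞) → ℝ≥0∞}, Measurable F →
      ∫⁻ ω, F (Y ω, Z ω) ∂Pr = ∫⁻ ω', ∫⁻ ω, F (Y ω, Z ω') ∂Pr ∂Pr := by
    intro F hF
    have : IsProbabilityMeasure (Pr.map Y) := Measure.isProbabilityMeasure_map hYm.aemeasurable
    have : IsProbabilityMeasure (Pr.map Z) := Measure.isProbabilityMeasure_map hZm.aemeasurable
    rw [← lintegral_map hF (hYm.prodMk hZm),
      hind.map_prod_eq_prod_map_map hYm.aemeasurable hZm.aemeasurable,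
      lintegral_prod_symm _ hF.aemeasurable, lintegral_map hF.lintegral_prod_left' hZm]
    refine lintegral_congr fun ω' => ?_
    have hF' : Measurable fun y => F (y, Z ω') := hF.comp (measurable_id.prodMk measurable_const)
    rw [lintegral_map hF' hYm]
  simp only [e1, e2]
  have hF1 : Measurable fun q : ℝ≥0∞ × (T → ℝ≥0∞) => q.1 * g (G q.1 q.2) :=
    measurable_fst.mul hG
  have hF2 : Measurable fun q : ℝ≥0∞ × (T → ℝ≥0∞) => g (G (q.1 + 1) q.2) :=
    hG.comp ((measurable_fst.add_const 1).prodMk measurable_snd)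
  have h1 := hfub hF1
  have h2 := hfub hF2
  have hmz : Measurable fun ω' => ∫⁻ ω, g (G (Y ω + 1) (Z ω')) ∂Pr := by
    have : Measurable fun q : Ω × Ω => g (G (Y q.2 + 1) (Z q.1)) :=
      hF2.comp ((hYm.comp measurable_snd).prodMk (hZm.comp measurable_fst))
    exact this.lintegral_prod_right'
  refine h1.trans ?_
  rw [h2, ← lintegral_const_mul _ hmz]
  refine lintegral_congr fun ω' => ?_
  have hG' : Measurable fun y => g (G y (Z ω')) :=
    hG.comp (f := fun y => (y, Z ω')) (measurable_id'.prodMk measurable_const)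
  exact hX.lintegral_count_mul (hA s₀) hμ hG'

theorem measure_eq_sum_fiber {ι : Type*} [Fintype ι] [DecidableEq ι] (m : Measure E) {A : ι → Set E}
    {sig : E → (ι → Bool)} (hsig : ∀ x i, sig x i = true ↔ x ∈ A i)
    (hs : ∀ s, MeasurableSet (sig ⁻¹' {s})) (i : ι) :
    m (A i) = ∑ s : ι → Bool, if s i then m (sig ⁻¹' {s}) else 0 := by
  classical
  have e : A i = ⋃ s ∈ Finset.univ.filter (fun s : ι → Bool => s i = true), sig ⁻¹' {s} := by
    ext x
    simp [← hsig]
  rw [← Finset.sum_filter, ← measure_biUnion_finset, ← e]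
  · intro s _ t _ hst
    exact Disjoint.preimage _ (disjoint_singleton.2 hst)
  · exact fun s _ => hs s

/-- The Mecke formula on product sets. -/
theorem IsPoissonProcess.mecke_rectangle [IsProbabilityMeasure Pr]
    (hX : IsPoissonProcess X μ Pr) {B : Set E} (hB : MeasurableSet B) (hμ : μ B ≠ ∞)
    {ι : Type*} [Fintype ι] {A : ι → Set E} (hA : ∀ i, MeasurableSet (A i))
    {T : ι → Set ℝ≥0∞} (hT : ∀ i, MeasurableSet (T i)) :
    ∫⁻ ω, pointMeasure (X ω) B *
        {m : Measure E | ∀ i, m (A i) ∈ T i}.indicator 1 (pointMeasure (X ω)) ∂Pr =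
      ∫⁻ x in B, ∫⁻ ω, {m : Measure E | ∀ i, m (A i) ∈ T i}.indicator 1
        (pointMeasure (X ω) + Measure.dirac x) ∂Pr ∂μ := by
  classical
  let AO : Option ι → Set E := fun o => o.elim B A
  have hAO : ∀ o, MeasurableSet (AO o) := by rintro (_ | i); exacts [hB, hA i]
  -- The signature records membership in B and in every A i. Its fibres form a finite partition of
  -- E, and each count is a sum of fibre counts, so the problem reduces to `lintegral_partition`.
  let sig : E → (Option ι → Bool) := fun x o => decide (x ∈ AO o)
  have hsig : ∀ x o, sig x o = true ↔ x ∈ AO o := fun x o => by simp [sig]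
  have hsm : Measurable sig := measurable_pi_lambda _ fun o => measurable_to_bool (by
    convert hAO o using 1
    ext x; simp [sig])
  have hs : ∀ s, MeasurableSet (sig ⁻¹' {s}) := fun s => hsm (measurableSet_singleton s)
  have hdisj : Pairwise fun s t : Option ι → Bool => Disjoint (sig ⁻¹' {s}) (sig ⁻¹' {t}) :=
    fun s t hst => Disjoint.preimage _ (disjoint_singleton.2 hst)
  let V : Set ((Option ι → Bool) → ℝ≥0∞) :=
    {v | ∀ i, (∑ s, if s (some i) then v s else 0) ∈ T i}
  have hV : MeasurableSet V := by
    have : V = ⋂ i, (fun v : (Option ι → Bool) → ℝ≥0∞ =>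
        ∑ s, if s (some i) = true then v s else 0) ⁻¹' T i := by
      ext v; simp [V]
    rw [this]
    refine MeasurableSet.iInter fun i => (Finset.measurable_sum _ fun s _ => ?_) (hT i)
    split_ifs
    · exact measurable_pi_apply s
    · exact measurable_const
  have hgm : Measurable (V.indicator (1 : ((Option ι → Bool) → ℝ≥0∞) → ℝ≥0∞)) :=
    measurable_one.indicator hV
  have key : ∀ m : Measure E, {m : Measure E | ∀ i, m (A i) ∈ T i}.indicator
      (1 : Measure E → ℝ≥0∞) m = V.indicator 1 fun s => m (sig ⁻¹' {s}) := by
    intro m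
    have : m ∈ {m : Measure E | ∀ i, m (A i) ∈ T i} ↔ (fun s => m (sig ⁻¹' {s})) ∈ V := by
      simp only [mem_ofPred_eq, V]
      refine forall_congr' fun i => ?_
      rw [show m (A i) = _ from measure_eq_sum_fiber m hsig hs (some i)]
    simp only [indicator_apply, this, Pi.one_apply]
  simp only [key]
  have hBsum : ∀ m : Measure E, m B = ∑ s : Option ι → Bool,
      if s none then m (sig ⁻¹' {s}) else 0 := fun m => measure_eq_sum_fiber m hsig hs none
  have hBU : B = ⋃ s ∈ Finset.univ.filter (fun s : Option ι → Bool => s none = true),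
      sig ⁻¹' {s} := by
    ext x
    have := hsig x none
    simp [this, AO]
  have hmeas : ∀ s : Option ι → Bool, Measurable fun ω => pointMeasure (X ω) (sig ⁻¹' {s}) :=
    fun s => hX.measurable_apply (hs s)
  have hvec : Measurable fun ω => V.indicator (1 : ((Option ι → Bool) → ℝ≥0∞) → ℝ≥0∞)
      (fun s => pointMeasure (X ω) (sig ⁻¹' {s})) :=
    hgm.comp (measurable_pi_lambda _ hmeas)
  have lhs : ∀ ω, pointMeasure (X ω) B *
      V.indicator 1 (fun s => pointMeasure (X ω) (sig ⁻¹' {s})) =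
      ∑ s ∈ Finset.univ.filter (fun s : Option ι → Bool => s none = true),
        pointMeasure (X ω) (sig ⁻¹' {s}) *
          V.indicator 1 (fun s => pointMeasure (X ω) (sig ⁻¹' {s})) := by
    intro ω
    rw [hBsum, Finset.sum_mul, Finset.sum_filter]
    refine Finset.sum_congr rfl fun s _ => ?_
    split_ifs <;> simp
  simp only [lhs]
  have hmv : ∀ s, Measurable fun ω => pointMeasure (X ω) (sig ⁻¹' {s}) *
      V.indicator (1 : ((Option ι → Bool) → ℝ≥0∞) → ℝ≥0∞)
        (fun s => pointMeasure (X ω) (sig ⁻¹' {s})) := fun s => (hmeas s).mul hvec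
  rw [lintegral_finsetSum _ fun s _ => hmv s]
  conv_rhs => rw [hBU]
  rw [lintegral_biUnion_finset (fun s _ t _ hst => hdisj hst) fun s _ => hs s]
  refine Finset.sum_congr rfl fun s hs' => ?_
  have hss : sig ⁻¹' {s} ⊆ B := by
    intro x hx
    have h1 : s none = true := (Finset.mem_filter.1 hs').2
    rw [← show sig x = s from hx] at h1
    exact (hsig x none).1 h1
  rw [hX.lintegral_partition hs hdisj hgm s (ne_top_of_le_ne_top hμ (measure_mono hss)),
    setLIntegral_congr_fun (hs s) (g := fun _ => ∫⁻ ω, V.indicator 1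
      (fun t => pointMeasure (X ω) (sig ⁻¹' {t}) + if t = s then 1 else 0) ∂Pr)
      (fun x hx => ?_), setLIntegral_const, mul_comm]
  -- Adding a Dirac mass at a point of the fibre s raises the count of that fibre by one and no
  -- other.
  refine lintegral_congr fun ω => ?_
  congr 1
  funext t
  rw [Measure.add_apply, Measure.dirac_apply' _ (hs t)]
  have hx' : sig x = s := hx
  by_cases hts : t = s
  · subst hts; simp [hx']
  · have : x ∉ sig ⁻¹' {t} := fun h => hts (h.symm.trans hx')
    simp [hts, this]

/-- **Mecke's formula.** -/
theorem IsPoissonProcess.mecke [IsProbabilityMeasure Pr] [SigmaFinite μ]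
    (hX : IsPoissonProcess X μ Pr) (hfin : ∀ ω k, (X ω ∩ spanningSets μ k).Finite)
    {f : E × Measure E → ℝ≥0∞} (hf : Measurable f) :
    ∫⁻ ω, ∫⁻ x, f (x, pointMeasure (X ω)) ∂(pointMeasure (X ω)) ∂Pr =
      ∫⁻ x, ∫⁻ ω, f (x, pointMeasure (X ω) + Measure.dirac x) ∂Pr ∂μ := by
  classical
  have hξ := hX.measurable_pointMeasure
  -- The configuration as an s-finite kernel, which is needed to form the product measure with Pr.
  set κ : Kernel Ω E := (regKernel μ).comap _ hξ with hκdef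
  have hκ : ∀ ω, κ ω = pointMeasure (X ω) := by
    intro ω
    rw [hκdef, Kernel.comap_apply]
    refine regKernel_apply μ _ fun k => ?_
    rw [pointMeasure_apply _ (measurableSet_spanningSets μ k)]
    simpa using hfin ω k
  have hm1 : Measurable fun p : Ω × E => (p.2, pointMeasure (X p.1)) :=
    measurable_snd.prodMk (hξ.comp measurable_fst)
  have hm2 : Measurable fun p : E × Ω => (p.1, pointMeasure (X p.2) + Measure.dirac p.1) := by
    refine measurable_fst.prodMk (Measurable.add (hξ.comp measurable_snd) ?_)
    exact Measure.measurable_dirac.comp measurable_fst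
  -- The two sides of the formula are integrals against `M1` and `M2`, so the claim becomes an
  -- equality of measures, to be tested on a π-system of rectangles.
  set M1 : Measure (E × Measure E) := (Pr ⊗ₘ κ).map fun p => (p.2, pointMeasure (X p.1))
  set M2 : Measure (E × Measure E) :=
    (μ.prod Pr).map fun p => (p.1, pointMeasure (X p.2) + Measure.dirac p.1)
  have h1 : ∀ f : E × Measure E → ℝ≥0∞, Measurable f →
      ∫⁻ p, f p ∂M1 = ∫⁻ ω, ∫⁻ x, f (x, pointMeasure (X ω)) ∂(pointMeasure (X ω)) ∂Pr := by
    intro f hf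
    have hf1 : Measurable fun p : Ω × E => f (p.2, pointMeasure (X p.1)) := hf.comp hm1
    rw [lintegral_map hf hm1, Measure.lintegral_compProd hf1]
    exact lintegral_congr fun ω => by rw [hκ]
  have h2 : ∀ f : E × Measure E → ℝ≥0∞, Measurable f →
      ∫⁻ p, f p ∂M2 = ∫⁻ x, ∫⁻ ω, f (x, pointMeasure (X ω) + Measure.dirac x) ∂Pr ∂μ := by
    intro f hf
    have hf2 : Measurable fun p : E × Ω => f (p.1, pointMeasure (X p.2) + Measure.dirac p.1) :=
      hf.comp hm2
    rw [lintegral_map hf hm2, lintegral_prod _ hf2.aemeasurable]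
  suffices h : M1 = M2 by rw [← h1 f hf, ← h2 f hf, h]
  have hrect : ∀ {B : Set E}, MeasurableSet B → μ B ≠ ∞ → ∀ {S : Set (Measure E)},
      MeasurableSet S → S ∈ piiUnionInter (fun A : {A : Set E // MeasurableSet A} =>
        {s | MeasurableSet[(borel ℝ≥0∞).comap fun m : Measure E => m A.1] s}) univ →
      M1 (B ×ˢ S) = M2 (B ×ˢ S) := by
    rintro B hB hμB S hSm ⟨t, -, F, hF, rfl⟩
    choose! T hT using hF
    have e1 : ∀ x ∈ t, MeasurableSet (T x) := fun x hx => (hT x hx).1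
    have e : (⋂ x ∈ t, F x) = {m : Measure E | ∀ i : t, m i.1.1 ∈ T i.1} := by
      ext m
      simp only [mem_iInter, mem_ofPred_eq, Subtype.forall]
      refine forall_congr' fun a => forall_congr' fun ha => forall_congr' fun hat => ?_
      rw [← (hT ⟨a, ha⟩ hat).2]; rfl
    rw [e] at hSm ⊢
    have := hX.mecke_rectangle hB hμB (ι := t) (A := fun i => i.1.1) (fun i => i.1.2)
      (T := fun i => T i.1) (fun i => e1 i.1 i.2)
    rw [← lintegral_indicator_one (hB.prod hSm), ← lintegral_indicator_one (hB.prod hSm),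
      h1 _ (measurable_one.indicator (hB.prod hSm)), h2 _ (measurable_one.indicator (hB.prod hSm))]
    set S := {m : Measure E | ∀ i : t, m i.1.1 ∈ T i.1}
    have hprod : ∀ (x : E) (m : Measure E), (B ×ˢ S).indicator (1 : E × Measure E → ℝ≥0∞) (x, m) =
        B.indicator 1 x * S.indicator 1 m := by
      intro x m
      by_cases hx : x ∈ B <;> by_cases hm : m ∈ S <;> simp [hx, hm]
    simp only [hprod]
    convert this using 1
    · refine lintegral_congr fun ω => ?_
      rw [lintegral_mul_const _ (measurable_one.indicator hB), lintegral_indicator_one hB]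
    · rw [← lintegral_indicator hB]
      refine lintegral_congr fun x => ?_
      by_cases hx : x ∈ B <;> simp [hx]
  -- The σ-algebra on measures is generated by the evaluations at measurable sets, and finitely many
  -- evaluation conditions at a time form a π-system.
  have hgen : (inferInstance : MeasurableSpace (E × Measure E)) = MeasurableSpace.generateFrom
      (image2 (· ×ˢ ·) {B : Set E | MeasurableSet B}
        (piiUnionInter (fun A : {A : Set E // MeasurableSet A} =>
          {s | MeasurableSet[(borel ℝ≥0∞).comap fun m : Measure E => m A.1] s}) univ)) := by
    refine (generateFrom_eq_prod MeasurableSpace.generateFrom_measurableSet ?_ ?_ ?_).symm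
    · refine (generateFrom_piiUnionInter_measurableSet
        (fun A : {A : Set E // MeasurableSet A} =>
          (borel ℝ≥0∞).comap fun m : Measure E => m A.1) univ).trans ?_
      simp only [mem_univ, iSup_pos]
      rw [Measure.instMeasurableSpace, iSup_subtype]
    · exact isCountablySpanning_measurableSet
    · exact ⟨fun _ => univ, fun _ => ⟨∅, by simp, fun _ => univ, by simp, by simp⟩,
        iUnion_const _⟩
  have hpi : IsPiSystem (image2 (· ×ˢ ·) {B : Set E | MeasurableSet B}
        (piiUnionInter (fun A : {A : Set E // MeasurableSet A} =>
          {s | MeasurableSet[(borel ℝ≥0∞).comap fun m : Measure E => m A.1] s}) univ)) :=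
    MeasurableSpace.isPiSystem_measurableSet.prod (isPiSystem_piiUnionInter _
      (fun A => @MeasurableSpace.isPiSystem_measurableSet _ ((borel ℝ≥0∞).comap _)) _)
  have hSm : ∀ S ∈ piiUnionInter (fun A : {A : Set E // MeasurableSet A} =>
          {s | MeasurableSet[(borel ℝ≥0∞).comap fun m : Measure E => m A.1] s}) univ,
      MeasurableSet S := by
    rintro S ⟨t, -, F, hF, rfl⟩
    refine Finset.measurableSet_biInter _ fun A hA => ?_
    obtain ⟨T, hT, e⟩ := hF A hA
    rw [← e]
    exact Measure.measurable_coe A.2 hT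
  -- Uniqueness from a π-system needs finite mass, hence the restriction to the spanning sets of μ.
  have hpiece : ∀ k, M1.restrict (spanningSets μ k ×ˢ univ) =
      M2.restrict (spanningSets μ k ×ˢ univ) := by
    intro k
    have hk := measurableSet_spanningSets μ k
    have hkt := (measure_spanningSets_lt_top μ k).ne
    have huniv : (univ : Set (Measure E)) ∈ piiUnionInter
        (fun A : {A : Set E // MeasurableSet A} =>
          {s | MeasurableSet[(borel ℝ≥0∞).comap fun m : Measure E => m A.1] s}) univ :=
      ⟨∅, by simp, fun _ => univ, by simp, by simp⟩
    have hkey : ∀ B : Set E, MeasurableSet B → ∀ S ∈ piiUnionInter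
        (fun A : {A : Set E // MeasurableSet A} =>
          {s | MeasurableSet[(borel ℝ≥0∞).comap fun m : Measure E => m A.1] s}) univ,
        M1.restrict (spanningSets μ k ×ˢ univ) (B ×ˢ S) =
          M2.restrict (spanningSets μ k ×ˢ univ) (B ×ˢ S) := by
      intro B hB S hS
      have hS' := hSm S hS
      rw [Measure.restrict_apply (hB.prod hS'), Measure.restrict_apply (hB.prod hS'), prod_inter_prod,
        inter_univ]
      exact hrect (hB.inter hk) (ne_top_of_le_ne_top hkt (measure_mono inter_subset_right)) hS' hS
    have hM2 : M2 (spanningSets μ k ×ˢ univ) = μ (spanningSets μ k) := by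
      rw [← lintegral_indicator_one (hk.prod MeasurableSet.univ),
        h2 _ (measurable_one.indicator (hk.prod MeasurableSet.univ)),
        ← lintegral_indicator_one hk]
      refine lintegral_congr fun x => ?_
      by_cases hx : x ∈ spanningSets μ k <;> simp [hx]
    have hM1 : M1 (spanningSets μ k ×ˢ univ) = μ (spanningSets μ k) := by
      rw [← hM2]
      exact hrect hk hkt MeasurableSet.univ huniv
    have : IsFiniteMeasure (M1.restrict (spanningSets μ k ×ˢ univ)) :=
      ⟨by rw [Measure.restrict_apply_univ, hM1]; exact hkt.lt_top⟩
    refine ext_of_generate_finite _ hgen hpi ?_ ?_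
    · rintro _ ⟨B, hB, S, hS, rfl⟩
      exact hkey B hB S hS
    · rw [Measure.restrict_apply_univ, Measure.restrict_apply_univ, hM1, hM2]
  have hU : (⋃ k, spanningSets μ k ×ˢ (univ : Set (Measure E))) = univ := by
    rw [← iUnion_prod_const, iUnion_spanningSets, univ_prod_univ]
  exact Measure.ext_of_iUnion_eq_univ hU hpiece

end Mecke

/-! ### Powers of measures and the multivariate Mecke formula -/

section ProdPow

variable {E : Type*} [MeasurableSpace E]

theorem measurable_cons (n : ℕ) :
    Measurable fun p : E × (Fin n → E) => (Fin.cons p.1 p.2 : Fin (n + 1) → E) := by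
  refine measurable_pi_lambda _ fun i => ?_
  refine Fin.cases ?_ (fun j => ?_) i
  · simpa using measurable_fst
  · simpa [Function.comp_def] using (measurable_pi_apply j).comp measurable_snd

instance instSFiniteProdPow (m : Measure E) [SFinite m] : ∀ n, SFinite (prodPow m n)
  | 0 => by rw [prodPow]; infer_instance
  | n + 1 => by
    have := instSFiniteProdPow m n
    rw [prodPow]; infer_instance

theorem lintegral_prodPow_zero (m : Measure E) {f : (Fin 0 → E) → ℝ≥0∞} (hf : Measurable f) :
    ∫⁻ z, f z ∂(prodPow m 0) = f fun i => i.elim0 := by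
  rw [prodPow, lintegral_dirac' _ hf]

theorem lintegral_prodPow_succ (m : Measure E) [SFinite m] (n : ℕ) {f : (Fin (n + 1) → E) → ℝ≥0∞}
    (hf : Measurable f) :
    ∫⁻ z, f z ∂(prodPow m (n + 1)) = ∫⁻ x, ∫⁻ z, f (Fin.cons x z) ∂(prodPow m n) ∂m := by
  have hf' : Measurable fun p : E × (Fin n → E) => f (Fin.cons p.1 p.2) :=
    hf.comp (measurable_cons n)
  rw [prodPow, lintegral_map hf (measurable_cons n), lintegral_prod _ hf'.aemeasurable]

theorem measurableSet_forall_mem {s : Set E} (hs : MeasurableSet s) (n : ℕ) :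
    MeasurableSet {z : Fin n → E | ∀ i, z i ∈ s} := by
  have : {z : Fin n → E | ∀ i, z i ∈ s} = ⋂ i, (fun z => z i) ⁻¹' s := by ext; simp
  rw [this]
  exact MeasurableSet.iInter fun i => measurable_pi_apply i hs

/-- Used to discard from a power of ξ + δ_x all tuples in which x occurs, where it agrees with the
power of ξ. -/
theorem prodPow_restrict (m : Measure E) [SFinite m] {s : Set E} (hs : MeasurableSet s) :
    ∀ n, prodPow (m.restrict s) n = (prodPow m n).restrict {z | ∀ i, z i ∈ s}
  | 0 => by
    have : {z : Fin 0 → E | ∀ i, z i ∈ s} = univ := by ext; simp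
    rw [this, Measure.restrict_univ, prodPow, prodPow]
  | n + 1 => by
    rw [prodPow, prodPow, prodPow_restrict m hs n, Measure.prod_restrict,
      Measure.restrict_map (measurable_cons n) (measurableSet_forall_mem hs _)]
    congr 2
    ext ⟨x, z⟩
    simp [Fin.forall_fin_succ]

theorem prodPow_ae_forall {m : Measure E} [SFinite m] {s : Set E} (hs : MeasurableSet s)
    (h : m sᶜ = 0) (n : ℕ) : ∀ᵐ z ∂(prodPow m n), ∀ i, z i ∈ s := by
  have h1 : m.restrict s = m := Measure.restrict_eq_self_of_ae_mem (by rw [ae_iff]; exact h)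
  have h2 := prodPow_restrict m hs n
  rw [h1] at h2
  rw [h2]
  exact ae_restrict_mem (measurableSet_forall_mem hs n)

/-- The product powers of the kernel `regKernel`. -/
noncomputable def prodPowKernel (μ : Measure E) [SigmaFinite μ] :
    (n : ℕ) → Kernel (Measure E) (Fin n → E)
  | 0 => Kernel.const _ (Measure.dirac fun i => i.elim0)
  | n + 1 => ((regKernel μ) ×ₖ (prodPowKernel μ n)).map
      fun p => (Fin.cons p.1 p.2 : Fin (n + 1) → E)

instance instSFiniteProdPowKernel (μ : Measure E) [SigmaFinite μ] :
    ∀ n, IsSFiniteKernel (prodPowKernel μ n)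
  | 0 => by rw [prodPowKernel]; infer_instance
  | n + 1 => by
    have := instSFiniteProdPowKernel μ n
    rw [prodPowKernel]; infer_instance

theorem prodPowKernel_apply (μ : Measure E) [SigmaFinite μ] (m : Measure E)
    (hm : ∀ k, m (spanningSets μ k) ≠ ∞) : ∀ n, prodPowKernel μ n m = prodPow m n
  | 0 => by rw [prodPowKernel, prodPow, Kernel.const_apply]
  | n + 1 => by
    rw [prodPowKernel, prodPow, Kernel.map_apply _ (measurable_cons n), Kernel.prod_apply,
      regKernel_apply μ m hm, prodPowKernel_apply μ m hm n]

instance (A : Set E) [Countable A] : SFinite (pointMeasure A) := by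
  rw [pointMeasure]; infer_instance

theorem lintegral_pointMeasure (A : Set E) {f : E → ℝ≥0∞} (hf : Measurable f) :
    ∫⁻ x, f x ∂(pointMeasure A) = ∑' x : A, f x := by
  rw [pointMeasure, lintegral_sum_measure]
  exact tsum_congr fun x => lintegral_dirac' _ hf

theorem lintegral_prodPow_pointMeasure (A : Set E) [Countable A] :
    ∀ (n : ℕ) {f : (Fin n → E) → ℝ≥0∞}, Measurable f →
      ∫⁻ z, f z ∂(prodPow (pointMeasure A) n) = ∑' z : Fin n → A, f fun i => z i
  | 0, f, hf => by
    rw [lintegral_prodPow_zero _ hf, tsum_eq_single (fun i => i.elim0)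
      (fun z hz => absurd (funext fun i => i.elim0) hz)]
    congr 1
    funext i
    exact i.elim0
  | n + 1, f, hf => by
    have hf' : Measurable fun p : E × (Fin n → E) => f (Fin.cons p.1 p.2) :=
      hf.comp (measurable_cons n)
    have hf2 : ∀ x, Measurable fun z : Fin n → E => f (Fin.cons x z) := fun x =>
      hf'.comp measurable_prodMk_left
    rw [lintegral_prodPow_succ _ _ hf, lintegral_pointMeasure _ hf'.lintegral_prod_right',
      ← (Fin.consEquiv fun _ : Fin (n + 1) => A).tsum_eq]
    refine Eq.trans ?_ (ENNReal.tsum_prod (f := fun (x : A) (z : Fin n → A) => f fun i =>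
        ((Fin.cons x z : Fin (n + 1) → A) i : E))).symm
    refine tsum_congr fun x => ?_
    rw [lintegral_prodPow_pointMeasure A n (hf2 x)]
    refine tsum_congr fun z => ?_
    congr 1
    funext i
    refine Fin.cases ?_ (fun j => ?_) i <;> simp

/-- The measure `δ_{z₁} + ⋯ + δ_{zₙ}`. -/
noncomputable def diracSum {n : ℕ} (z : Fin n → E) : Measure E := ∑ i, Measure.dirac (z i)

theorem diracSum_cons {n : ℕ} (x : E) (z : Fin n → E) :
    diracSum (Fin.cons x z : Fin (n + 1) → E) = Measure.dirac x + diracSum z := by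
  simp [diracSum, Fin.sum_univ_succ]

theorem measurableSet_injective [MeasurableEq E] (n : ℕ) :
    MeasurableSet {z : Fin n → E | Function.Injective z} := by
  have : {z : Fin n → E | Function.Injective z} = ⋂ i, ⋂ j, {z : Fin n → E | z i = z j → i = j} := by
    ext; simp [Function.Injective]
  rw [this]
  refine MeasurableSet.iInter fun i => MeasurableSet.iInter fun j => ?_
  by_cases h : i = j
  · simp [h]
  · simp only [h, imp_false]
    exact (measurableSet_eq_fun (measurable_pi_apply i) (measurable_pi_apply j)).compl

variable {Ω : Type*} [MeasurableSpace Ω] {X : Ω → Set E} {μ : Measure E} {Pr : Measure Ω}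

/-- The multivariate Mecke formula. -/
theorem IsPoissonProcess.mecke_pow [MeasurableEq E] [MeasurableSingletonClass E]
    [IsProbabilityMeasure Pr] [SigmaFinite μ]
    (hX : IsPoissonProcess X μ Pr) (hfin : ∀ ω k, (X ω ∩ spanningSets μ k).Finite)
    (hcount : ∀ ω, (X ω).Countable) (hatom : ∀ x, μ {x} = 0) :
    ∀ (n : ℕ) {f : (Fin n → E) × Measure E → ℝ≥0∞}, Measurable f →
      ∫⁻ ω, ∫⁻ z, {z : Fin n → E | Function.Injective z}.indicator
        (fun z => f (z, pointMeasure (X ω))) z ∂(prodPow (pointMeasure (X ω)) n) ∂Pr =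
      ∫⁻ z, ∫⁻ ω, f (z, pointMeasure (X ω) + diracSum z) ∂Pr ∂(prodPow μ n)
  | 0, f, hf => by
    have h1 : Measurable fun z : Fin 0 → E => ∫⁻ ω, f (z, pointMeasure (X ω) + diracSum z) ∂Pr :=
      measurable_of_countable _
    rw [lintegral_prodPow_zero _ h1]
    refine lintegral_congr fun ω => ?_
    rw [lintegral_prodPow_zero _ (measurable_of_countable _), indicator_of_mem]
    · simp [diracSum]
    · intro i; exact i.elim0
  | n + 1, f, hf => by
    classical
    have hξ := hX.measurable_pointMeasure
    have hcω : ∀ ω, Countable (X ω) := fun ω => (hcount ω).to_subtype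
    have hinj := measurableSet_injective (E := E)
    have hξfin : ∀ ω k, pointMeasure (X ω) (spanningSets μ k) ≠ ∞ := fun ω k => by
      rw [pointMeasure_apply _ (measurableSet_spanningSets μ k)]
      simpa using hfin ω k
    set g : (E × Measure E) × (Fin n → E) → ℝ≥0∞ := fun q =>
      {z : Fin (n + 1) → E | Function.Injective z}.indicator
        (fun z => f (z, q.1.2)) (Fin.cons q.1.1 q.2) with hg
    have hconsm : Measurable fun q : (E × Measure E) × (Fin n → E) =>
        (Fin.cons q.1.1 q.2 : Fin (n + 1) → E) :=
      (measurable_cons n).comp ((measurable_fst.comp measurable_fst).prodMk measurable_snd)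
    have hgm : Measurable g := by
      have h1 : Measurable fun q : (E × Measure E) × (Fin n → E) =>
          f ((Fin.cons q.1.1 q.2 : Fin (n + 1) → E), q.1.2) :=
        hf.comp (hconsm.prodMk (measurable_snd.comp measurable_fst))
      exact h1.indicator (hconsm (hinj (n + 1)))
    -- The last n points are integrated out, which leaves a function of one point and the
    -- configuration to which the simple formula applies.
    set F : E × Measure E → ℝ≥0∞ := fun p => ∫⁻ z, g (p, z) ∂(prodPowKernel μ n p.2) with hF
    have hFm : Measurable F :=
      hgm.lintegral_kernel_prod_right' (κ := (prodPowKernel μ n).comap Prod.snd measurable_snd)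
    have e1 : ∀ ω, ∫⁻ z, {z : Fin (n + 1) → E | Function.Injective z}.indicator
        (fun z => f (z, pointMeasure (X ω))) z ∂(prodPow (pointMeasure (X ω)) (n + 1)) =
        ∫⁻ x, F (x, pointMeasure (X ω)) ∂(pointMeasure (X ω)) := by
      intro ω
      have h2 : Measurable fun z : Fin (n + 1) → E =>
          {z : Fin (n + 1) → E | Function.Injective z}.indicator
            (fun z => f (z, pointMeasure (X ω))) z :=
        (hf.comp (measurable_id'.prodMk measurable_const)).indicator (hinj (n + 1))
      rw [lintegral_prodPow_succ _ _ h2]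
      refine lintegral_congr fun x => ?_
      simp only [hF]
      rw [prodPowKernel_apply μ _ (hξfin ω)]
    simp only [e1]
    rw [hX.mecke hfin hFm]
    have hRm : Measurable fun z : Fin (n + 1) → E =>
        ∫⁻ ω, f (z, pointMeasure (X ω) + diracSum z) ∂Pr := by
      have : Measurable fun q : (Fin (n + 1) → E) × Ω =>
          f (q.1, pointMeasure (X q.2) + diracSum q.1) := by
        refine hf.comp (measurable_fst.prodMk ((hξ.comp measurable_snd).add ?_))
        refine Finset.measurable_sum _ fun i _ => ?_
        exact Measure.measurable_dirac.comp ((measurable_pi_apply i).comp measurable_fst)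
      exact this.lintegral_prod_right'
    rw [lintegral_prodPow_succ _ _ hRm]
    refine lintegral_congr fun x => ?_
    have hxc : MeasurableSet ({x}ᶜ : Set E) := (measurableSet_singleton x).compl
    set fx : (Fin n → E) × Measure E → ℝ≥0∞ := fun q =>
      {z : Fin n → E | ∀ i, z i ∈ ({x}ᶜ : Set E)}.indicator
        (fun z => f (Fin.cons x z, q.2 + Measure.dirac x)) q.1 with hfx
    have hfxm : Measurable fx := by
      have h1 : Measurable fun q : (Fin n → E) × Measure E =>
          f ((Fin.cons x q.1 : Fin (n + 1) → E), q.2 + Measure.dirac x) :=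
        hf.comp (((measurable_cons n).comp (measurable_const.prodMk measurable_fst)).prodMk
          (measurable_snd.add_const _))
      exact h1.indicator (measurable_fst (measurableSet_forall_mem hxc n))
    have e2 : ∀ ω, F (x, pointMeasure (X ω) + Measure.dirac x) =
        ∫⁻ z, {z : Fin n → E | Function.Injective z}.indicator
          (fun z => fx (z, pointMeasure (X ω))) z ∂(prodPow (pointMeasure (X ω)) n) := by
      intro ω
      have hk : ∀ k, (pointMeasure (X ω) + Measure.dirac x) (spanningSets μ k) ≠ ∞ := fun k => by
        rw [Measure.add_apply]
        exact ENNReal.add_ne_top.2 ⟨hξfin ω k, measure_ne_top _ _⟩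
      have hg2 : ∀ z, g ((x, pointMeasure (X ω) + Measure.dirac x), z) =
          {z : Fin n → E | ∀ i, z i ∈ ({x}ᶜ : Set E)}.indicator
            (fun z => {z : Fin n → E | Function.Injective z}.indicator
              (fun z => fx (z, pointMeasure (X ω))) z) z := by
        intro z
        have hiff : Function.Injective (Fin.cons x z : Fin (n + 1) → E) ↔
            (∀ i, z i ∈ ({x}ᶜ : Set E)) ∧ Function.Injective z := by
          rw [Fin.cons_injective_iff]
          simp [eq_comm]
        simp only [hg, hfx, indicator_apply, mem_ofPred_eq, hiff]
        by_cases h1 : ∀ i, z i ∈ ({x}ᶜ : Set E)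
        · by_cases h2 : Function.Injective z
          · simp only [if_pos (And.intro h1 h2), if_pos h1, if_pos h2]
          · simp only [if_neg fun h : (∀ i, z i ∈ ({x}ᶜ : Set E)) ∧ Function.Injective z => h2 h.2,
              if_neg h2, ite_self]
        · simp only [if_neg fun h : (∀ i, z i ∈ ({x}ᶜ : Set E)) ∧ Function.Injective z => h1 h.1,
            if_neg h1]
      -- Injectivity forbids the other points to equal x, so the Dirac mass added by the first
      -- application disappears from the product, and the induction hypothesis applies.
      have hres : (prodPow (pointMeasure (X ω) + Measure.dirac x) n).restrict
          {z | ∀ i, z i ∈ ({x}ᶜ : Set E)} =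
          (prodPow (pointMeasure (X ω)) n).restrict {z | ∀ i, z i ∈ ({x}ᶜ : Set E)} := by
        rw [← prodPow_restrict _ hxc, ← prodPow_restrict _ hxc]
        congr 1
        rw [Measure.restrict_add, MeasureTheory.restrict_dirac' hxc, if_neg (by simp), add_zero]
      simp only [hF]
      rw [prodPowKernel_apply μ _ hk]
      simp only [hg2]
      rw [lintegral_indicator (measurableSet_forall_mem hxc n), hres,
        ← lintegral_indicator (measurableSet_forall_mem hxc n)]
      refine lintegral_congr fun z => ?_
      simp only [hfx, indicator_apply, mem_ofPred_eq]
      by_cases h1 : ∀ i, z i ∈ ({x}ᶜ : Set E)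
      · simp only [if_pos h1]
      · simp only [if_neg h1, ite_self]
    simp only [e2]
    rw [IsPoissonProcess.mecke_pow hX hfin hcount hatom n hfxm]
    refine lintegral_congr_ae ?_
    -- On the intensity side the condition of avoiding x is free, since μ has no atoms.
    filter_upwards [prodPow_ae_forall (m := μ) hxc (by rw [compl_compl]; exact hatom x) n]
      with z hz
    refine lintegral_congr fun ω => ?_
    simp only [hfx]
    rw [indicator_of_mem (by exact hz), diracSum_cons, add_assoc, add_comm (diracSum z)]

end ProdPow

/-! ### The intensity measure -/

theorem measurable_weight (M : Model) (β : ℝ) : Measurable (M.weight β) := by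
  have h : MeasurableSet {h : ℝ | 0 < M.kappa * h} :=
    measurableSet_lt measurable_const (by fun_prop)
  exact Measurable.ite h (by fun_prop) measurable_const

theorem weight_ne_top (M : Model) (β h : ℝ) : M.weight β h ≠ ∞ := by
  rw [Model.weight]; split_ifs <;> simp

/-- The measure `(κ h)^{κ β} 1{κ h > 0} dh`. -/
noncomputable def heightMeasure (M : Model) (β : ℝ) : Measure ℝ :=
  (volume : Measure ℝ).withDensity (M.weight β)

instance (M : Model) (β : ℝ) : SigmaFinite (heightMeasure M β) :=
  SigmaFinite.withDensity_of_ne_top' (weight_ne_top M β)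

theorem intensity_eq (M : Model) (d : ℕ) (β γ : ℝ) :
    intensity M d β γ = ENNReal.ofReal (γ * M.normConst d β) •
      (volume : Measure (Vec d)).prod (heightMeasure M β) := by
  rw [intensity, heightMeasure, prod_withDensity_right (measurable_weight M β)]
  rfl

instance instSigmaFiniteIntensity (M : Model) (d : ℕ) (β γ : ℝ) :
    SigmaFinite (intensity M d β γ) := by
  rw [intensity_eq]
  exact SMul.sigmaFinite (Real.toNNReal (γ * M.normConst d β))

theorem normConst_pos {M : Model} {d : ℕ} {β : ℝ} (hβ : M.Admissible d β) :
    0 < M.normConst d β := by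
  cases M with
  | beta =>
    have hβ' : -1 < β := hβ
    have h1 : 0 < Real.Gamma (((d : ℝ) + 1) / 2 + β + 1) :=
      Real.Gamma_pos_of_pos (by have : (0 : ℝ) ≤ d := Nat.cast_nonneg d; linarith)
    have h2 : 0 < Real.Gamma (β + 1) := Real.Gamma_pos_of_pos (by linarith)
    have h3 := Real.pi_pos
    simp only [Model.normConst]
    positivity
  | betaPrime =>
    have hβ' : (d : ℝ) / 2 + 1 < β := hβ
    have hd : (0 : ℝ) ≤ d := Nat.cast_nonneg d
    have h1 : 0 < Real.Gamma β := Real.Gamma_pos_of_pos (by linarith)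
    have h2 : 0 < Real.Gamma (β - ((d : ℝ) + 1) / 2) := Real.Gamma_pos_of_pos (by linarith)
    have h3 := Real.pi_pos
    simp only [Model.normConst]
    positivity

theorem lintegral_intensity (M : Model) (d : ℕ) (β γ : ℝ) {f : Pt d → ℝ≥0∞} (hf : Measurable f) :
    ∫⁻ y, f y ∂(intensity M d β γ) = ENNReal.ofReal (γ * M.normConst d β) *
      ∫⁻ v, ∫⁻ h, f (v, h) ∂(heightMeasure M β) := by
  rw [intensity_eq, lintegral_smul_measure, lintegral_prod _ hf.aemeasurable, smul_eq_mul]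

theorem intensity_singleton (M : Model) {d : ℕ} (β γ : ℝ) (x : Pt d) :
    intensity M d β γ {x} = 0 := by
  have h0 : (volume : Measure (Pt d)) {x} = 0 := by
    rw [Measure.volume_eq_prod, ← singleton_prod_singleton, Measure.prod_prod,
      measure_singleton x.2, mul_zero]
  rw [intensity, Measure.smul_apply, withDensity_absolutelyContinuous _ _ h0, smul_zero]

theorem heightMeasure_nonpos (M : Model) (β : ℝ) :
    heightMeasure M β {h | ¬ 0 < M.kappa * h} = 0 := by
  have hs0 : MeasurableSet {h : ℝ | 0 < M.kappa * h} :=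
    measurableSet_lt measurable_const (by fun_prop)
  have hs : MeasurableSet {h : ℝ | ¬ 0 < M.kappa * h} := hs0.compl
  rw [heightMeasure, withDensity_apply _ hs, setLIntegral_congr_fun hs (g := fun _ => 0), lintegral_zero]
  intro h hh
  rw [Model.weight, if_neg hh]

theorem intensity_nonpos (M : Model) (d : ℕ) (β γ : ℝ) :
    intensity M d β γ {y | ¬ 0 < M.kappa * y.2} = 0 := by
  have : {y : Pt d | ¬ 0 < M.kappa * y.2} = univ ×ˢ {h | ¬ 0 < M.kappa * h} := by
    ext; simp
  rw [intensity_eq, this, Measure.smul_apply, Measure.prod_prod, heightMeasure_nonpos, mul_zero,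
    smul_zero]

/-- Points with the same bounding half-space form a null set. -/
theorem intensity_bound_eq (M : Model) {d : ℕ} (β γ : ℝ) (x : Pt d) (H : HalfSpace d) :
    intensity M d β γ {y | bound x y = Sum.inl H} = 0 := by
  have hm : MeasurableSet {y | bound x y = Sum.inl H} := by
    have h := measurable_bound x (measurableSet_inl_image.2 (measurableSet_singleton H))
    rwa [image_singleton] at h
  have : (volume : Measure (Pt d)) {y | bound x y = Sum.inl H} = 0 := by
    rw [Measure.volume_eq_prod, Measure.measure_prod_null hm]
    refine Filter.Eventually.of_forall fun v => ?_
    refine Set.Subsingleton.measure_zero ?_ _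
    intro a ha b hb
    have key : ∀ a : ℝ, bound x (v, a) = Sum.inl H → ‖v - x.1‖ ≠ 0 ∧
        (a + ‖v‖ ^ 2 - x.2 - ‖x.1‖ ^ 2) / (2 * ‖v - x.1‖) = H.2 := by
      intro a ha
      rw [bound] at ha
      split_ifs at ha with hv
      exact ⟨norm_ne_zero_iff.2 hv, congrArg Prod.snd (Sum.inl_injective ha)⟩
    obtain ⟨h0, h1⟩ := key a ha
    obtain ⟨-, h2⟩ := key b hb
    rw [← h2, div_left_inj' (by positivity)] at h1
    linarith
  rw [intensity, Measure.smul_apply, withDensity_absolutelyContinuous _ _ this, smul_zero]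

/-! ### Translations and scalings -/

/-- Translation of the spatial part. -/
def shiftPt {d : ℕ} (a : Vec d) (y : Pt d) : Pt d := (y.1 + a, y.2)

/-- The parabolic scaling `(v, h) ↦ (r v, r² h)`. -/
def scalePt {d : ℕ} (r : ℝ) (y : Pt d) : Pt d := (r • y.1, r ^ 2 * y.2)

/-- The exponent `2 κ β + d + 2` by which the intensity measure scales. -/
noncomputable def scaleExp (M : Model) (d : ℕ) (β : ℝ) : ℝ := 2 * M.kappa * β + d + 2

theorem measurable_shiftPt {d : ℕ} (a : Vec d) : Measurable (shiftPt a) := by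
  unfold shiftPt; fun_prop

theorem measurable_scalePt {d : ℕ} (r : ℝ) : Measurable (scalePt (d := d) r) := by
  unfold scalePt; fun_prop

theorem measurePreserving_shiftPt (M : Model) {d : ℕ} (β γ : ℝ) (a : Vec d) :
    MeasurePreserving (shiftPt a) (intensity M d β γ) (intensity M d β γ) := by
  rw [intensity_eq]
  refine MeasurePreserving.smul_measure ?_ _
  exact (measurePreserving_add_right volume a).prod (MeasurePreserving.id _)

/-- The weight is homogeneous of degree κβ and Lebesgue measure adds one. -/
theorem heightMeasure_map (M : Model) (β : ℝ) {s : ℝ} (hs : 0 < s) :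
    (heightMeasure M β).map (s * ·) =
      ENNReal.ofReal (s ^ (-(M.kappa * β + 1))) • heightMeasure M β := by
  have hsm : Measurable fun h : ℝ => s * h := by fun_prop
  refine Measure.ext_of_lintegral _ fun f hf => ?_
  have hw : ∀ h, M.weight β h = ENNReal.ofReal (s ^ (-(M.kappa * β))) * M.weight β (s * h) := by
    intro h
    have h1 : M.kappa * (s * h) = s * (M.kappa * h) := by ring
    rw [Model.weight, Model.weight, h1]
    by_cases hh : 0 < M.kappa * h
    · rw [if_pos hh, if_pos (by positivity), ← ENNReal.ofReal_mul (by positivity),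
        Real.mul_rpow hs.le hh.le, ← mul_assoc, ← Real.rpow_add hs, neg_add_cancel, Real.rpow_zero,
        one_mul]
    · rw [if_neg hh, if_neg (by rwa [mul_pos_iff_of_pos_left hs]), mul_zero]
  have hg : Measurable fun h => M.weight β h * f h := (measurable_weight M β).mul hf
  have hfs : Measurable fun h => f (s * h) := hf.comp hsm
  rw [lintegral_map hf hsm, lintegral_smul_measure, heightMeasure,
    lintegral_withDensity_eq_lintegral_mul _ (measurable_weight M β) hfs,
    lintegral_withDensity_eq_lintegral_mul _ (measurable_weight M β) hf]
  simp only [Pi.mul_apply]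
  have e1 : ∀ h, M.weight β h * f (s * h) = ENNReal.ofReal (s ^ (-(M.kappa * β))) *
      (M.weight β (s * h) * f (s * h)) := by
    intro h
    conv_lhs => rw [hw h]
    rw [mul_assoc]
  have hg' : Measurable fun h => M.weight β (s * h) * f (s * h) := hg.comp hsm
  simp only [e1]
  rw [lintegral_const_mul _ hg', ← lintegral_map hg hsm, Real.map_volume_mul_left hs.ne',
    lintegral_smul_measure, smul_eq_mul, smul_eq_mul, ← mul_assoc,
    ← ENNReal.ofReal_mul (by positivity), abs_of_pos (by positivity), neg_add, Real.rpow_add hs,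
    Real.rpow_neg_one]

/-- The d spatial directions contribute r^{-d}, and the heights, scaled by r², contribute
r^{-2(κβ+1)}. -/
theorem intensity_map_scalePt (M : Model) (d : ℕ) (β γ : ℝ) {r : ℝ} (hr : 0 < r) :
    (intensity M d β γ).map (scalePt r) =
      ENNReal.ofReal (r ^ (-scaleExp M d β)) • intensity M d β γ := by
  have e : (scalePt r : Pt d → Pt d) = Prod.map (r • ·) (r ^ 2 * ·) := rfl
  have h2 : Measurable fun h : ℝ => r ^ 2 * h := by fun_prop
  have h1 : Measurable fun v : Vec d => r • v := by fun_prop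
  have hc : ENNReal.ofReal |(r ^ Module.finrank ℝ (Vec d))⁻¹| *
      ENNReal.ofReal ((r ^ 2) ^ (-(M.kappa * β + 1))) = ENNReal.ofReal (r ^ (-scaleExp M d β)) := by
    rw [abs_of_pos (by positivity), ← ENNReal.ofReal_mul (by positivity), finrank_euclideanSpace_fin]
    congr 1
    rw [← Real.rpow_natCast r d, ← Real.rpow_neg hr.le, ← Real.rpow_natCast r 2,
      ← Real.rpow_mul hr.le, ← Real.rpow_add hr]
    congr 1
    rw [scaleExp]; push_cast; ring
  have : SFinite (ENNReal.ofReal |(r ^ Module.finrank ℝ (Vec d))⁻¹| • (volume : Measure (Vec d))) :=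
    inferInstanceAs (SFinite (Real.toNNReal _ • (volume : Measure (Vec d))))
  have : SFinite (ENNReal.ofReal ((r ^ 2) ^ (-(M.kappa * β + 1))) • heightMeasure M β) :=
    inferInstanceAs (SFinite (Real.toNNReal _ • heightMeasure M β))
  rw [intensity_eq, Measure.map_smul, e, ← Measure.map_prod_map _ _ h1 h2,
    Measure.map_addHaar_smul _ hr.ne', heightMeasure_map M β (by positivity), Measure.prod_smul_left,
    Measure.prod_smul_right, smul_smul, smul_smul, smul_smul, mul_assoc, hc, mul_comm]

/-! ### Boxes under a paraboloid -/

theorem scaleExp_neg {d : ℕ} {β : ℝ} (hβ : Model.betaPrime.Admissible d β) :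
    scaleExp .betaPrime d β < 0 := by
  have : (d : ℝ) / 2 + 1 < β := hβ
  simp only [scaleExp, Model.kappa]; linarith

theorem scaleExp_pos {d : ℕ} {β : ℝ} (hβ : Model.beta.Admissible d β) (hd : 1 ≤ d) :
    0 < scaleExp .beta d β := by
  have h1 : -1 < β := hβ
  have h2 : (1 : ℝ) ≤ d := by exact_mod_cast hd
  simp only [scaleExp, Model.kappa]
  linarith

theorem scaleExp_ne_zero {M : Model} {d : ℕ} {β : ℝ} (hβ : M.Admissible d β) (hd : 1 ≤ d) :
    scaleExp M d β ≠ 0 := by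
  cases M with
  | beta => exact (scaleExp_pos hβ hd).ne'
  | betaPrime => exact (scaleExp_neg hβ).ne

/-- A box below the paraboloid with apex `(w, 0)`. -/
def box {d : ℕ} (ε : ℝ) (w : Vec d) : Set (Pt d) :=
  {y | ‖y.1 - w‖ < ε ∧ -8 * ε ^ 2 < y.2 ∧ y.2 < -4 * ε ^ 2}

theorem measurableSet_box {d : ℕ} (ε : ℝ) (w : Vec d) : MeasurableSet (box ε w) := by
  have h1 : MeasurableSet {y : Pt d | ‖y.1 - w‖ < ε} :=
    measurableSet_lt (by fun_prop) measurable_const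
  have h2 : MeasurableSet {y : Pt d | -8 * ε ^ 2 < y.2} :=
    measurableSet_lt measurable_const (by fun_prop)
  have h3 : MeasurableSet {y : Pt d | y.2 < -4 * ε ^ 2} :=
    measurableSet_lt (by fun_prop) measurable_const
  exact h1.inter (h2.inter h3)

/-- The box is the translate of a parabolic dilate of the unit box, because its height bounds are
proportional to ε². -/
theorem intensity_box (M : Model) (d : ℕ) (β γ : ℝ) {ε : ℝ} (hε : 0 < ε) (w : Vec d) :
    intensity M d β γ (box ε w) =
      ENNReal.ofReal (ε ^ scaleExp M d β) * intensity M d β γ (box 1 0) := by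
  have h1 : shiftPt w ⁻¹' box ε w = box ε 0 := by
    ext y; simp [box, shiftPt]
  have h2 : scalePt ε ⁻¹' box ε 0 = box (d := d) 1 0 := by
    ext y
    have hε2 : 0 < ε ^ 2 := by positivity
    simp only [box, scalePt, mem_preimage, mem_ofPred_eq, sub_zero, norm_smul, Real.norm_eq_abs,
      abs_of_pos hε]
    refine and_congr ?_ (and_congr ?_ ?_)
    · exact mul_lt_iff_lt_one_right hε
    · rw [mul_comm, mul_lt_mul_iff_right₀ hε2]; norm_num
    · rw [mul_comm (-4), mul_lt_mul_iff_right₀ hε2]; norm_num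
  have h3 := congrArg (fun m => m (box ε 0)) (intensity_map_scalePt M d β γ hε)
  simp only [Measure.map_apply (measurable_scalePt ε) (measurableSet_box ε 0), h2,
    Measure.smul_apply, smul_eq_mul] at h3
  rw [← (measurePreserving_shiftPt M β γ w).measure_preimage
    (measurableSet_box ε w).nullMeasurableSet, h1, h3, ← mul_assoc,
    ← ENNReal.ofReal_mul (by positivity), ← Real.rpow_add hε, add_neg_cancel, Real.rpow_zero,
    ENNReal.ofReal_one, one_mul]

theorem intensity_box_pos {d : ℕ} {β γ : ℝ} (hβ : Model.betaPrime.Admissible d β) (hγ : 0 < γ) :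
    0 < intensity .betaPrime d β γ (box 1 0) := by
  have e : box (1 : ℝ) (0 : Vec d) = Metric.ball 0 1 ×ˢ Ioo (-8) (-4) := by
    ext y; simp [box, mem_prod]
  have hc := normConst_pos hβ
  rw [intensity_eq, e, Measure.smul_apply, Measure.prod_prod, smul_eq_mul]
  refine ENNReal.mul_pos (by simpa using mul_pos hγ hc) (mul_ne_zero ?_ ?_)
  · exact (Metric.measure_ball_pos volume (0 : Vec d) one_pos).ne'
  · rw [heightMeasure, withDensity_apply _ measurableSet_Ioo]
    intro h0
    rw [lintegral_eq_zero_iff (measurable_weight _ _), Filter.EventuallyEq,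
      ae_restrict_iff' measurableSet_Ioo] at h0
    have h1 : ∀ᵐ h : ℝ, h ∉ Ioo (-8 : ℝ) (-4) := by
      filter_upwards [h0] with h hh hmem
      have h2 := hh hmem
      have hp : 0 < Model.betaPrime.kappa * h := by
        simp only [Model.kappa]; linarith [hmem.2]
      rw [Model.weight, if_pos hp] at h2
      have h3 : 0 < (Model.betaPrime.kappa * h) ^ (Model.betaPrime.kappa * β) :=
        Real.rpow_pos_of_pos hp _
      exact absurd h2 (by simpa using h3)
    rw [ae_iff] at h1
    have h4 : {h : ℝ | ¬ h ∉ Ioo (-8 : ℝ) (-4)} = Ioo (-8) (-4) := by ext; simp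
    rw [h4, Real.volume_Ioo] at h1
    norm_num at h1

/-- Both w and the spatial part of y lie within ε of g, so their squared distance is below 4ε²; this
is the reason for the upper height -4ε² of the box. -/
theorem mem_of_mem_box {d : ℕ} {ε : ℝ} {w g : Vec d} (hw : ‖w - g‖ ≤ ε) {y : Pt d}
    (hy : y ∈ box ε g) : ‖w - y.1‖ ^ 2 + y.2 < 0 := by
  obtain ⟨h1, -, h3⟩ := hy
  have h4 : ‖w - y.1‖ < 2 * ε := by
    have h5 : w - y.1 = (w - g) - (y.1 - g) := by abel
    rw [h5]
    exact (norm_sub_le _ _).trans_lt (by linarith)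
  nlinarith [norm_nonneg (w - y.1)]

/-- In the `β'`-model the region below a paraboloid of apex height at least zero has infinite
measure. -/
theorem intensity_paraboloid_eq_top {d : ℕ} {β γ : ℝ} (hβ : Model.betaPrime.Admissible d β)
    (hγ : 0 < γ) (w : Vec d) {a : ℝ} (ha : 0 ≤ a) :
    intensity .betaPrime d β γ {y | ‖w - y.1‖ ^ 2 + y.2 < a} = ∞ := by
  -- The region contains arbitrarily small boxes. Their measure is proportional to ε to a negative
  -- power in the β'-model and so is unbounded as ε → 0.
  have hsub : ∀ ε : ℝ, 0 < ε → ENNReal.ofReal (ε ^ scaleExp .betaPrime d β) *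
      intensity .betaPrime d β γ (box 1 0) ≤
      intensity .betaPrime d β γ {y | ‖w - y.1‖ ^ 2 + y.2 < a} := by
    intro ε hε
    rw [← intensity_box _ _ _ _ hε w]
    refine measure_mono fun y hy => ?_
    exact (mem_of_mem_box (w := w) (by simpa using hε.le) hy).trans_le ha
  have hδ := scaleExp_neg hβ
  have hm := intensity_box_pos hβ hγ
  set m := intensity .betaPrime d β γ (box 1 0)
  have ht : Filter.Tendsto (fun x : ℝ => ENNReal.ofReal x * m) Filter.atTop (nhds (∞ * m)) :=
    ENNReal.Tendsto.mul_const ENNReal.tendsto_ofReal_atTop (Or.inl (by simp))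
  rw [ENNReal.top_mul hm.ne'] at ht
  refine top_le_iff.1 (le_of_tendsto ht ?_)
  filter_upwards [Filter.eventually_gt_atTop 0] with x hx
  have := hsub (x ^ (scaleExp .betaPrime d β)⁻¹) (Real.rpow_pos_of_pos hx _)
  rwa [← Real.rpow_mul hx.le, inv_mul_cancel₀ hδ.ne, Real.rpow_one] at this

/-! ### Regions of finite measure -/

/-- An exhausting family of regions of finite measure. -/
def finiteRegion (M : Model) (d k : ℕ) : Set (Pt d) :=
  match M with
  | .beta => {y | ‖y.1‖ ≤ k ∧ y.2 ≤ k}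
  | .betaPrime => {y | ‖y.1‖ ^ 2 ≤ k * (1 - y.2) ∧ y.2 ≤ -1 / k}

theorem measurableSet_finiteRegion (M : Model) (d k : ℕ) : MeasurableSet (finiteRegion M d k) := by
  cases M with
  | beta =>
    have h1 : MeasurableSet {y : Pt d | ‖y.1‖ ≤ k} := measurableSet_le (by fun_prop) measurable_const
    have h2 : MeasurableSet {y : Pt d | y.2 ≤ k} := measurableSet_le (by fun_prop) measurable_const
    exact h1.inter h2
  | betaPrime =>
    have h1 : MeasurableSet {y : Pt d | ‖y.1‖ ^ 2 ≤ k * (1 - y.2)} :=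
      measurableSet_le (by fun_prop) (by fun_prop)
    have h2 : MeasurableSet {y : Pt d | y.2 ≤ -1 / k} :=
      measurableSet_le (by fun_prop) measurable_const
    exact h1.inter h2

/-- In the β-model h^β is integrable at 0 since β > -1. In the β'-model heights stay away from 0,
the section at height h has volume of order (-h)^{d/2}, and (-h)^{d/2-β} is integrable at infinity
since β > d/2 + 1. -/
theorem intensity_finiteRegion {M : Model} {d : ℕ} {β : ℝ} (hβ : M.Admissible d β) (γ : ℝ) {k : ℕ}
    (hk : 0 < k) : intensity M d β γ (finiteRegion M d k) ≠ ∞ := by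
  cases M with
  | beta =>
    have e : finiteRegion .beta d k = Metric.closedBall 0 k ×ˢ Iic (k : ℝ) := by
      ext y; simp [finiteRegion, mem_prod]
    rw [intensity_eq, e, Measure.smul_apply, Measure.prod_prod, smul_eq_mul]
    refine ENNReal.mul_ne_top (by simp) (ENNReal.mul_ne_top measure_closedBall_lt_top.ne ?_)
    have hβ' : -1 < β := hβ
    have hint : IntegrableOn (fun h : ℝ => h ^ β) (Ioc 0 k) :=
      (intervalIntegrable_iff_integrableOn_Ioc_of_le (by positivity)).1
        (intervalIntegral.intervalIntegrable_rpow' hβ')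
    have hle : heightMeasure .beta β (Iic (k : ℝ)) ≤ ∫⁻ h in Ioc (0 : ℝ) k, ENNReal.ofReal (h ^ β) := by
      rw [heightMeasure, withDensity_apply _ measurableSet_Iic, ← lintegral_indicator measurableSet_Iic,
        ← lintegral_indicator measurableSet_Ioc]
      refine lintegral_mono fun h => ?_
      simp only [indicator_apply, Model.weight, Model.kappa, one_mul, mem_Iic, mem_Ioc]
      split_ifs with h1 h2 h3 h4 <;> simp_all
    refine ne_top_of_le_ne_top ?_ hle
    exact (hint.lintegral_lt_top).ne
  | betaPrime =>
    have hβ' : (d : ℝ) / 2 + 1 < β := hβ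
    have hk' : (0 : ℝ) < k := by exact_mod_cast hk
    have hm := measurableSet_finiteRegion .betaPrime d k
    rw [intensity_eq, Measure.smul_apply, smul_eq_mul, Measure.prod_apply_symm hm]
    refine ENNReal.mul_ne_top (by simp) ?_
    set V := (volume : Measure (Vec d)) (Metric.ball 0 1)
    have hV : V ≠ ∞ := measure_ball_lt_top.ne
    -- From 1 ≤ k(-h) follows k(1 - h) ≤ k(1 + k)(-h), so the section lies in a ball of radius √(k(1
    -- + k)) √(-h).
    set C : ℝ := Real.sqrt (k * (1 + k)) ^ d
    have hsec : ∀ h : ℝ, (volume : Measure (Vec d))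
        ((fun v => (v, h)) ⁻¹' finiteRegion .betaPrime d k) ≤
        (Iic (-1 / (k : ℝ))).indicator (fun h => ENNReal.ofReal (C * (-h) ^ ((d : ℝ) / 2)) * V) h := by
      intro h
      by_cases hh : h ≤ -1 / k
      · rw [indicator_of_mem (by exact hh)]
        have hh1 : 1 ≤ k * (-h) := by
          rw [le_div_iff₀ hk'] at hh; linarith
        have hh0 : 0 < -h := by
          by_contra! hcon
          nlinarith
        have hsub : ((fun v : Vec d => (v, h)) ⁻¹' finiteRegion .betaPrime d k) ⊆
            Metric.closedBall 0 (Real.sqrt (k * (1 + k)) * Real.sqrt (-h)) := by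
          intro v hv
          have h1 : ‖v‖ ^ 2 ≤ k * (1 - h) := hv.1
          rw [mem_closedBall_zero_iff, ← Real.sqrt_mul (by positivity)]
          refine Real.le_sqrt_of_sq_le (h1.trans ?_)
          nlinarith
        refine (measure_mono hsub).trans_eq ?_
        rw [Measure.addHaar_closedBall _ _ (by positivity), finrank_euclideanSpace_fin, mul_pow]
        congr 3
        rw [Real.sqrt_eq_rpow, ← Real.rpow_natCast, ← Real.rpow_mul hh0.le]
        congr 1; ring
      · rw [indicator_of_notMem (by exact hh)]
        have : ((fun v : Vec d => (v, h)) ⁻¹' finiteRegion .betaPrime d k) = ∅ :=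
          eq_empty_of_forall_notMem fun v hv => hh hv.2
        rw [this, measure_empty]
    refine ne_top_of_le_ne_top ?_ (lintegral_mono hsec)
    have hmi : Measurable fun h : ℝ => ENNReal.ofReal (C * (-h) ^ ((d : ℝ) / 2)) * V := by fun_prop
    rw [heightMeasure, lintegral_withDensity_eq_lintegral_mul _ (measurable_weight _ _)
      (hmi.indicator measurableSet_Iic)]
    -- The endpoint 1/(2k) lies below 1/k, so the open half-line contains the closed range -h ≥ 1/k.
    have hint : IntegrableOn (fun t : ℝ => t ^ ((d : ℝ) / 2 - β)) (Ioi (1 / (2 * k) : ℝ)) :=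
      integrableOn_Ioi_rpow_of_lt (by linarith) (by positivity)
    set G : ℝ → ℝ≥0∞ := fun t => ENNReal.ofReal C * V *
      (Ioi (1 / (2 * k) : ℝ)).indicator (fun t => ENNReal.ofReal (t ^ ((d : ℝ) / 2 - β))) t with hG
    have hGm : Measurable G :=
      ((Measurable.indicator (by fun_prop) measurableSet_Ioi).const_mul _)
    have hle : ∀ h : ℝ, (Model.betaPrime.weight β * (Iic (-1 / (k : ℝ))).indicator
        fun h => ENNReal.ofReal (C * (-h) ^ ((d : ℝ) / 2)) * V) h ≤ G (-h) := by
      intro h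
      rw [Pi.mul_apply]
      by_cases hh : h ≤ -1 / k
      · have hh1 : 1 ≤ k * (-h) := by
          rw [le_div_iff₀ hk'] at hh; linarith
        have hh0 : 0 < -h := by
          by_contra! hcon
          nlinarith
        have hmem : -h ∈ Ioi (1 / (2 * k) : ℝ) := by
          rw [mem_Ioi, div_lt_iff₀ (by positivity)]; linarith
        rw [indicator_of_mem (by exact hh)]
        simp only [hG]
        rw [indicator_of_mem hmem, Model.weight, if_pos (by simpa [Model.kappa] using hh0)]
        have e1 : Model.betaPrime.kappa * h = -h := by simp [Model.kappa]
        have e2 : Model.betaPrime.kappa * β = -β := by simp [Model.kappa]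
        rw [e1, e2, ENNReal.ofReal_mul (by positivity), sub_eq_add_neg, Real.rpow_add hh0,
          ENNReal.ofReal_mul (by positivity)]
        exact le_of_eq (by ring)
      · rw [indicator_of_notMem (by exact hh), mul_zero]; exact bot_le
    refine ne_top_of_le_ne_top ?_ (lintegral_mono hle)
    rw [(Measure.measurePreserving_neg (volume : Measure ℝ)).lintegral_comp hGm,
      lintegral_const_mul _ (Measurable.indicator (by fun_prop) measurableSet_Ioi),
      lintegral_indicator measurableSet_Ioi]
    exact ENNReal.mul_ne_top (ENNReal.mul_ne_top (by simp) hV) hint.lintegral_lt_top.ne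

/-! ### Almost sure properties of Poisson processes -/

section General

variable {E Ω : Type*} [MeasurableSpace E] [MeasurableSpace Ω] {X : Ω → Set E} {μ : Measure E}
  {Pr : Measure Ω}

/-- `exp (-a)` for `a ∈ [0, ∞]`. -/
noncomputable def expNeg (a : ℝ≥0∞) : ℝ≥0∞ :=
  if a = ∞ then 0 else ENNReal.ofReal (Real.exp (-a.toReal))

theorem measurable_expNeg : Measurable expNeg :=
  Measurable.ite (measurableSet_singleton _) measurable_const (by fun_prop)

theorem expNeg_top : expNeg ∞ = 0 := if_pos rfl

theorem expNeg_le {a : ℝ≥0∞} {b : ℝ} (h : ENNReal.ofReal b ≤ a) :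
    expNeg a ≤ ENNReal.ofReal (Real.exp (-b)) := by
  rw [expNeg]
  split_ifs with ha
  · exact bot_le
  · refine ENNReal.ofReal_le_ofReal (Real.exp_le_exp.2 (neg_le_neg ?_))
    exact (ENNReal.ofReal_le_iff_le_toReal ha).1 h

theorem IsPoissonProcess.lintegral_count_eq [IsProbabilityMeasure Pr]
    (hX : IsPoissonProcess X μ Pr) {A : Set E} (hA : MeasurableSet A) (hμ : μ A ≠ ∞) :
    ∫⁻ ω, pointMeasure (X ω) A ∂Pr = μ A := by
  simpa using hX.lintegral_count_mul hA hμ (g := fun _ => 1) measurable_const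

theorem IsPoissonProcess.ae_finite [IsProbabilityMeasure Pr]
    (hX : IsPoissonProcess X μ Pr) {A : Set E} (hA : MeasurableSet A) (hμ : μ A ≠ ∞) :
    ∀ᵐ ω ∂Pr, (X ω ∩ A).Finite := by
  filter_upwards [ae_lt_top (hX.measurable_apply hA) (by rwa [hX.lintegral_count_eq hA hμ])]
    with ω hω
  rw [pointMeasure_apply _ hA] at hω
  simpa using hω

theorem IsPoissonProcess.ae_disjoint [IsProbabilityMeasure Pr]
    (hX : IsPoissonProcess X μ Pr) {A : Set E} (hA : MeasurableSet A) (hμ : μ A = 0) :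
    ∀ᵐ ω ∂Pr, X ω ∩ A = ∅ := by
  have h := hX.lintegral_count_eq hA (by simp [hμ])
  rw [hμ, lintegral_eq_zero_iff (hX.measurable_apply hA)] at h
  filter_upwards [h] with ω hω
  rw [pointMeasure_apply _ hA] at hω
  simpa using hω

theorem IsPoissonProcess.measure_empty [IsProbabilityMeasure Pr]
    (hX : IsPoissonProcess X μ Pr) {A : Set E} (hA : MeasurableSet A) :
    Pr {ω | pointMeasure (X ω) A = 0} = expNeg (μ A) := by
  have hm : MeasurableSet {ω | pointMeasure (X ω) A = 0} :=
    hX.measurable_apply hA (measurableSet_singleton 0)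
  by_cases hμ : μ A = ∞
  · rw [hμ, expNeg_top]
    have h := hX.count_eq_top A hA hμ
    refine measure_mono_null ?_ (ae_iff.1 h)
    intro ω hω htop
    have h0 : pointMeasure (X ω) A = 0 := hω
    rw [pointMeasure_apply _ hA, htop] at h0
    simp at h0
  · have h1 := hX.lintegral_count hA hμ (g := ({0} : Set ℝ≥0∞).indicator 1)
      (measurable_one.indicator (measurableSet_singleton 0))
    rw [← lintegral_indicator_one hm]
    refine Eq.trans (lintegral_congr fun ω => ?_) (h1.trans ?_)
    · simp only [indicator_apply, mem_ofPred_eq, mem_singleton_iff]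
      split_ifs <;> rfl
    · rw [tsum_eq_single 0]
      · simp [expNeg, hμ]
        rfl
      · intro n hn
        simp [hn]

/-- A Poisson process with σ-finite intensity can be changed on a null set so that every
realisation is countable and locally finite. -/
theorem IsPoissonProcess.exists_regular [IsProbabilityMeasure Pr] [SigmaFinite μ]
    (hX : IsPoissonProcess X μ Pr) :
    ∃ X' : Ω → Set E, IsPoissonProcess X' μ Pr ∧ (∀ ω k, (X' ω ∩ spanningSets μ k).Finite) ∧
      (∀ ω, (X' ω).Countable) ∧ ∀ᵐ ω ∂Pr, X ω = X' ω := by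
  classical
  set G : Set Ω := {ω | ∀ k, pointMeasure (X ω) (spanningSets μ k) < ∞} with hG
  have hGm : MeasurableSet G := by
    have : G = ⋂ k, (fun ω => pointMeasure (X ω) (spanningSets μ k)) ⁻¹' Iio ∞ := by
      ext; simp [hG]
    rw [this]
    exact MeasurableSet.iInter fun k =>
      hX.measurable_apply (measurableSet_spanningSets μ k) measurableSet_Iio
  have hGae : ∀ᵐ ω ∂Pr, ω ∈ G := by
    rw [hG]
    simp only [mem_ofPred_eq, ae_all_iff]
    intro k
    have hk := measurableSet_spanningSets μ k
    exact ae_lt_top (hX.measurable_apply hk)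
      (by rw [hX.lintegral_count_eq hk (measure_spanningSets_lt_top μ k).ne]
          exact (measure_spanningSets_lt_top μ k).ne)
  set X' : Ω → Set E := fun ω => if ω ∈ G then X ω else ∅ with hX'
  have hae : ∀ᵐ ω ∂Pr, X ω = X' ω := by
    filter_upwards [hGae] with ω hω
    simp [hX', hω]
  have hcount : ∀ A : Set E, (fun ω => (X ω ∩ A).encard) =ᵐ[Pr] fun ω => (X' ω ∩ A).encard := by
    intro A
    filter_upwards [hae] with ω hω
    rw [hω]
  have hfin : ∀ ω k, (X' ω ∩ spanningSets μ k).Finite := by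
    intro ω k
    by_cases hω : ω ∈ G
    · have := hω k
      rw [pointMeasure_apply _ (measurableSet_spanningSets μ k)] at this
      simpa [hX', hω] using this
    · simp [hX', hω]
  refine ⟨X', ⟨fun A hA => ?_, fun A hA hμ => ?_, fun A hA hμ => ?_, fun m A hA hd => ?_⟩, hfin,
    fun ω => ?_, hae⟩
  · have : (fun ω => (X' ω ∩ A).encard) = fun ω => if ω ∈ G then (X ω ∩ A).encard else 0 := by
      funext ω
      by_cases hω : ω ∈ G <;> simp [hX', hω]
    rw [this]
    exact Measurable.ite hGm (hX.measurable_count A hA) measurable_const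
  · rw [← Measure.map_congr (hcount A), hX.map_count A hA hμ]
  · filter_upwards [hX.count_eq_top A hA hμ, hae] with ω h1 h2
    rw [← h2, h1]
  · exact (hX.indep m A hA hd).congr fun i => hcount (A i)
  · have : X' ω = ⋃ k, X' ω ∩ spanningSets μ k := by
      rw [← inter_iUnion, iUnion_spanningSets, inter_univ]
    rw [this]
    exact countable_iUnion fun k => (hfin ω k).countable

end General

/-! ### Almost sure properties of the two models -/

section Models

variable {M : Model} {d : ℕ} {β γ : ℝ} {Ω : Type*} [MeasurableSpace Ω] {X : Ω → Set (Pt d)}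
  {Pr : Measure Ω}

theorem measurableSet_same_bound (hd : 1 ≤ d) : MeasurableSet {z : Fin 3 → Pt d |
    ∃ H, bound (z 0) (z 1) = Sum.inl H ∧ bound (z 0) (z 2) = Sum.inl H} := by
  obtain ⟨g⟩ := nonempty_halfSpace hd
  let f : ExtHalfSpace d → HalfSpace d := Sum.elim id fun _ => g
  have hf : Measurable f := measurable_id.sumElim measurable_const
  have hb : ∀ i : Fin 3, Measurable fun z : Fin 3 → Pt d => bound (z 0) (z i) := fun i =>
    (measurable_bound_prod d).comp (f := fun z : Fin 3 → Pt d => (z 0, z i))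
      ((measurable_pi_apply 0).prodMk (measurable_pi_apply i))
  have e : {z : Fin 3 → Pt d | ∃ H, bound (z 0) (z 1) = Sum.inl H ∧ bound (z 0) (z 2) = Sum.inl H} =
      ((fun z => bound (z 0) (z 1)) ⁻¹' range Sum.inl ∩
        (fun z => bound (z 0) (z 2)) ⁻¹' range Sum.inl) ∩
      {z | f (bound (z 0) (z 1)) = f (bound (z 0) (z 2))} := by
    ext z
    constructor
    · rintro ⟨H, h1, h2⟩
      refine ⟨⟨⟨H, h1.symm⟩, ⟨H, h2.symm⟩⟩, ?_⟩
      change f _ = f _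
      rw [h1, h2]
    · rintro ⟨⟨⟨H, h1⟩, ⟨H', h2⟩⟩, h3⟩
      have h4 : f (bound (z 0) (z 1)) = f (bound (z 0) (z 2)) := h3
      have h1 : Sum.inl H = bound (z 0) (z 1) := h1
      have h2 : Sum.inl H' = bound (z 0) (z 2) := h2
      rw [← h1, ← h2] at h4
      have h5 : H = H' := h4
      subst h5
      exact ⟨H, h1.symm, h2.symm⟩
  rw [e]
  exact ((hb 1 measurableSet_range_inl).inter (hb 2 measurableSet_range_inl)).inter
    (measurableSet_eq_fun (hf.comp (hb 1)) (hf.comp (hb 2)))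

/-- By Mecke's formula for triples the mean number of bad triples is an integral over x, y, y', and
for fixed x and y the bad y' form a null set. -/
theorem ae_bound_injective (hd : 1 ≤ d) [IsProbabilityMeasure Pr]
    (hX : IsPoissonProcess X (intensity M d β γ) Pr)
    (hfin : ∀ ω k, (X ω ∩ spanningSets (intensity M d β γ) k).Finite)
    (hcount : ∀ ω, (X ω).Countable) :
    ∀ᵐ ω ∂Pr, ∀ x ∈ X ω, ∀ y ∈ X ω, ∀ y' ∈ X ω, x ≠ y → x ≠ y' → y ≠ y' →
      ∀ H, bound x y = Sum.inl H → bound x y' ≠ Sum.inl H := by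
  set T := {z : Fin 3 → Pt d |
    ∃ H, bound (z 0) (z 1) = Sum.inl H ∧ bound (z 0) (z 2) = Sum.inl H} with hT
  have hTm : MeasurableSet T := measurableSet_same_bound hd
  have hfm : Measurable fun q : (Fin 3 → Pt d) × Measure (Pt d) =>
      T.indicator (1 : (Fin 3 → Pt d) → ℝ≥0∞) q.1 :=
    (measurable_one.indicator hTm).comp measurable_fst
  have h := hX.mecke_pow hfin hcount (intensity_singleton M β γ) 3 hfm
  have hT1 : Measurable (T.indicator (1 : (Fin 3 → Pt d) → ℝ≥0∞)) := measurable_one.indicator hTm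
  have hrhs : ∫⁻ z, T.indicator (1 : (Fin 3 → Pt d) → ℝ≥0∞) z ∂(prodPow (intensity M d β γ) 3) = 0 := by
    rw [lintegral_prodPow_succ _ _ hT1]
    refine lintegral_eq_zero_of_ae_eq_zero (Filter.Eventually.of_forall fun x => ?_)
    have hT2 : Measurable fun z : Fin 2 → Pt d =>
        T.indicator (1 : (Fin 3 → Pt d) → ℝ≥0∞) (Fin.cons x z) :=
      hT1.comp ((measurable_cons 2).comp measurable_prodMk_left)
    refine (lintegral_prodPow_succ _ _ hT2).trans ?_
    refine lintegral_eq_zero_of_ae_eq_zero (Filter.Eventually.of_forall fun y => ?_)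
    have hT3 : Measurable fun z : Fin 1 → Pt d =>
        T.indicator (1 : (Fin 3 → Pt d) → ℝ≥0∞) (Fin.cons x (Fin.cons y z)) :=
      hT2.comp ((measurable_cons 1).comp measurable_prodMk_left)
    refine (lintegral_prodPow_succ _ _ hT3).trans ?_
    refine lintegral_eq_zero_of_ae_eq_zero ?_
    rcases hb : bound x y with H | b
    · have hn : ∀ᵐ y' ∂(intensity M d β γ), bound x y' ≠ Sum.inl H := by
        rw [ae_iff]
        simpa using intensity_bound_eq M β γ x H
      filter_upwards [hn] with y' hy'
      refine lintegral_eq_zero_of_ae_eq_zero (Filter.Eventually.of_forall fun z => ?_)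
      refine indicator_of_notMem ?_ _
      rintro ⟨H', h1, h2⟩
      have h1' : bound x y = Sum.inl H' := h1
      have h2' : bound x y' = Sum.inl H' := h2
      rw [hb] at h1'
      rw [← h1'] at h2'
      exact hy' h2'
    · refine Filter.Eventually.of_forall fun y' => ?_
      refine lintegral_eq_zero_of_ae_eq_zero (Filter.Eventually.of_forall fun z => ?_)
      refine indicator_of_notMem ?_ _
      rintro ⟨H', h1, h2⟩
      have h1' : bound x y = Sum.inl H' := h1
      rw [hb] at h1'
      cases h1'
  have hinj := measurableSet_injective (E := Pt d) 3
  have hcω : ∀ ω, Countable (X ω) := fun ω => (hcount ω).to_subtype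
  have hT4 : Measurable ({z : Fin 3 → Pt d | Function.Injective z}.indicator
      fun z => T.indicator (1 : (Fin 3 → Pt d) → ℝ≥0∞) z) := hT1.indicator hinj
  have hmul : ∀ z, ∫⁻ ω, T.indicator (1 : (Fin 3 → Pt d) → ℝ≥0∞) z ∂Pr = T.indicator 1 z := by
    intro z; simp
  simp only [hmul] at h
  rw [hrhs] at h
  simp only [lintegral_prodPow_pointMeasure _ 3 hT4] at h
  have hmeas : Measurable fun ω => ∑' z : Fin 3 → X ω,
      {z : Fin 3 → Pt d | Function.Injective z}.indicator
        (fun z => T.indicator (1 : (Fin 3 → Pt d) → ℝ≥0∞) z) fun i => z i := by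
    simp only [← lintegral_prodPow_pointMeasure _ 3 hT4]
    have hξ := hX.measurable_pointMeasure
    have hk : ∀ ω, prodPowKernel (intensity M d β γ) 3 (pointMeasure (X ω)) =
        prodPow (pointMeasure (X ω)) 3 := fun ω => prodPowKernel_apply _ _ (fun k => by
      rw [pointMeasure_apply _ (measurableSet_spanningSets _ k)]
      simpa using hfin ω k) 3
    simp only [← hk]
    exact (hT4.lintegral_kernel (κ := prodPowKernel (intensity M d β γ) 3)).comp hξ
  rw [lintegral_eq_zero_iff hmeas] at h
  filter_upwards [h] with ω hω x hx y hy y' hy' hxy hxy' hyy' H h1 h2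
  rw [Pi.zero_apply, ENNReal.tsum_eq_zero] at hω
  have h3 := hω ![⟨x, hx⟩, ⟨y, hy⟩, ⟨y', hy'⟩]
  have hz : (fun i => ((![⟨x, hx⟩, ⟨y, hy⟩, ⟨y', hy'⟩] : Fin 3 → X ω) i : Pt d)) = ![x, y, y'] := by
    funext i; fin_cases i <;> rfl
  rw [hz, indicator_of_mem, indicator_of_mem] at h3
  · exact one_ne_zero h3
  · exact ⟨H, h1, h2⟩
  · intro i j hij
    fin_cases i <;> fin_cases j <;> first
      | rfl
      | exact absurd hij hxy
      | exact absurd hij hxy'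
      | exact absurd hij hyy'
      | exact absurd hij.symm hxy
      | exact absurd hij.symm hxy'
      | exact absurd hij.symm hyy'

/-! ### Covering argument for the β'-model -/

/-- Every point of a ball is close to a point of a finite grid. -/
theorem exists_grid (d N : ℕ) {m : ℕ} (hm : 0 < m) (hd : 1 ≤ d) :
    ∃ S : Finset (Vec d), S.card ≤ (2 * N * m * d + 1) ^ d ∧
      ∀ w : Vec d, ‖w‖ ≤ N → ∃ g ∈ S, ‖w - g‖ ≤ 1 / (m : ℝ) := by
  classical
  set L : ℤ := N * m * d with hL
  -- With mesh 1/(md) the coordinate errors are at most 1/(md), so the Euclidean error is at most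
  -- 1/(m√d) ≤ 1/m.
  let F : (Fin d → ℤ) → Vec d := fun z => WithLp.toLp 2 fun i => (z i : ℝ) / (m * d)
  refine ⟨(Fintype.piFinset fun _ : Fin d => Finset.Icc (-L) L).image F,
    Finset.card_image_le.trans ?_, fun w hw => ?_⟩
  · rw [Fintype.card_piFinset]
    simp only [Int.card_Icc, Finset.prod_const, Finset.card_univ, Fintype.card_fin]
    refine Nat.pow_le_pow_left (le_of_eq ?_) d
    have : L + 1 - -L = ((2 * N * m * d + 1 : ℕ) : ℤ) := by rw [hL]; push_cast; ring
    rw [this, Int.toNat_natCast]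
  · have hmd : (0 : ℝ) < m * d := by
      have h1 : (0 : ℝ) < m := by exact_mod_cast hm
      have h2 : (0 : ℝ) < d := by exact_mod_cast hd
      positivity
    have hwi : ∀ i, |w i| ≤ N := fun i => by
      simpa using (PiLp.norm_apply_le w i).trans hw
    refine ⟨F fun i => ⌊w i * (m * d)⌋, Finset.mem_image_of_mem _ ?_, ?_⟩
    · rw [Fintype.mem_piFinset]
      intro i
      have h1 := abs_le.1 (hwi i)
      have hLr : (L : ℝ) = N * (m * d) := by rw [hL]; push_cast; ring
      rw [Finset.mem_Icc, Int.le_floor]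
      constructor
      · push_cast; rw [hLr]; nlinarith [h1.1]
      · have : (⌊w i * (m * d)⌋ : ℝ) ≤ L := (Int.floor_le _).trans (by rw [hLr]; nlinarith [h1.2])
        exact_mod_cast this
    · have hc : ∀ i, |(w - F fun i => ⌊w i * (m * d)⌋) i| ≤ 1 / (m * d) := by
        intro i
        have e : (w - F fun i => ⌊w i * (m * d)⌋) i = Int.fract (w i * (m * d)) / (m * d) := by
          simp only [PiLp.sub_apply, F, Int.fract]
          field_simp
        rw [e, abs_of_nonneg (div_nonneg (Int.fract_nonneg _) hmd.le)]
        exact div_le_div_of_nonneg_right (Int.fract_lt_one _).le hmd.le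
      rw [EuclideanSpace.norm_eq]
      refine Real.sqrt_le_iff.2 ⟨by positivity, ?_⟩
      have hd' : (1 : ℝ) ≤ d := by exact_mod_cast hd
      calc ∑ i, ‖(w - F fun i => ⌊w i * (m * d)⌋) i‖ ^ 2
          ≤ ∑ _i : Fin d, (1 / (m * d : ℝ)) ^ 2 := by
            refine Finset.sum_le_sum fun i _ => ?_
            rw [Real.norm_eq_abs]
            exact pow_le_pow_left₀ (abs_nonneg _) (hc i) 2
        _ = (1 / (m : ℝ)) ^ 2 * (1 / d) := by
            rw [Finset.sum_const, Finset.card_univ, Fintype.card_fin, nsmul_eq_mul]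
            have h1 : (m : ℝ) ≠ 0 := by positivity
            field_simp
        _ ≤ (1 / (m : ℝ)) ^ 2 := mul_le_of_le_one_right (by positivity)
            ((div_le_one (by linarith)).2 hd')

/-- In the `β'`-model, almost surely every paraboloid with apex at height zero contains a point. -/
theorem ae_exists_below (hd : 1 ≤ d) [IsProbabilityMeasure Pr]
    (hβ : Model.betaPrime.Admissible d β) (hγ : 0 < γ)
    (hX : IsPoissonProcess X (intensity .betaPrime d β γ) Pr) :
    ∀ᵐ ω ∂Pr, ∀ w : Vec d, ∃ y ∈ X ω, ‖w - y.1‖ ^ 2 + y.2 < 0 := by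
  suffices h : ∀ N : ℕ, ∀ᵐ ω ∂Pr, ∀ w : Vec d, ‖w‖ ≤ N → ∃ y ∈ X ω, ‖w - y.1‖ ^ 2 + y.2 < 0 by
    filter_upwards [ae_all_iff.2 h] with ω hω w
    obtain ⟨N, hN⟩ := exists_nat_ge ‖w‖
    exact hω N w hN
  intro N
  rw [ae_iff]
  set Bad := {ω | ¬ ∀ w : Vec d, ‖w‖ ≤ N → ∃ y ∈ X ω, ‖w - y.1‖ ^ 2 + y.2 < 0} with hBad
  set δ := scaleExp .betaPrime d β with hδdef
  have hδ : δ < 0 := scaleExp_neg hβ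
  -- A positive real lower bound is enough, whether or not the box has finite measure.
  obtain ⟨c, hc0, hc⟩ : ∃ c : ℝ, 0 < c ∧ ENNReal.ofReal c ≤ intensity .betaPrime d β γ (box 1 0) := by
    have hp := intensity_box_pos hβ hγ
    by_cases ht : intensity .betaPrime d β γ (box 1 0) = ∞
    · exact ⟨1, one_pos, by rw [ht]; exact le_top⟩
    · exact ⟨_, ENNReal.toReal_pos hp.ne' ht, ENNReal.ofReal_toReal_le⟩
  -- If the claim fails at w, the box of size 1/m at a grid point near w is empty. There are O(m^d)
  -- grid points, and each box is empty with probability at most exp(-c m^{-δ}). Since δ < 0, the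
  -- union bound tends to 0.
  have hbound : ∀ m : ℕ, 0 < m → Pr Bad ≤
      ENNReal.ofReal ((2 * N * d + 1 : ℝ) ^ d * ((m : ℝ) ^ d * Real.exp (-(c * (m : ℝ) ^ (-δ))))) := by
    intro m hm
    have hm' : (0 : ℝ) < m := by exact_mod_cast hm
    obtain ⟨S, hScard, hS⟩ := exists_grid d N hm hd
    have hsub : Bad ⊆ ⋃ g ∈ S, {ω | pointMeasure (X ω) (box (1 / (m : ℝ)) g) = 0} := by
      intro ω hω
      have hω' : ¬ ∀ w : Vec d, ‖w‖ ≤ N → ∃ y ∈ X ω, ‖w - y.1‖ ^ 2 + y.2 < 0 := hω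
      push Not at hω'
      obtain ⟨w, hw, hwy⟩ := hω'
      obtain ⟨g, hg, hwg⟩ := hS w hw
      refine mem_iUnion₂.2 ⟨g, hg, ?_⟩
      rw [mem_ofPred_eq, pointMeasure_apply _ (measurableSet_box _ _)]
      have : X ω ∩ box (1 / (m : ℝ)) g = ∅ := eq_empty_of_forall_notMem fun y hy =>
        absurd (mem_of_mem_box hwg hy.2) (not_lt.2 (hwy y hy.1))
      rw [this]; simp
    refine (measure_mono hsub).trans ((measure_biUnion_finset_le _ _).trans ?_)
    have hone : ∀ g ∈ S, Pr {ω | pointMeasure (X ω) (box (1 / (m : ℝ)) g) = 0} ≤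
        ENNReal.ofReal (Real.exp (-(c * (m : ℝ) ^ (-δ)))) := by
      intro g _
      rw [hX.measure_empty (measurableSet_box _ _)]
      refine expNeg_le ?_
      rw [intensity_box _ _ _ _ (by positivity), ← hδdef, one_div, Real.inv_rpow hm'.le,
        ← Real.rpow_neg hm'.le, mul_comm c, ENNReal.ofReal_mul (by positivity)]
      gcongr
    refine (Finset.sum_le_sum hone).trans ?_
    rw [Finset.sum_const, nsmul_eq_mul, ← mul_assoc, ENNReal.ofReal_mul (by positivity)]
    gcongr
    rw [← mul_pow, ← ENNReal.ofReal_natCast]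
    refine ENNReal.ofReal_le_ofReal ?_
    refine (Nat.cast_le.2 hScard).trans ?_
    push_cast
    refine pow_le_pow_left₀ (by positivity) ?_ d
    have h1 : (1 : ℝ) ≤ m := by exact_mod_cast hm
    nlinarith
  have hlim : Filter.Tendsto (fun m : ℕ => ENNReal.ofReal ((2 * N * d + 1 : ℝ) ^ d *
      ((m : ℝ) ^ d * Real.exp (-(c * (m : ℝ) ^ (-δ)))))) Filter.atTop (nhds 0) := by
    have h1 := tendsto_rpow_mul_exp_neg_mul_atTop_nhds_zero ((d : ℝ) / (-δ)) c hc0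
    have h2 : Filter.Tendsto (fun m : ℕ => (m : ℝ) ^ (-δ)) Filter.atTop Filter.atTop :=
      (tendsto_rpow_atTop (by linarith)).comp tendsto_natCast_atTop_atTop
    have h3 := (h1.comp h2).const_mul ((2 * N * d + 1 : ℝ) ^ d)
    rw [mul_zero] at h3
    have h4 := ENNReal.tendsto_ofReal h3
    rw [ENNReal.ofReal_zero] at h4
    refine h4.congr fun m => ?_
    simp only [Function.comp_apply]
    rw [← Real.rpow_mul (Nat.cast_nonneg m), mul_div_cancel₀ _ (by linarith : -δ ≠ 0),
      Real.rpow_natCast, neg_mul]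
  refine le_antisymm (ge_of_tendsto hlim ?_) bot_le
  filter_upwards [Filter.eventually_gt_atTop 0] with m hm using hbound m hm

/-- The deterministic properties of almost every realisation. -/
structure GenericConfig (M : Model) (A : Set (Pt d)) : Prop where
  pos : ∀ y ∈ A, 0 < M.kappa * y.2
  distinct : ∀ x ∈ A, ∀ y ∈ A, ∀ y' ∈ A, x ≠ y → x ≠ y' → y ≠ y' →
    ∀ H, bound x y = Sum.inl H → bound x y' ≠ Sum.inl H
  finite : ∀ k : ℕ, 0 < k → (A ∩ finiteRegion M d k).Finite
  below : M = .betaPrime → ∀ w : Vec d, ∃ y ∈ A, ‖w - y.1‖ ^ 2 + y.2 < 0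

theorem ae_genericConfig (hd : 1 ≤ d) [IsProbabilityMeasure Pr] (hβ : M.Admissible d β) (hγ : 0 < γ)
    (hX : IsPoissonProcess X (intensity M d β γ) Pr)
    (hfin : ∀ ω k, (X ω ∩ spanningSets (intensity M d β γ) k).Finite)
    (hcount : ∀ ω, (X ω).Countable) : ∀ᵐ ω ∂Pr, GenericConfig M (X ω) := by
  have hs0 : MeasurableSet {y : Pt d | 0 < M.kappa * y.2} :=
    measurableSet_lt measurable_const (by fun_prop)
  have h1 := hX.ae_disjoint (A := {y | ¬ 0 < M.kappa * y.2}) hs0.compl (intensity_nonpos M d β γ)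
  have h2 := ae_bound_injective hd hX hfin hcount
  have h3 : ∀ᵐ ω ∂Pr, ∀ k : ℕ, 0 < k → (X ω ∩ finiteRegion M d k).Finite := by
    rw [ae_all_iff]
    intro k
    by_cases hk : 0 < k
    · filter_upwards [hX.ae_finite (measurableSet_finiteRegion M d k)
        (intensity_finiteRegion hβ γ hk)] with ω hω _ using hω
    · exact Filter.Eventually.of_forall fun ω h => absurd h hk
  have h4 : ∀ᵐ ω ∂Pr, M = .betaPrime → ∀ w : Vec d, ∃ y ∈ X ω, ‖w - y.1‖ ^ 2 + y.2 < 0 := by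
    cases M with
    | beta => exact Filter.Eventually.of_forall fun ω h => nomatch h
    | betaPrime => filter_upwards [ae_exists_below hd hβ hγ hX] with ω hω _ using hω
  filter_upwards [h1, h2, h3, h4] with ω a1 a2 a3 a4
  refine ⟨fun y hy => ?_, a2, a3, a4⟩
  by_contra hcon
  have : y ∈ X ω ∩ {y | ¬ 0 < M.kappa * y.2} := ⟨hy, hcon⟩
  rw [a1] at this
  exact this

end Models

/-! ### Laguerre cells of generic configurations -/

theorem mem_laguerreCell {d : ℕ} {A : Set (Pt d)} {x : Pt d} {w : Vec d} :
    w ∈ laguerreCell A x ↔ ∀ y ∈ A, w ∈ (bound x y).toSet := by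
  simp only [mem_toSet_bound]; rfl

theorem convex_toSet {d : ℕ} (H : ExtHalfSpace d) : Convex ℝ H.toSet := by
  match H with
  | .inl (u, t) => exact convex_halfSpace _ _
  | .inr false => exact convex_empty
  | .inr true => exact convex_univ

/-- The set of points whose bounding half-space does not contain a set `U`. -/
def cutters {d : ℕ} (A : Set (Pt d)) (x : Pt d) (U : Set (Vec d)) : Set (Pt d) :=
  {y ∈ A | ¬ U ⊆ (bound x y).toSet}

/-- Only finitely many points of a generic configuration have a bounding half-space that meets a
small neighbourhood of a bounded cell. -/
theorem GenericConfig.exists_finite_cutters {M : Model} {d : ℕ} {A : Set (Pt d)}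
    (hA : GenericConfig M A) {x : Pt d} {K : ConvexBody (Vec d)}
    (hK : laguerreCell A x = K) :
    ∃ δ : ℝ, 0 < δ ∧ (cutters A x (Metric.thickening δ (K : Set (Vec d)))).Finite := by
  obtain ⟨R, hR0, hR⟩ : ∃ R : ℝ, 0 ≤ R ∧ ∀ w ∈ Metric.thickening 1 (K : Set (Vec d)), ‖w‖ ≤ R := by
    obtain ⟨R, hR⟩ := K.isBounded.thickening (δ := 1) |>.exists_norm_le
    exact ⟨max R 0, le_max_right _ _, fun w hw => (hR w hw).trans (le_max_left _ _)⟩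
  have key : ∀ {δ : ℝ} {y}, y ∈ cutters A x (Metric.thickening δ (K : Set (Vec d))) → y ∈ A ∧
      ∃ w ∈ Metric.thickening δ (K : Set (Vec d)), ‖w - y.1‖ ^ 2 + y.2 < ‖w - x.1‖ ^ 2 + x.2 := by
    rintro δ y ⟨hy, hn⟩
    obtain ⟨w, hw, hwn⟩ := not_subset.1 hn
    rw [mem_toSet_bound, not_le] at hwn
    exact ⟨hy, w, hw, hwn⟩
  cases M with
  | beta =>
    refine ⟨1, one_pos, ?_⟩
    -- S bounds the power distance to x near the cell. A cutter has positive height, so both its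
    -- height and its squared distance to some point w near the cell are below S.
    set S := (R + ‖x.1‖) ^ 2 + |x.2| with hS
    obtain ⟨k, hk⟩ := exists_nat_ge (R + 1 + S)
    have hS0 : 0 ≤ S := by positivity
    refine (hA.finite (k + 1) (Nat.succ_pos k)).subset fun y hy => ?_
    obtain ⟨hyA, w, hw, hlt⟩ := key hy
    have hp : 0 < y.2 := by simpa [Model.kappa] using hA.pos y hyA
    have h1 : ‖w - x.1‖ ^ 2 ≤ (R + ‖x.1‖) ^ 2 :=
      pow_le_pow_left₀ (norm_nonneg _)
        ((norm_sub_le _ _).trans (add_le_add_left (hR w hw) _)) 2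
    have h2 := le_abs_self x.2
    have h3 : ‖w - y.1‖ ≤ 1 + S := by nlinarith [sq_nonneg (‖w - y.1‖ - 1)]
    have h4 : ‖y.1‖ ≤ ‖w‖ + ‖w - y.1‖ := by
      have := norm_sub_le w (w - y.1)
      rwa [sub_sub_cancel] at this
    refine ⟨hyA, ?_, ?_⟩
    · push_cast; linarith [hR w hw]
    · push_cast; nlinarith [sq_nonneg ‖w - y.1‖]
  | betaPrime =>
    set φ : Vec d → ℝ := fun w => ‖w - x.1‖ ^ 2 + x.2 with hφ
    have hφc : Continuous φ := by fun_prop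
    obtain ⟨w₀, hw₀, hmax⟩ := K.isCompact.exists_isMaxOn K.nonempty hφc.continuousOn
    -- Some point of the configuration has negative power distance to w₀, and at a point of the cell
    -- the power distance to x is no larger.
    have hneg : φ w₀ < 0 := by
      obtain ⟨y, hy, hlt⟩ := hA.below rfl w₀
      have hc : w₀ ∈ laguerreCell A x := hK ▸ hw₀
      exact (hc y hy).trans_lt hlt
    have hsub : (K : Set (Vec d)) ⊆ {w | φ w < φ w₀ / 2} := fun w hw =>
      (show φ w ≤ φ w₀ from hmax hw).trans_lt (by linarith)
    obtain ⟨δ, hδ, hδs⟩ := K.isCompact.exists_thickening_subset_open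
      (isOpen_lt hφc continuous_const) hsub
    refine ⟨min δ 1, lt_min hδ one_pos, ?_⟩
    -- Near the cell the power distance to x stays below φ(w₀)/2 < 0, so cutters have height below
    -- φ(w₀)/2, and ‖w - y‖² is less than minus their height. The summand -2/φ(w₀) handles the
    -- height condition, the rest the growth condition.
    obtain ⟨k, hk⟩ := exists_nat_ge (2 * R ^ 2 + 2 + (-2 / φ w₀))
    have hq : 0 < -2 / φ w₀ := div_pos_of_neg_of_neg (by norm_num) hneg
    refine (hA.finite (k + 1) (Nat.succ_pos k)).subset fun y hy => ?_
    obtain ⟨hyA, w, hw, hlt⟩ := key hy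
    have h1 : ‖w‖ ≤ R := hR w (Metric.thickening_mono (min_le_right _ _) _ hw)
    have h2 : φ w < φ w₀ / 2 := hδs (Metric.thickening_mono (min_le_left _ _) _ hw)
    have h3 : ‖w - y.1‖ ^ 2 + y.2 < φ w₀ / 2 := hlt.trans h2
    have h4 : ‖y.1‖ ≤ ‖w‖ + ‖w - y.1‖ := by
      have := norm_sub_le w (w - y.1)
      rwa [sub_sub_cancel] at this
    have h5 : ‖y.1‖ ^ 2 ≤ 2 * R ^ 2 + 2 * ‖w - y.1‖ ^ 2 := by
      nlinarith [sq_nonneg (‖w‖ - ‖w - y.1‖), norm_nonneg w, norm_nonneg y.1,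
        norm_nonneg (w - y.1)]
    have h6 : y.2 < φ w₀ / 2 := by nlinarith [sq_nonneg ‖w - y.1‖]
    refine ⟨hyA, ?_, ?_⟩
    · push_cast
      nlinarith [sq_nonneg R]
    · push_cast
      have hk1 : 0 < (k : ℝ) + 1 := by positivity
      rw [le_div_iff₀ hk1]
      have h7 : (-2 / φ w₀) * φ w₀ = -2 := div_mul_cancel₀ _ hneg.ne
      nlinarith [sq_nonneg R]

/-- A bounded cell is the intersection of the bounding half-spaces of the points near it. -/
theorem iInter_cutters {d : ℕ} {A : Set (Pt d)} {x : Pt d} {K : ConvexBody (Vec d)}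
    (hK : laguerreCell A x = K) {δ : ℝ} (hδ : 0 < δ) :
    (K : Set (Vec d)) =
      ⋂ y : cutters A x (Metric.thickening δ (K : Set (Vec d))), (bound x y).toSet := by
  set Y := cutters A x (Metric.thickening δ (K : Set (Vec d))) with hY
  set C := ⋂ y : Y, (bound x (y : Pt d)).toSet with hC
  have hKC : (K : Set (Vec d)) ⊆ C := by
    refine subset_iInter fun y w hw => ?_
    rw [← hK] at hw
    exact mem_laguerreCell.1 hw y y.2.1
  -- Inside the thickening the points that are not cutters impose no condition.
  have hsub : C ∩ Metric.thickening δ (K : Set (Vec d)) ⊆ K := by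
    rintro w ⟨hwC, hwt⟩
    rw [← hK]
    refine mem_laguerreCell.2 fun y hy => ?_
    by_cases h : Metric.thickening δ (K : Set (Vec d)) ⊆ (bound x y).toSet
    · exact h hwt
    · exact mem_iInter.1 hwC ⟨y, hy, h⟩
  have hCc : Convex ℝ C := convex_iInter fun y => convex_toSet _
  have hclos : closure (Metric.thickening (δ / 2) (K : Set (Vec d))) ⊆
      Metric.thickening δ (K : Set (Vec d)) :=
    (Metric.closure_thickening_subset_cthickening _ _).trans
      (Metric.cthickening_subset_thickening' hδ (by linarith) _)
  -- C is convex, hence connected, and its part in the closure of the smaller thickening already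
  -- lies in K; it therefore cannot leave that thickening.
  have hu : C ⊆ Metric.thickening (δ / 2) (K : Set (Vec d)) := by
    refine hCc.isPreconnected.subset_of_closure_inter_subset Metric.isOpen_thickening ?_ ?_
    · obtain ⟨w, hw⟩ := K.nonempty
      exact ⟨w, hKC hw, Metric.self_subset_thickening (by linarith) _ hw⟩
    · exact fun w hw => Metric.self_subset_thickening (by linarith) _ (hsub ⟨hw.2, hclos hw.1⟩)
  exact hKC.antisymm fun w hw =>
    hsub ⟨hw, Metric.thickening_mono (by linarith) _ (hu hw)⟩

/-- The families of `n` points of `A` whose bounding half-spaces are the facets of the cell of `x`. -/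
def cellFamilies {d : ℕ} (A : Set (Pt d)) (x : Pt d) (n : ℕ) : Set (Fin n → Pt d) :=
  {y | (∀ i, y i ∈ A) ∧ Function.Injective (Fin.cons x y : Fin (n + 1) → Pt d) ∧
    (fun i => bound x (y i)) ∈ goodFamilies d n ∧
    A ∩ openFlower (x, polyBody fun i => bound x (y i)) = ∅}

/-- The chosen points give one inclusion; the other holds because no point of A lies in the flower,
so no bounding half-space cuts the body. -/
theorem laguerreCell_eq_of_cellFamilies {d n : ℕ} {A : Set (Pt d)} {x : Pt d} {y : Fin n → Pt d}
    (hy : y ∈ cellFamilies A x n) :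
    laguerreCell A x = polyBody fun i => bound x (y i) := by
  obtain ⟨h1, -, h3, h4⟩ := hy
  refine Subset.antisymm (fun w hw => ?_) fun w hw => ?_
  · rw [coe_polyBody h3]
    exact mem_iInter.2 fun i => mem_laguerreCell.1 hw _ (h1 i)
  · refine mem_laguerreCell.2 fun z hz => ?_
    by_contra hn
    have : z ∈ A ∩ openFlower (x, polyBody fun i => bound x (y i)) :=
      ⟨hz, mem_openFlower_iff.2 fun hs => hn (hs hw)⟩
    rw [h4] at this
    exact this

theorem bound_self {d : ℕ} (x : Pt d) : bound x x = .inr true := by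
  simp [bound]

/-- The facets of a polytopal cell of a generic configuration are given by distinct points. -/
theorem GenericConfig.exists_cellFamily {M : Model} {d : ℕ} {A : Set (Pt d)}
    (hA : GenericConfig M A) {x : Pt d} {n : ℕ} (hn : 2 ≤ n)
    {K : ConvexBody (Vec d)} (hK : laguerreCell A x = K) (hKn : K ∈ polytopes d n) :
    ∃ y ∈ cellFamilies A x n, ∃ G : Fin n → HalfSpace d,
      (∀ i, bound x (y i) = Sum.inl (G i)) ∧ (K : Set (Vec d)) = polyInter G := by
  classical
  obtain ⟨δ, hδ, hfin⟩ := hA.exists_finite_cutters hK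
  set Y := cutters A x (Metric.thickening δ (K : Set (Vec d))) with hY
  have hKY := iInter_cutters hK hδ
  rw [← hY] at hKY
  -- A cutter with an improper half-space is impossible: ∅ would contain the nonempty cell, and ℝ^d
  -- cuts nothing.
  have hleft : ∀ y : Y, ∃ g, bound x (y : Pt d) = Sum.inl g := by
    intro y
    rcases hb : bound x (y : Pt d) with g | b
    · exact ⟨g, rfl⟩
    · exfalso
      have hn := y.2.2
      have hc := subset_iInter_iff.1 hKY.subset y
      rw [hb] at hn hc
      cases b
      · obtain ⟨w, hw⟩ := K.nonempty
        exact hc hw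
      · exact hn (subset_univ _)
  choose G hG using hleft
  have hfinY : Finite Y := hfin
  have hKG : (K : Set (Vec d)) = polyInter G := by
    rw [hKY]
    exact iInter_congr fun y => by rw [hG]; rfl
  have hs : (polyStrict G).Nonempty := by
    rw [← interior_polyInter, ← hKG]
    exact interior_nonempty_of_mem_polytopes hn hKn
  -- The size of an irredundant subfamily equals the number of facets, so exactly n points remain.
  obtain ⟨s, hs1, hs2⟩ := exists_irredundant_subset G hs
  have hs3 : (polyStrict fun i : s => G i).Nonempty := by
    obtain ⟨w, hw⟩ := hs
    exact ⟨w, fun i => hw i⟩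
  have : Fintype s := Fintype.ofFinite s
  have hcard : Fintype.card s = n := by
    have h := hs1.encard_faces hs3
    rw [hs2, ← hKG, hKn.2] at h
    exact_mod_cast h.symm
  let e : Fin n ≃ s := (Fintype.equivFinOfCardEq hcard).symm
  set y : Fin n → Pt d := fun i => ((e i : Y) : Pt d) with hy
  have hb : ∀ i, bound x (y i) = Sum.inl (G (e i)) := fun i => hG _
  have hKe : (K : Set (Vec d)) = polyInter fun i => G (e i) := by
    rw [hKG, ← hs2]
    ext w
    simp only [mem_polyInter]
    exact ⟨fun h i => h (e i), fun h i => by simpa using h (e.symm i)⟩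
  have hinter : (K : Set (Vec d)) = ⋂ i, (bound x (y i)).toSet := by
    rw [hKe]
    exact iInter_congr fun i => by rw [hb]; rfl
  have hgood : (fun i => bound x (y i)) ∈ goodFamilies d n := ⟨K, hKn, hinter⟩
  have hKp : (polyBody fun i => bound x (y i)) = K :=
    SetLike.coe_injective (by rw [coe_polyBody hgood, hinter])
  refine ⟨y, ⟨fun i => (e i : Y).2.1, ?_, hgood, ?_⟩, fun i => G (e i), hb, hKe⟩
  · rw [Fin.cons_injective_iff]
    refine ⟨?_, fun i j hij => e.injective (Subtype.ext (Subtype.ext hij))⟩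
    rintro ⟨i, hi⟩
    have := hb i
    rw [hi, bound_self] at this
    cases this
  · rw [hKp]
    refine eq_empty_of_forall_notMem fun z hz => ?_
    refine (mem_openFlower_iff.1 hz.2) fun w hw => ?_
    have hwc : w ∈ laguerreCell A x := by rw [hK]; exact hw
    exact mem_laguerreCell.1 hwc z hz.1

/-- A polytopal cell with `n` facets comes from `n!` families of points. -/
theorem GenericConfig.encard_cellFamilies {M : Model} {d : ℕ} {A : Set (Pt d)}
    (hA : GenericConfig M A) {x : Pt d} (hx : x ∈ A) {n : ℕ} (hn : 2 ≤ n)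
    {K : ConvexBody (Vec d)} (hK : laguerreCell A x = K) (hKn : K ∈ polytopes d n) :
    (cellFamilies A x n).encard = n.factorial := by
  obtain ⟨y, hy, G, hG, hKG⟩ := hA.exists_cellFamily hn hK hKn
  obtain ⟨hyA, hyi, hyg, hye⟩ := id hy
  rw [Fin.cons_injective_iff] at hyi
  -- All families are reorderings of one of them, because the irredundant description of the cell is
  -- unique up to order.
  suffices h : cellFamilies A x n = (fun σ : Equiv.Perm (Fin n) => y ∘ σ) '' univ by
    rw [h, Function.Injective.encard_image]
    · rw [encard_univ, ENat.card_eq_coe_fintype_card, Fintype.card_perm, Fintype.card_fin]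
    · intro σ τ hστ
      exact Equiv.ext fun i => hyi.2 (congrFun hστ i)
  ext z
  simp only [image_univ, mem_range]
  constructor
  · intro hz
    obtain ⟨hzA, hzi, hzg, hze⟩ := id hz
    rw [Fin.cons_injective_iff] at hzi
    obtain ⟨F, hF, hFz⟩ := exists_left_of_goodFamilies hn hzg
    have hFK : polyInter F = polyInter G := by
      rw [← hKG, ← hK, laguerreCell_eq_of_cellFamilies hz, coe_polyBody hzg]
      refine iInter_congr fun i => ?_
      rw [show bound x (z i) = Sum.inl (F i) from congrFun hFz i]
      rfl
    have hex : ∀ i, ∃ j, y j = z i := by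
      intro i
      obtain ⟨j, hj⟩ := hF.2.2.mem_range hF.2.1 hFK i
      refine ⟨j, ?_⟩
      by_contra hne
      have hxy : x ≠ y j := fun e => hyi.1 ⟨j, e.symm⟩
      have hxz : x ≠ z i := fun e => hzi.1 ⟨i, e.symm⟩
      -- Equal half-spaces come from equal points; this is where genericity enters the count.
      refine hA.distinct x hx _ (hyA j) _ (hzA i) hxy hxz hne (G j) (hG j) ?_
      rw [hj]
      exact congrFun hFz i
    choose σ hσ using hex
    have hσi : Function.Injective σ := fun i j hij => hzi.2 (by rw [← hσ, ← hσ, hij])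
    exact ⟨Equiv.ofBijective σ (Finite.injective_iff_bijective.1 hσi), funext hσ⟩
  · rintro ⟨σ, rfl⟩
    have hI : ⋂ i, (bound x ((y ∘ σ) i)).toSet = ⋂ i, (bound x (y i)).toSet :=
      σ.surjective.iInter_comp fun i => (bound x (y i)).toSet
    have hg : (fun i => bound x ((y ∘ σ) i)) ∈ goodFamilies d n := by
      obtain ⟨L, hL, hL2⟩ := hyg
      exact ⟨L, hL, hL2.trans hI.symm⟩
    have hp : (polyBody fun i => bound x ((y ∘ σ) i)) = polyBody fun i => bound x (y i) :=
      SetLike.coe_injective (by rw [coe_polyBody hg, coe_polyBody hyg, hI])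
    refine ⟨fun i => hyA _, ?_, hg, by rw [hp]; exact hye⟩
    rw [Fin.cons_injective_iff]
    refine ⟨?_, hyi.2.comp σ.injective⟩
    rintro ⟨i, hi⟩
    exact hyi.1 ⟨σ i, hi⟩

/-! ### Translations -/

/-- The translate of a proper or improper half-space. -/
noncomputable def ExtHalfSpace.shift {d : ℕ} (a : Vec d) : ExtHalfSpace d → ExtHalfSpace d
  | .inl (u, t) => .inl (u, t + inner ℝ a (u : Vec d))
  | .inr b => .inr b

theorem bound_shiftPt {d : ℕ} (a : Vec d) (x y : Pt d) :
    bound (shiftPt a x) (shiftPt a y) = (bound x y).shift a := by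
  have e0 : y.1 + a - (x.1 + a) = y.1 - x.1 := by abel
  have e1 : y.2 + ‖y.1 + a‖ ^ 2 - x.2 - ‖x.1 + a‖ ^ 2 =
      y.2 + ‖y.1‖ ^ 2 - x.2 - ‖x.1‖ ^ 2 + 2 * inner ℝ a (y.1 - x.1) := by
    rw [norm_add_sq_real, norm_add_sq_real, inner_sub_right, real_inner_comm a y.1,
      real_inner_comm a x.1]
    ring
  by_cases h : y.1 - x.1 = 0
  · have hxy : y.1 = x.1 := sub_eq_zero.1 h
    simp [bound, shiftPt, hxy, ExtHalfSpace.shift]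
    constructor <;> intro _ <;> linarith
  · have hn : ‖y.1 - x.1‖ ≠ 0 := norm_ne_zero_iff.2 h
    simp only [bound, shiftPt, e0, e1, h, dite_false, ExtHalfSpace.shift, Sum.inl.injEq,
      Prod.mk.injEq, true_and]
    rw [real_inner_smul_right]
    field_simp

theorem ExtHalfSpace.shift_injective {d : ℕ} (a : Vec d) :
    Function.Injective (ExtHalfSpace.shift a) := by
  rintro (⟨u, t⟩ | b) (⟨u', t'⟩ | b') h
  · simp only [ExtHalfSpace.shift, Sum.inl.injEq, Prod.mk.injEq] at h
    obtain ⟨rfl, h⟩ := h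
    simpa using h
  · cases h
  · cases h
  · exact h

theorem shiftPt_injective {d : ℕ} (a : Vec d) : Function.Injective (shiftPt a) := by
  rintro ⟨v, h⟩ ⟨v', h'⟩ e
  simpa [shiftPt] using e

theorem GenericConfig.image_shiftPt {M : Model} {d : ℕ} {A : Set (Pt d)} (hA : GenericConfig M A)
    (a : Vec d) : GenericConfig M (shiftPt a '' A) := by
  refine ⟨?_, ?_, ?_, ?_⟩
  · rintro _ ⟨y, hy, rfl⟩
    exact hA.pos y hy
  · rintro _ ⟨x, hx, rfl⟩ _ ⟨y, hy, rfl⟩ _ ⟨y', hy', rfl⟩ h1 h2 h3 H e1 e2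
    rw [bound_shiftPt] at e1 e2
    rcases hb : bound x y with g | b
    · refine hA.distinct x hx y hy y' hy' (fun e => h1 (by rw [e])) (fun e => h2 (by rw [e]))
        (fun e => h3 (by rw [e])) g hb ?_
      rw [← hb]
      exact ExtHalfSpace.shift_injective a (e2.trans e1.symm)
    · rw [hb] at e1
      cases e1
  · intro k hk
    have hk0 : (0 : ℝ) < k := by exact_mod_cast hk
    -- Chosen so that the translate by -a of the k-th region lies in region N + 1, via ‖v‖² ≤ 2‖v +
    -- a‖² + 2‖a‖² in the β'-model.
    obtain ⟨N, hN⟩ := exists_nat_ge (2 * k + 2 * ‖a‖ ^ 2 + ‖a‖ : ℝ)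
    refine ((hA.finite (N + 1) (Nat.succ_pos N)).image (shiftPt a)).subset ?_
    rintro _ ⟨⟨y, hy, rfl⟩, hr⟩
    refine ⟨y, ⟨hy, ?_⟩, rfl⟩
    have hle : ‖y.1‖ ≤ ‖y.1 + a‖ + ‖a‖ := by
      have := norm_sub_le (y.1 + a) a
      rwa [add_sub_cancel_right] at this
    have h0 := norm_nonneg a
    cases M with
    | beta =>
      obtain ⟨h1, h2⟩ := hr
      simp only [shiftPt] at h1 h2
      refine ⟨?_, ?_⟩ <;> push_cast <;> nlinarith [sq_nonneg ‖a‖]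
    | betaPrime =>
      obtain ⟨h1, h2⟩ := hr
      simp only [shiftPt] at h1 h2
      have hkN : (k : ℝ) ≤ N + 1 := by nlinarith [sq_nonneg ‖a‖]
      have hneg : y.2 ≤ 0 := h2.trans (by rw [div_nonpos_iff]; right; constructor <;> linarith)
      refine ⟨?_, h2.trans ?_⟩ <;> push_cast
      · have h5 : ‖y.1‖ ^ 2 ≤ 2 * ‖y.1 + a‖ ^ 2 + 2 * ‖a‖ ^ 2 := by
          nlinarith [sq_nonneg (‖y.1 + a‖ - ‖a‖), norm_nonneg y.1, norm_nonneg (y.1 + a)]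
        nlinarith [sq_nonneg ‖a‖]
      · rw [neg_div, neg_div, neg_le_neg_iff]
        exact one_div_le_one_div_of_le hk0 hkN
  · intro hM w
    obtain ⟨y, hy, hlt⟩ := hA.below hM (w - a)
    refine ⟨_, ⟨y, hy, rfl⟩, ?_⟩
    have : w - (y.1 + a) = w - a - y.1 := by abel
    simpa [shiftPt, this] using hlt

theorem laguerreCell_image_shiftPt {d : ℕ} (A : Set (Pt d)) (a : Vec d) (x : Pt d) :
    laguerreCell (shiftPt a '' A) (shiftPt a x) = (fun w => w + a) '' laguerreCell A x := by
  ext w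
  simp only [laguerreCell, mem_ofPred_eq, mem_image, shiftPt]
  have e : ∀ v : Vec d, w - (v + a) = w - a - v := fun v => by abel
  simp only [e]
  constructor
  · intro h
    refine ⟨w - a, fun y hy => ?_, by abel⟩
    have h1 := h _ ⟨y, hy, rfl⟩
    rwa [e] at h1
  · rintro ⟨w', h, rfl⟩ _ ⟨y, hy, rfl⟩
    have e' : w' + a - (y.1 + a) = w' - y.1 := by abel
    rw [add_sub_cancel_right, e']
    exact h y hy

/-! ### The mean number of polytopal cells -/

/-- The body cut out by the bounding half-spaces of `(0, h)` and `n` points, marked by `(0, h)`. -/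
noncomputable def originMark {d n : ℕ} (p : ℝ × (Fin n → Pt d)) : Marked d :=
  (((0 : Vec d), p.1), polyBody fun i => bound ((0 : Vec d), p.1) (p.2 i))

/-- The families of points whose bounding half-spaces are the facets of a polytope. -/
def goodTuples (d n : ℕ) : Set (ℝ × (Fin n → Pt d)) :=
  {p | (fun i => bound ((0 : Vec d), p.1) (p.2 i)) ∈ goodFamilies d n}

/-- The translate of a family of points that moves the first point to the origin. -/
noncomputable def recentre {d n : ℕ} (z : Fin (n + 1) → Pt d) : ℝ × (Fin n → Pt d) :=
  ((z 0).2, fun i => shiftPt (-(z 0).1) (z i.succ))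

/-- The region that contains no point if the points `z 1, …, z n` determine the cell of `z 0`. -/
def voidRegion {d n : ℕ} (z : Fin (n + 1) → Pt d) : Set (Pt d) :=
  shiftPt (-(z 0).1) ⁻¹' openFlower (originMark (recentre z))

/-- The families `z` such that `z 1, …, z n` determine a polytope in `D` for the point `z 0` in `B`. -/
def cellEvent {d : ℕ} (n : ℕ) (B : Set (Vec d)) (D : Set (Marked d)) : Set (Fin (n + 1) → Pt d) :=
  {z | (z 0).1 ∈ B ∧ recentre z ∈ goodTuples d n ∧ originMark (recentre z) ∈ D}

theorem measurable_bound_tuple (d n : ℕ) : Measurable fun p : ℝ × (Fin n → Pt d) =>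
    fun i => bound ((0 : Vec d), p.1) (p.2 i) := by
  refine measurable_pi_lambda _ fun i => ?_
  exact (measurable_bound_prod d).comp
    (f := fun p : ℝ × (Fin n → Pt d) => (((0 : Vec d), p.1), p.2 i)) (by fun_prop)

section

variable {d n : ℕ}

theorem measurable_originMark (hd : 1 ≤ d) (hn : 2 ≤ n) :
    Measurable (originMark (d := d) (n := n)) :=
  (measurable_const.prodMk measurable_fst).prodMk
    ((measurable_polyBody hd hn).comp (measurable_bound_tuple d n))

theorem measurableSet_goodTuples (hd : 1 ≤ d) (hn : 2 ≤ n) : MeasurableSet (goodTuples d n) :=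
  measurable_bound_tuple d n (measurableSet_goodFamilies hd hn)

theorem measurable_recentre : Measurable (recentre (d := d) (n := n)) := by
  unfold recentre shiftPt; fun_prop

theorem measurableSet_cellEvent (hd : 1 ≤ d) (hn : 2 ≤ n) {B : Set (Vec d)} {D : Set (Marked d)}
    (hB : MeasurableSet B) (hD : MeasurableSet D) : MeasurableSet (cellEvent n B D) := by
  have h1 : MeasurableSet {z : Fin (n + 1) → Pt d | (z 0).1 ∈ B} :=
    (by fun_prop : Measurable fun z : Fin (n + 1) → Pt d => (z 0).1) hB
  have h2 : MeasurableSet {z : Fin (n + 1) → Pt d | recentre z ∈ goodTuples d n} :=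
    measurable_recentre (measurableSet_goodTuples hd hn)
  have h3 : MeasurableSet {z : Fin (n + 1) → Pt d | originMark (recentre z) ∈ D} :=
    ((measurable_originMark hd hn).comp measurable_recentre) hD
  exact h1.inter (h2.inter h3)

theorem measurableSet_voidRegion_prod (hd : 1 ≤ d) (hn : 2 ≤ n) :
    MeasurableSet {q : (Fin (n + 1) → Pt d) × Pt d | q.2 ∈ voidRegion q.1} := by
  have h1 : Measurable fun q : (Fin (n + 1) → Pt d) × Pt d => shiftPt (-(q.1 0).1) q.2 := by
    unfold shiftPt; fun_prop
  have h2 : Measurable fun q : (Fin (n + 1) → Pt d) × Pt d =>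
      (originMark (recentre q.1), shiftPt (-(q.1 0).1) q.2) :=
    ((measurable_originMark hd hn).comp (measurable_recentre.comp measurable_fst)).prodMk h1
  exact h2 (measurableSet_openFlower d)

theorem measurableSet_voidRegion (hd : 1 ≤ d) (hn : 2 ≤ n) (z : Fin (n + 1) → Pt d) :
    MeasurableSet (voidRegion z) :=
  measurable_prodMk_left (measurableSet_voidRegion_prod hd hn)

/-- The evaluation of m on a set varying with z is jointly measurable for s-finite kernels, hence
`regKernel μ q.2` in place of `q.2`. -/
theorem measurableSet_void (hd : 1 ≤ d) (hn : 2 ≤ n) (μ : Measure (Pt d)) [SigmaFinite μ] :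
    MeasurableSet {q : (Fin (n + 1) → Pt d) × Measure (Pt d) |
      regKernel μ q.2 (voidRegion q.1) = 0} := by
  have h1 : Measurable fun q : ((Fin (n + 1) → Pt d) × Measure (Pt d)) × Pt d => (q.1.1, q.2) :=
    (measurable_fst.comp measurable_fst).prodMk measurable_snd
  have h2 : MeasurableSet {q : ((Fin (n + 1) → Pt d) × Measure (Pt d)) × Pt d |
      q.2 ∈ voidRegion q.1.1} := h1 (measurableSet_voidRegion_prod hd hn)
  have h3 := Kernel.measurable_kernel_prodMk_left
    (κ := (regKernel μ).comap (Prod.snd : (Fin (n + 1) → Pt d) × Measure (Pt d) → _)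
      measurable_snd) h2
  have h4 : Measurable fun q : (Fin (n + 1) → Pt d) × Measure (Pt d) =>
      regKernel μ q.2 (voidRegion q.1) := by
    simp only [Kernel.comap_apply] at h3
    exact h3
  exact h4 (measurableSet_singleton 0)

/-- Guarantees that the Dirac masses added by Mecke's formula do not affect the emptiness of the
flower. -/
theorem notMem_voidRegion {z : Fin (n + 1) → Pt d} (hz : recentre z ∈ goodTuples d n)
    (i : Fin (n + 1)) : z i ∉ voidRegion z := by
  intro h
  have h' : shiftPt (-(z 0).1) (z i) ∈ openFlower (originMark (recentre z)) := h
  refine Fin.cases (motive := fun i => ¬ shiftPt (-(z 0).1) (z i) ∈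
    openFlower (originMark (recentre z))) ?_ (fun j => ?_) i h'
  · rintro ⟨w, -, hw⟩
    simp [shiftPt, originMark, recentre] at hw
  · intro hj
    refine mem_openFlower_iff.1 hj ?_
    have hc := coe_polyBody hz
    intro w hw
    exact mem_iInter.1 (hc.subset hw) j

theorem comp_shiftPt_mem_cellFamilies {A : Set (Pt d)} {x : Pt d} {y : Fin n → Pt d} :
    (fun i => shiftPt (-x.1) (y i)) ∈ cellFamilies (shiftPt (-x.1) '' A) ((0 : Vec d), x.2) n ↔
      (∀ i, y i ∈ A) ∧ Function.Injective (Fin.cons x y : Fin (n + 1) → Pt d) ∧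
      recentre (Fin.cons x y : Fin (n + 1) → Pt d) ∈ goodTuples d n ∧
      A ∩ voidRegion (Fin.cons x y : Fin (n + 1) → Pt d) = ∅ := by
  have hx : ((0 : Vec d), x.2) = shiftPt (-x.1) x := by simp [shiftPt]
  have hcons : (Fin.cons ((0 : Vec d), x.2) (fun i => shiftPt (-x.1) (y i)) : Fin (n + 1) → Pt d) =
      shiftPt (-x.1) ∘ (Fin.cons x y : Fin (n + 1) → Pt d) := by
    funext i
    refine Fin.cases ?_ (fun j => ?_) i
    · simp [hx]
    · simp
  unfold cellFamilies
  rw [mem_ofPred_eq, hcons, (shiftPt_injective (-x.1)).of_comp_iff]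
  refine and_congr (forall_congr' fun i => (shiftPt_injective _).mem_set_image) (and_congr Iff.rfl
    (and_congr Iff.rfl ?_))
  have e : shiftPt (-x.1) '' (A ∩ voidRegion (Fin.cons x y : Fin (n + 1) → Pt d)) =
      shiftPt (-x.1) '' A ∩ openFlower (originMark (recentre (Fin.cons x y : Fin (n + 1) → Pt d))) :=
    image_inter_preimage _ _ _
  rw [← image_eq_empty (f := shiftPt (-x.1)) (s := A ∩ voidRegion _), e]
  rfl

theorem laguerreCell_recentre {A : Set (Pt d)} {x : Pt d} {K : ConvexBody (Vec d)} :
    laguerreCell A x = (fun w => w + x.1) '' (K : Set (Vec d)) ↔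
      laguerreCell (shiftPt (-x.1) '' A) ((0 : Vec d), x.2) = K := by
  have hx : ((0 : Vec d), x.2) = shiftPt (-x.1) x := by simp [shiftPt]
  rw [hx, laguerreCell_image_shiftPt]
  constructor
  · intro h
    rw [h, image_image]
    simp
  · intro h
    rw [← h, image_image]
    simp

-- After translation of x to the origin the fibre is a set of `cellFamilies`: n! families if the
-- cell is a polytope in D, none otherwise.
open Classical in
theorem GenericConfig.encard_fibre {M : Model} {A : Set (Pt d)} (hA : GenericConfig M A) (hn : 2 ≤ n)
    {x : Pt d} (hx : x ∈ A) (B : Set (Vec d)) {D : Set (Marked d)}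
    (hD : ∀ p ∈ D, p.2 ∈ polytopes d n) :
    {y : Fin n → Pt d | (∀ i, y i ∈ A) ∧ Function.Injective (Fin.cons x y : Fin (n + 1) → Pt d) ∧
      (Fin.cons x y : Fin (n + 1) → Pt d) ∈ cellEvent n B D ∧
      A ∩ voidRegion (Fin.cons x y : Fin (n + 1) → Pt d) = ∅}.encard =
    if x ∈ cellsIn A B D then (n.factorial : ℕ∞) else 0 := by
  set V := {y : Fin n → Pt d | (∀ i, y i ∈ A) ∧
      Function.Injective (Fin.cons x y : Fin (n + 1) → Pt d) ∧
      (Fin.cons x y : Fin (n + 1) → Pt d) ∈ cellEvent n B D ∧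
      A ∩ voidRegion (Fin.cons x y : Fin (n + 1) → Pt d) = ∅} with hV
  set F := cellFamilies (shiftPt (-x.1) '' A) ((0 : Vec d), x.2) n with hF
  have hmark : ∀ y : Fin n → Pt d, originMark (recentre (Fin.cons x y : Fin (n + 1) → Pt d)) =
      (((0 : Vec d), x.2), polyBody fun i => bound ((0 : Vec d), x.2) (shiftPt (-x.1) (y i))) :=
    fun y => rfl
  split_ifs with hc
  · obtain ⟨-, hxB, K, hK, hKD⟩ := hc
    have hK' := laguerreCell_recentre.1 hK
    have hxA' : ((0 : Vec d), x.2) ∈ shiftPt (-x.1) '' A := ⟨x, hx, by simp [shiftPt]⟩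
    have hVF : V = (fun (y : Fin n → Pt d) i => shiftPt (-x.1) (y i)) ⁻¹' F := by
      ext y
      rw [mem_preimage, hF, comp_shiftPt_mem_cellFamilies]
      constructor
      · rintro ⟨h1, h2, h3, h4⟩
        exact ⟨h1, h2, h3.2.1, h4⟩
      · rintro ⟨h1, h2, h3, h4⟩
        refine ⟨h1, h2, ⟨hxB, h3, ?_⟩, h4⟩
        have h5 := laguerreCell_eq_of_cellFamilies
          (comp_shiftPt_mem_cellFamilies.2 ⟨h1, h2, h3, h4⟩)
        rw [hK'] at h5
        rw [hmark, ← SetLike.coe_injective h5]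
        exact hKD
    have hinj : Function.Injective fun (y : Fin n → Pt d) i => shiftPt (-x.1) (y i) :=
      fun y y' h => funext fun i => shiftPt_injective _ (congrFun h i)
    have hsurj : Function.Surjective fun (y : Fin n → Pt d) i => shiftPt (-x.1) (y i) :=
      fun y => ⟨fun i => shiftPt x.1 (y i), funext fun i => by simp [shiftPt]⟩
    rw [hVF, ← hinj.encard_image, image_preimage_eq _ hsurj]
    exact (hA.image_shiftPt (-x.1)).encard_cellFamilies hxA' hn hK' (hD _ hKD)
  · rw [encard_eq_zero]
    refine eq_empty_of_forall_notMem fun y hy => hc ?_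
    obtain ⟨h1, h2, h3, h4⟩ := hy
    refine ⟨hx, h3.1, _, laguerreCell_recentre.2 (laguerreCell_eq_of_cellFamilies
      (comp_shiftPt_mem_cellFamilies.2 ⟨h1, h2, h3.2.1, h4⟩)), ?_⟩
    rw [← hmark]
    exact h3.2.2

theorem tsum_indicator_one_eq_encard {ι κ : Type*} {g : ι → κ} (hg : Function.Injective g)
    {V : Set κ} (hV : V ⊆ range g) : ∑' i, V.indicator (1 : κ → ℝ≥0∞) (g i) = (V.encard : ℝ≥0∞) := by
  rw [hg.tsum_eq (f := V.indicator (1 : κ → ℝ≥0∞)), ← tsum_subtype V (1 : κ → ℝ≥0∞)]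
  · exact ENNReal.tsum_set_one V
  · exact (support_indicator_subset).trans hV

/-- The left side of Mecke's formula: summation over the last n points counts each cell n! times. -/
theorem GenericConfig.lintegral_cellEvent {M : Model} {A : Set (Pt d)} (hA : GenericConfig M A)
    (hc : A.Countable) (hd : 1 ≤ d) (hn : 2 ≤ n) {B : Set (Vec d)} {D : Set (Marked d)}
    (hD : ∀ p ∈ D, p.2 ∈ polytopes d n) {Q : Set (Fin (n + 1) → Pt d)} (hQ : MeasurableSet Q)
    (hQe : ∀ z, z ∈ Q ↔ z ∈ cellEvent n B D ∧ pointMeasure A (voidRegion z) = 0) :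
    ∫⁻ z, {z : Fin (n + 1) → Pt d | Function.Injective z}.indicator
      (Q.indicator (1 : (Fin (n + 1) → Pt d) → ℝ≥0∞)) z ∂(prodPow (pointMeasure A) (n + 1)) =
      n.factorial * ((cellsIn A B D).encard : ℝ≥0∞) := by
  classical
  have : Countable A := hc.to_subtype
  have : SFinite (pointMeasure A) := by unfold pointMeasure; infer_instance
  set F : (Fin (n + 1) → Pt d) → ℝ≥0∞ := {z : Fin (n + 1) → Pt d | Function.Injective z}.indicator
      (Q.indicator (1 : (Fin (n + 1) → Pt d) → ℝ≥0∞)) with hF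
  have hFm : Measurable F :=
    (measurable_one.indicator hQ).indicator (measurableSet_injective (n + 1))
  have hFm2 : Measurable fun p : Pt d × (Fin n → Pt d) => F (Fin.cons p.1 p.2) :=
    hFm.comp (measurable_cons n)
  rw [lintegral_prodPow_succ _ _ hFm, lintegral_pointMeasure _ hFm2.lintegral_prod_right']
  have h1 : ∀ x : A, ∫⁻ y, F (Fin.cons (x : Pt d) y) ∂(prodPow (pointMeasure A) n) =
      n.factorial * (cellsIn A B D).indicator (1 : Pt d → ℝ≥0∞) x := by
    intro x
    have hx := hA.encard_fibre hn x.2 B hD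
    have hFx : Measurable fun y : Fin n → Pt d => F (Fin.cons (x : Pt d) y) :=
      hFm2.comp measurable_prodMk_left
    rw [lintegral_prodPow_pointMeasure _ _ hFx]
    set V := {y : Fin n → Pt d | (∀ i, y i ∈ A) ∧
      Function.Injective (Fin.cons (x : Pt d) y : Fin (n + 1) → Pt d) ∧
      (Fin.cons (x : Pt d) y : Fin (n + 1) → Pt d) ∈ cellEvent n B D ∧
      A ∩ voidRegion (Fin.cons (x : Pt d) y : Fin (n + 1) → Pt d) = ∅} with hV
    have hinj : Function.Injective fun (y : Fin n → A) i => (y i : Pt d) :=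
      fun y y' h => funext fun i => Subtype.ext (congrFun h i)
    have hVr : V ⊆ range fun (y : Fin n → A) i => (y i : Pt d) :=
      fun y hy => ⟨fun i => ⟨y i, hy.1 i⟩, rfl⟩
    have e := tsum_indicator_one_eq_encard hinj hVr
    have hVF : ∀ y : Fin n → A, F (Fin.cons (x : Pt d) fun i => (y i : Pt d)) =
        V.indicator (1 : (Fin n → Pt d) → ℝ≥0∞) fun i => (y i : Pt d) := by
      intro y
      have hpm : ∀ z : Fin (n + 1) → Pt d,
          pointMeasure A (voidRegion z) = 0 ↔ A ∩ voidRegion z = ∅ := by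
        intro z
        rw [pointMeasure_apply _ (measurableSet_voidRegion hd hn z)]
        simp
      simp only [hF, hV, indicator_apply, mem_ofPred_eq, hQe, hpm, Subtype.coe_prop, implies_true,
        true_and, Pi.one_apply]
      rw [← ite_and]
    simp only [hVF]
    rw [e, hx, indicator_apply]
    split_ifs <;> simp
  simp only [h1]
  rw [ENNReal.tsum_mul_left, tsum_indicator_one_eq_encard Subtype.val_injective]
  rw [Subtype.range_coe]
  exact fun x hx => hx.1

theorem prodPow_map {α β : Type*} [MeasurableSpace α] [MeasurableSpace β] (m : Measure α) [SFinite m]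
    {f : α → β} (hf : Measurable f) : ∀ n, prodPow (m.map f) n = (prodPow m n).map fun z i => f (z i)
  | 0 => by
    have : Measurable fun (z : Fin 0 → α) i => f (z i) := measurable_of_countable _
    rw [prodPow, prodPow, Measure.map_dirac' this]
    congr 1
    exact funext fun i => i.elim0
  | n + 1 => by
    have h1 : Measurable fun (z : Fin n → α) i => f (z i) := by fun_prop
    have h2 : Measurable fun (z : Fin (n + 1) → α) i => f (z i) := by fun_prop
    rw [prodPow, prodPow, prodPow_map m hf n, Measure.map_prod_map _ _ hf h1,
      Measure.map_map (measurable_cons n) (hf.prodMap h1), Measure.map_map h2 (measurable_cons n)]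
    congr 1
    funext p
    funext i
    refine Fin.cases ?_ (fun j => ?_) i <;> simp

end

/-! ### The `Φ`-content -/

theorem phiContent_eq (M : Model) {d : ℕ} (β γ : ℝ) (p : Marked d) :
    phiContent M β γ p = intensity M d β γ (openFlower p) := by
  rw [openFlower_eq, phiContent, measure_sdiff_null (intensity_singleton M β γ p.1)]

theorem measurable_phiContent (M : Model) (d : ℕ) (β γ : ℝ) :
    Measurable (phiContent M (d := d) β γ) := by
  have : phiContent M (d := d) β γ = fun p => intensity M d β γ (openFlower p) :=
    funext fun p => phiContent_eq M β γ p
  rw [this]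
  exact measurable_measure_prodMk_left (measurableSet_openFlower d)

/-- The integral of a function of marked polytopes with `n` facets with respect to the measure
`(1 / n!) ∫ ∫ 1{((0, h), H₁ ∩ ⋯ ∩ Hₙ) ∈ ·} μ̃ⁿ(dH) (κ h)^{κ β} dh`. -/
noncomputable def cellIntegral (M : Model) {d : ℕ} (β γ : ℝ) (n : ℕ) (f : Marked d → ℝ≥0∞) : ℝ≥0∞ :=
  ∫⁻ h, (n.factorial : ℝ≥0∞)⁻¹ * ∫⁻ y, (goodTuples d n).indicator (fun p => f (originMark p)) (h, y)
    ∂(prodPow (intensity M d β γ) n) ∂(heightMeasure M β)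

section

variable {M : Model} {d n : ℕ} {β γ : ℝ} {Ω : Type*} [MeasurableSpace Ω] {X : Ω → Set (Pt d)}
  {Pr : Measure Ω}

theorem measurable_cellIntegrand (hd : 1 ≤ d) (hn : 2 ≤ n) {f : Marked d → ℝ≥0∞}
    (hf : Measurable f) : Measurable ((goodTuples d n).indicator fun p => f (originMark p)) :=
  (hf.comp (measurable_originMark hd hn)).indicator (measurableSet_goodTuples hd hn)

/-- For a fixed first point (v, h), translation invariance of the intensity removes v from the inner
integral, so integration over v only yields the volume of B. -/
theorem lintegral_recentre (hd : 1 ≤ d) (hn : 2 ≤ n) {B : Set (Vec d)} (hB : MeasurableSet B)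
    {f : Marked d → ℝ≥0∞} (hf : Measurable f) :
    ∫⁻ z, {z : Fin (n + 1) → Pt d | (z 0).1 ∈ B}.indicator (fun z =>
      (goodTuples d n).indicator (fun p => f (originMark p)) (recentre z)) z
        ∂(prodPow (intensity M d β γ) (n + 1)) =
      ENNReal.ofReal (γ * M.normConst d β) * volume B * (n.factorial * cellIntegral M β γ n f) := by
  set g := (goodTuples d n).indicator fun p => f (originMark p) with hg
  have hgm : Measurable g := measurable_cellIntegrand hd hn hf
  have hB' : MeasurableSet {z : Fin (n + 1) → Pt d | (z 0).1 ∈ B} :=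
    (by fun_prop : Measurable fun z : Fin (n + 1) → Pt d => (z 0).1) hB
  set J : ℝ → ℝ≥0∞ := fun h => ∫⁻ y, g (h, y) ∂(prodPow (intensity M d β γ) n) with hJ
  have hJm : Measurable J := hgm.lintegral_prod_right'
  have hgr : Measurable fun z : Fin (n + 1) → Pt d => g (recentre z) := hgm.comp measurable_recentre
  rw [lintegral_prodPow_succ _ _ (hgr.indicator hB')]
  have h1 : ∀ x : Pt d, ∫⁻ y, {z : Fin (n + 1) → Pt d | (z 0).1 ∈ B}.indicator
      (fun z => g (recentre z)) (Fin.cons x y) ∂(prodPow (intensity M d β γ) n) =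
      B.indicator 1 x.1 * J x.2 := by
    intro x
    have hsh : Measurable fun (y : Fin n → Pt d) i => shiftPt (-x.1) (y i) :=
      measurable_pi_lambda _ fun i => (measurable_shiftPt _).comp (measurable_pi_apply i)
    by_cases hx : x.1 ∈ B
    · have : ∀ y : Fin n → Pt d, {z : Fin (n + 1) → Pt d | (z 0).1 ∈ B}.indicator
          (fun z => g (recentre z)) (Fin.cons x y) = g (x.2, fun i => shiftPt (-x.1) (y i)) := by
        intro y
        rw [indicator_of_mem (by simpa using hx)]
        simp [recentre]
      simp only [this]
      rw [indicator_of_mem hx, Pi.one_apply, one_mul, hJ]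
      conv_rhs => rw [← (measurePreserving_shiftPt M β γ (-x.1)).map_eq,
        prodPow_map _ (measurable_shiftPt _)]
      exact (lintegral_map (hgm.comp measurable_prodMk_left) hsh).symm
    · rw [indicator_of_notMem hx, zero_mul]
      refine lintegral_eq_zero_of_ae_eq_zero (Filter.Eventually.of_forall fun y => ?_)
      exact indicator_of_notMem (by simpa using hx) _
  simp only [h1]
  have hBm : Measurable (B.indicator (1 : Vec d → ℝ≥0∞)) := measurable_one.indicator hB
  have hBJ : Measurable fun x : Pt d => B.indicator (1 : Vec d → ℝ≥0∞) x.1 * J x.2 :=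
    (hBm.comp measurable_fst).mul (hJm.comp measurable_snd)
  rw [lintegral_intensity M d β γ hBJ]
  have h2 : ∀ v : Vec d, ∫⁻ h, B.indicator (1 : Vec d → ℝ≥0∞) v * J h ∂(heightMeasure M β) =
      B.indicator 1 v * ∫⁻ h, J h ∂(heightMeasure M β) := fun v => lintegral_const_mul _ hJm
  simp only [h2]
  rw [lintegral_mul_const _ hBm, lintegral_indicator_one hB, cellIntegral,
    lintegral_const_mul _ hJm, ← mul_assoc (n.factorial : ℝ≥0∞), ENNReal.mul_inv_cancel, one_mul,
    mul_assoc]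
  · exact_mod_cast n.factorial_ne_zero
  · exact ENNReal.natCast_ne_top _

/-- The mean number of polytopal cells with `n` facets. -/
theorem lintegral_encard_cellsIn (hd : 1 ≤ d) (hn : 2 ≤ n) [IsProbabilityMeasure Pr]
    (hβ : M.Admissible d β) (hγ : 0 < γ) (hX : IsPoissonProcess X (intensity M d β γ) Pr)
    {B : Set (Vec d)} {D : Set (Marked d)} (hB : MeasurableSet B) (hDm : MeasurableSet D)
    (hD : ∀ p ∈ D, p.2 ∈ polytopes d n) :
    ∫⁻ ω, ((cellsIn (X ω) B D).encard : ℝ≥0∞) ∂Pr =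
      ENNReal.ofReal (γ * M.normConst d β) * volume B *
        cellIntegral M β γ n (D.indicator fun p => expNeg (phiContent M β γ p)) := by
  obtain ⟨X', hX', hfin, hcount, hae⟩ := hX.exists_regular
  have h0 : ∫⁻ ω, ((cellsIn (X ω) B D).encard : ℝ≥0∞) ∂Pr =
      ∫⁻ ω, ((cellsIn (X' ω) B D).encard : ℝ≥0∞) ∂Pr := by
    refine lintegral_congr_ae ?_
    filter_upwards [hae] with ω hω
    rw [hω]
  rw [h0]
  clear h0 hae hX
  set μ := intensity M d β γ with hμ
  set f : Marked d → ℝ≥0∞ := D.indicator fun p => expNeg (phiContent M β γ p) with hf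
  have hfm : Measurable f :=
    (measurable_expNeg.comp (measurable_phiContent M d β γ)).indicator hDm
  have hpmfin : ∀ ω k, pointMeasure (X' ω) (spanningSets μ k) ≠ ∞ := fun ω k => by
    rw [pointMeasure_apply _ (measurableSet_spanningSets μ k)]
    simpa using hfin ω k
  set Q : Set ((Fin (n + 1) → Pt d) × Measure (Pt d)) :=
    {q | q.1 ∈ cellEvent n B D ∧ regKernel μ q.2 (voidRegion q.1) = 0} with hQ
  have hQm : MeasurableSet Q := by
    have h1 : MeasurableSet {q : (Fin (n + 1) → Pt d) × Measure (Pt d) | q.1 ∈ cellEvent n B D} :=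
      measurable_fst (measurableSet_cellEvent hd hn hB hDm)
    exact h1.inter (measurableSet_void hd hn μ)
  have hmecke := hX'.mecke_pow hfin hcount (intensity_singleton M β γ) (n + 1)
    (f := Q.indicator 1) (measurable_one.indicator hQm)
  -- On generic realisations the sum over (n + 1)-tuples is n! times the number of cells.
  have hL : ∀ᵐ ω ∂Pr, ∫⁻ z, {z : Fin (n + 1) → Pt d | Function.Injective z}.indicator
      (fun z => Q.indicator (1 : (Fin (n + 1) → Pt d) × Measure (Pt d) → ℝ≥0∞) (z, pointMeasure (X' ω))) z
        ∂(prodPow (pointMeasure (X' ω)) (n + 1)) =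
      n.factorial * ((cellsIn (X' ω) B D).encard : ℝ≥0∞) := by
    filter_upwards [ae_genericConfig hd hβ hγ hX' hfin hcount] with ω hω
    refine hω.lintegral_cellEvent (hcount ω) hd hn hD
      (Q := (fun z => (z, pointMeasure (X' ω))) ⁻¹' Q) (measurable_prodMk_right hQm) fun z => ?_
    rw [mem_preimage, hQ, mem_ofPred_eq, regKernel_apply μ _ (hpmfin ω)]
  rw [lintegral_congr_ae hL, lintegral_const_mul' _ _ (ENNReal.natCast_ne_top _)] at hmecke
  -- For a fixed tuple the added points avoid the void region, so the inner integral is the void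
  -- probability e^{-Φ} whenever the tuple determines a polytope in D.
  have hR : ∀ z, ∫⁻ ω, Q.indicator (1 : (Fin (n + 1) → Pt d) × Measure (Pt d) → ℝ≥0∞) (z, pointMeasure (X' ω) + diracSum z) ∂Pr =
      {z : Fin (n + 1) → Pt d | (z 0).1 ∈ B}.indicator (fun z =>
        (goodTuples d n).indicator (fun p => f (originMark p)) (recentre z)) z := by
    intro z
    by_cases hz : z ∈ cellEvent n B D
    · obtain ⟨hzB, hzg, hzD⟩ := id hz
      rw [indicator_of_mem (show z ∈ {z : Fin (n + 1) → Pt d | (z 0).1 ∈ B} from hzB),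
        indicator_of_mem hzg, hf, indicator_of_mem hzD, phiContent_eq]
      have hvm := measurableSet_voidRegion hd hn z
      have hd0 : diracSum z (voidRegion z) = 0 := by
        rw [diracSum, Measure.finsetSum_apply]
        refine Finset.sum_eq_zero fun i _ => ?_
        rw [Measure.dirac_apply' _ hvm, indicator_of_notMem (notMem_voidRegion hzg i)]
      have hdfin : ∀ k, diracSum z (spanningSets μ k) ≠ ∞ := by
        intro k
        rw [diracSum, Measure.finsetSum_apply]
        exact (ENNReal.sum_lt_top.2 fun i _ => measure_lt_top _ _).ne
      have h1 : ∀ ω, Q.indicator (1 : (Fin (n + 1) → Pt d) × Measure (Pt d) → ℝ≥0∞) (z, pointMeasure (X' ω) + diracSum z) =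
          {ω | pointMeasure (X' ω) (voidRegion z) = 0}.indicator 1 ω := by
        intro ω
        have hk : regKernel μ (pointMeasure (X' ω) + diracSum z) = pointMeasure (X' ω) + diracSum z :=
          regKernel_apply μ _ fun k => by
            rw [Measure.add_apply]
            exact ENNReal.add_ne_top.2 ⟨hpmfin ω k, hdfin k⟩
        have hiff : (z, pointMeasure (X' ω) + diracSum z) ∈ Q ↔
            ω ∈ {ω | pointMeasure (X' ω) (voidRegion z) = 0} := by
          rw [hQ, mem_ofPred_eq, mem_ofPred_eq, hk, Measure.add_apply, hd0, add_zero]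
          exact and_iff_right hz
        by_cases h : ω ∈ {ω | pointMeasure (X' ω) (voidRegion z) = 0}
        · rw [indicator_of_mem h, indicator_of_mem (hiff.2 h)]; rfl
        · rw [indicator_of_notMem h, indicator_of_notMem (fun h' => h (hiff.1 h'))]
      simp only [h1]
      have hvz : MeasurableSet {ω | pointMeasure (X' ω) (voidRegion z) = 0} :=
        hX'.measurable_apply hvm (measurableSet_singleton 0)
      rw [lintegral_indicator_one hvz,
        hX'.measure_empty hvm]
      congr 1
      exact (measurePreserving_shiftPt M β γ _).measure_preimage
        (measurable_prodMk_left (measurableSet_openFlower d)).nullMeasurableSet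
    · have h1 : ∀ ω, Q.indicator (1 : (Fin (n + 1) → Pt d) × Measure (Pt d) → ℝ≥0∞) (z, pointMeasure (X' ω) + diracSum z) = 0 :=
        fun ω => indicator_of_notMem (fun h => hz h.1) _
      simp only [h1, lintegral_zero]
      symm
      by_cases hzB : (z 0).1 ∈ B
      · rw [indicator_of_mem (show z ∈ {z : Fin (n + 1) → Pt d | (z 0).1 ∈ B} from hzB)]
        by_cases hzg : recentre z ∈ goodTuples d n
        · rw [indicator_of_mem hzg, hf, indicator_of_notMem fun hzD => hz ⟨hzB, hzg, hzD⟩]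
        · rw [indicator_of_notMem hzg]
      · exact indicator_of_notMem (s := {z : Fin (n + 1) → Pt d | (z 0).1 ∈ B}) hzB _
  simp only [hR] at hmecke
  rw [lintegral_recentre hd hn hB hfm, mul_left_comm] at hmecke
  exact (ENNReal.mul_right_inj (by exact_mod_cast n.factorial_ne_zero)
    (ENNReal.natCast_ne_top _)).1 hmecke

end

/-! ### The measure `ν` and the law of the typical cell -/

section

variable {M : Model} {d n : ℕ} {β γ : ℝ}

theorem lintegral_polytopeMeasure (hd : 1 ≤ d) (hn : 2 ≤ n) (h : ℝ) {f : Marked d → ℝ≥0∞}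
    (hf : Measurable f) :
    ∫⁻ p, f p ∂((polytopeMeasure M β γ ((0 : Vec d), h) n).map fun P => (((0 : Vec d), h), P)) =
      (n.factorial : ℝ≥0∞)⁻¹ * ∫⁻ y, (goodTuples d n).indicator (fun p => f (originMark p)) (h, y)
        ∂(prodPow (intensity M d β γ) n) := by
  have hg : MeasurableSet (goodFamilies d n) := measurableSet_goodFamilies hd hn
  -- The restricted measure sees only good families, where `interBody` coincides with the measurable
  -- map `polyBody`.
  have hpb : ((prodPow (halfSpaceMeasure M β γ ((0 : Vec d), h)) n).restrict
      (goodFamilies d n)).map interBody = ((prodPow (halfSpaceMeasure M β γ ((0 : Vec d), h)) n).restrict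
        (goodFamilies d n)).map polyBody := by
    refine Measure.map_congr ?_
    filter_upwards [ae_restrict_mem hg] with H hH
    rw [polyBody, if_pos hH]
  have hm1 : Measurable fun P : ConvexBody (Vec d) => (((0 : Vec d), h), P) := measurable_prodMk_left
  have hm2 : Measurable fun (y : Fin n → Pt d) i => bound ((0 : Vec d), h) (y i) :=
    measurable_pi_lambda _ fun i => (measurable_bound _).comp (measurable_pi_apply i)
  have hm3 : Measurable fun H : Fin n → ExtHalfSpace d => f (((0 : Vec d), h), polyBody H) :=
    hf.comp (hm1.comp (measurable_polyBody hd hn))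
  rw [lintegral_map hf hm1, polytopeMeasure, lintegral_smul_measure, smul_eq_mul]
  change _ * ∫⁻ P, _ ∂(((prodPow (halfSpaceMeasure M β γ ((0 : Vec d), h)) n).restrict
    (goodFamilies d n)).map interBody) = _
  have hm4 : Measurable fun P : ConvexBody (Vec d) => f (((0 : Vec d), h), P) := hf.comp hm1
  rw [hpb, lintegral_map hm4 (measurable_polyBody hd hn), halfSpaceMeasure,
    prodPow_map _ (measurable_bound _)]
  congr 1
  refine (setLIntegral_map hg hm3 hm2).trans ?_
  rw [← lintegral_indicator (hm2 hg)]
  rfl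

/-- Needed for the integration rule of `Measure.bind` in the definition of ν. -/
theorem measurable_polytopeMeasure (hd : 1 ≤ d) (hn : 2 ≤ n) : Measurable fun h : ℝ =>
    (polytopeMeasure M β γ ((0 : Vec d), h) n).map fun P => (((0 : Vec d), h), P) := by
  refine Measure.measurable_of_measurable_coe _ fun s hs => ?_
  have e : ∀ h : ℝ, (polytopeMeasure M β γ ((0 : Vec d), h) n).map
      (fun P => (((0 : Vec d), h), P)) s = (n.factorial : ℝ≥0∞)⁻¹ *
        ∫⁻ y, (goodTuples d n).indicator (fun p => s.indicator 1 (originMark p)) (h, y)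
        ∂(prodPow (intensity M d β γ) n) := fun h => by
    rw [← lintegral_polytopeMeasure hd hn h (measurable_one.indicator hs), lintegral_indicator_one hs]
  simp only [e]
  exact (measurable_cellIntegrand hd hn (measurable_one.indicator hs)).lintegral_prod_right'.const_mul _

theorem lintegral_nu (hd : 1 ≤ d) (hn : 2 ≤ n) (Λ : ℝ≥0∞) {f : Marked d → ℝ≥0∞}
    (hf : Measurable f) :
    ∫⁻ p, f p ∂(nu M d β γ n Λ) = ENNReal.ofReal (γ * M.normConst d β) / Λ *
      cellIntegral M β γ n ((markedPolytopes M d n).indicator f) := by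
  have hm := measurableSet_markedPolytopes M d hn
  rw [nu, lintegral_smul_measure, smul_eq_mul, ← lintegral_indicator hm,
    Measure.lintegral_bind (measurable_polytopeMeasure hd hn).aemeasurable
      (hf.indicator hm).aemeasurable]
  simp only [lintegral_polytopeMeasure hd hn _ (hf.indicator hm)]
  rfl

theorem ae_heightMeasure (M : Model) (β : ℝ) : ∀ᵐ h ∂(heightMeasure M β), 0 < M.kappa * h := by
  rw [ae_iff]
  exact heightMeasure_nonpos M β

theorem cellIntegral_congr {f g : Marked d → ℝ≥0∞}
    (h : ∀ h : ℝ, 0 < M.kappa * h → ∀ P ∈ polytopes d n,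
      f (((0 : Vec d), h), P) = g (((0 : Vec d), h), P)) :
    cellIntegral M β γ n f = cellIntegral M β γ n g := by
  refine lintegral_congr_ae ?_
  filter_upwards [ae_heightMeasure M β] with t ht
  congr 1
  refine lintegral_congr fun y => ?_
  by_cases hy : (t, y) ∈ goodTuples d n
  · rw [indicator_of_mem hy, indicator_of_mem hy]
    exact h t ht _ (polyBody_mem hy)
  · rw [indicator_of_notMem hy, indicator_of_notMem hy]

theorem mem_markedPolytopes_beta {h : ℝ} {P : ConvexBody (Vec d)} (hh : 0 < h)
    (hP : P ∈ polytopes d n) : (((0 : Vec d), h), P) ∈ markedPolytopes .beta d n :=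
  ⟨rfl, hh.le, hP⟩

/-- Polytopes that are not in the space of marked polytopes have infinite `Φ`-content. -/
theorem phiContent_eq_top_or_mem (hβ : M.Admissible d β) (hγ : 0 < γ) {h : ℝ}
    (hh : 0 < M.kappa * h) {P : ConvexBody (Vec d)} (hP : P ∈ polytopes d n) :
    (((0 : Vec d), h), P) ∈ markedPolytopes M d n ∨
      phiContent M β γ (((0 : Vec d), h), P) = ∞ := by
  cases M with
  | beta => exact Or.inl (mem_markedPolytopes_beta (by simpa [Model.kappa] using hh) hP)
  | betaPrime =>
    have hneg : h < 0 := by simpa [Model.kappa] using hh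
    by_cases hs : (P : Set (Vec d)) ⊆ Metric.ball 0 (Real.sqrt (-h))
    · exact Or.inl ⟨rfl, hneg, hP, hs⟩
    · right
      -- The paraboloid with spatial apex w passing through (0, h) has apex height ‖w‖² + h ≥ 0; the
      -- region below it has infinite measure and lies in the flower.
      obtain ⟨w, hw, hwn⟩ := not_subset.1 hs
      rw [mem_ball_zero_iff, not_lt, Real.sqrt_le_left (norm_nonneg w)] at hwn
      rw [phiContent_eq, ← top_le_iff,
        ← intensity_paraboloid_eq_top hβ hγ w (a := ‖w‖ ^ 2 + h) (by linarith)]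
      refine measure_mono fun y hy => ⟨w, hw, ?_⟩
      have hy' : ‖w - y.1‖ ^ 2 + y.2 < ‖w‖ ^ 2 + h := hy
      simpa using hy'

theorem volume_unitCube (d : ℕ) : volume {v : Vec d | ∀ i, v i ∈ Icc (0 : ℝ) 1} = 1 := by
  have e : {v : Vec d | ∀ i, v i ∈ Icc (0 : ℝ) 1} =
      (MeasurableEquiv.toLp 2 (Fin d → ℝ)).symm ⁻¹' (Set.univ.pi fun _ => Icc (0 : ℝ) 1) := by
    ext v
    simp only [mem_ofPred_eq, mem_preimage, mem_univ_pi]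
    rfl
  rw [e, (EuclideanSpace.volume_preserving_symm_measurableEquiv_toLp (Fin d)).measure_preimage
    (MeasurableSet.univ_pi fun _ => measurableSet_Icc).nullMeasurableSet, volume_pi_pi]
  simp

theorem measurableSet_unitCube (d : ℕ) : MeasurableSet {v : Vec d | ∀ i, v i ∈ Icc (0 : ℝ) 1} := by
  have e : {v : Vec d | ∀ i, v i ∈ Icc (0 : ℝ) 1} =
      ⋂ i, (fun v : Vec d => v i) ⁻¹' Icc (0 : ℝ) 1 := by
    ext; simp
  rw [e]
  exact MeasurableSet.iInter fun i => (by fun_prop : Measurable fun v : Vec d => v i) measurableSet_Icc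

theorem isBounded_unitCube (d : ℕ) :
    Bornology.IsBounded {v : Vec d | ∀ i, v i ∈ Icc (0 : ℝ) 1} := by
  rw [isBounded_iff_forall_norm_le]
  refine ⟨Real.sqrt d, fun v hv => ?_⟩
  rw [EuclideanSpace.norm_eq]
  refine Real.sqrt_le_sqrt ?_
  calc ∑ i, ‖v i‖ ^ 2 ≤ ∑ _i : Fin d, (1 : ℝ) := by
        refine Finset.sum_le_sum fun i _ => ?_
        obtain ⟨h0, h1⟩ := hv i
        rw [Real.norm_eq_abs, abs_of_nonneg h0]
        exact pow_le_one₀ h0 h1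
    _ = d := by simp

/-! ### Law of the typical cell -/

variable {Ω Ω' : Type*} [MeasurableSpace Ω] [MeasurableSpace Ω'] {Pr : Measure Ω} {Pr' : Measure Ω'}
  {X : Ω → Set (Pt d)} {C : Ω' → Marked d}

theorem IsTypicalCell.law_unitCube (hC : IsTypicalCell X Pr C Pr') {D : Set (Marked d)}
    (hD : MeasurableSet D) (hDc : D ⊆ centered d) :
    Pr' (C ⁻¹' D) = (∫⁻ ω, ((cellsIn (X ω) {v : Vec d | ∀ i, v i ∈ Icc (0 : ℝ) 1} D).encard : ℝ≥0∞)
      ∂Pr) / vertexDensity X Pr :=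
  hC.law _ (isBounded_unitCube d) (measurableSet_unitCube d) (by rw [volume_unitCube]; exact one_ne_zero)
    D hD hDc

theorem measurableSet_mem_polytopes (hn : 2 ≤ n) :
    MeasurableSet {p : Marked d | p.2 ∈ polytopes d n} :=
  measurable_snd (measurableSet_polytopes hn)

/-- The law of the typical cell on polytopes with `n` facets has density `e^{-Φ}` with respect to the
measure `ν`. -/
theorem IsTypicalCell.measure_eq_lintegral_nu [IsProbabilityMeasure Pr] (hd : 1 ≤ d) (hn : 2 ≤ n)
    (hβ : M.Admissible d β) (hγ : 0 < γ) (hX : IsPoissonProcess X (intensity M d β γ) Pr)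
    (hC : IsTypicalCell X Pr C Pr') {T : Set (Marked d)} (hT : MeasurableSet T) :
    Pr' {ω | (C ω).2 ∈ polytopes d n ∧ C ω ∈ T} =
      ∫⁻ p in T, expNeg (phiContent M β γ p) ∂(nu M d β γ n (vertexDensity X Pr)) := by
  set D : Set (Marked d) := centered d ∩ ({p | p.2 ∈ polytopes d n} ∩ T) with hD
  have hpm := measurableSet_mem_polytopes (d := d) hn
  have hDm : MeasurableSet D := (measurableSet_centered d).inter (hpm.inter hT)
  have hem : Measurable fun p : Marked d => expNeg (phiContent M β γ p) :=
    measurable_expNeg.comp (measurable_phiContent M d β γ)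
  have e : {ω | (C ω).2 ∈ polytopes d n ∧ C ω ∈ T} = C ⁻¹' D := by
    ext ω
    exact ⟨fun h => ⟨hC.mem_centered ω, h⟩, fun h => h.2⟩
  rw [e, hC.law_unitCube hDm inter_subset_left, lintegral_encard_cellsIn hd hn hβ hγ hX
    (measurableSet_unitCube d) hDm (fun p hp => hp.2.1), volume_unitCube, mul_one,
    ← lintegral_indicator hT, lintegral_nu hd hn _ (hem.indicator hT), ENNReal.mul_div_right_comm]
  congr 1
  -- The integrands differ only in the restriction of ν to the marked polytopes; outside these Φ = ∞
  -- and both vanish.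
  refine cellIntegral_congr fun h hh P hP => ?_
  classical
  simp only [indicator_apply]
  rcases phiContent_eq_top_or_mem (n := n) hβ hγ hh hP with hmem | htop
  · have : ((((0 : Vec d), h), P) ∈ D) ↔ (((0 : Vec d), h), P) ∈ T :=
      ⟨fun h => h.2.2, fun h => ⟨rfl, hP, h⟩⟩
    rw [if_pos hmem]
    simp only [this]
  · rw [htop, expNeg_top]
    simp

theorem nu_compl_markedPolytopes (hn : 2 ≤ n) (Λ : ℝ≥0∞) :
    nu M d β γ n Λ (markedPolytopes M d n)ᶜ = 0 := by
  have hm := measurableSet_markedPolytopes M d hn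
  rw [nu, Measure.smul_apply, Measure.restrict_apply hm.compl, compl_inter_self, measure_empty,
    smul_zero]

theorem nu_restrict_markedPolytopes (hn : 2 ≤ n) (Λ : ℝ≥0∞) :
    (nu M d β γ n Λ).restrict (markedPolytopes M d n) = nu M d β γ n Λ :=
  Measure.restrict_eq_self_of_ae_mem (by rw [ae_iff]; exact nu_compl_markedPolytopes hn Λ)

theorem ae_nu_height (hd : 1 ≤ d) (hn : 2 ≤ n) (Λ : ℝ≥0∞) :
    ∀ᵐ p ∂(nu M d β γ n Λ), 0 < M.kappa * p.1.2 := by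
  have hm : MeasurableSet {p : Marked d | ¬ 0 < M.kappa * p.1.2} :=
    (measurableSet_lt measurable_const
      (by fun_prop : Measurable fun p : Marked d => M.kappa * p.1.2)).compl
  rw [ae_iff, ← lintegral_indicator_one hm, lintegral_nu hd hn _ (measurable_one.indicator hm),
    cellIntegral_congr (g := fun _ => 0)]
  · simp [cellIntegral]
  · intro h hh P hP
    classical
    simp [indicator_apply, hh]

end

section

open scoped Pointwise

/-! ### Scaling -/

/-- The dilation of a half-space. -/
noncomputable def HalfSpace.dilate {d : ℕ} (r : ℝ) (H : HalfSpace d) : HalfSpace d := (H.1, r * H.2)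

/-- The dilation of a proper or improper half-space. -/
noncomputable def ExtHalfSpace.dilate {d : ℕ} (r : ℝ) : ExtHalfSpace d → ExtHalfSpace d
  | .inl H => .inl (HalfSpace.dilate r H)
  | .inr b => .inr b

/-- The parabolic dilation of a marked body. -/
noncomputable def Marked.dilate {d : ℕ} (r : ℝ) (p : Marked d) : Marked d := (scalePt r p.1, r • p.2)

section

variable {M : Model} {d n : ℕ} {β γ : ℝ} {r : ℝ}

/-- The quantity h + ‖v‖² has degree 2 under parabolic scaling, while v' - v has degree 1, so
offsets have degree 1. -/
theorem bound_scalePt (hr : 0 < r) (x y : Pt d) :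
    bound (scalePt r x) (scalePt r y) = (bound x y).dilate r := by
  have e0 : r • y.1 - r • x.1 = r • (y.1 - x.1) := (smul_sub _ _ _).symm
  have e1 : r ^ 2 * y.2 + ‖r • y.1‖ ^ 2 - r ^ 2 * x.2 - ‖r • x.1‖ ^ 2 =
      r ^ 2 * (y.2 + ‖y.1‖ ^ 2 - x.2 - ‖x.1‖ ^ 2) := by
    rw [norm_smul, norm_smul, Real.norm_eq_abs, abs_of_pos hr]; ring
  by_cases h : y.1 - x.1 = 0
  · have hxy : y.1 = x.1 := sub_eq_zero.1 h
    have h2 : 0 < r ^ 2 := by positivity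
    have e2 : ∀ a : ℝ, 0 ≤ r ^ 2 * a ↔ 0 ≤ a := fun a => mul_nonneg_iff_of_pos_left h2
    simp only [bound, scalePt, e0, e1, h, smul_zero, dite_true, ExtHalfSpace.dilate, e2]
  · have h' : r • (y.1 - x.1) ≠ 0 := smul_ne_zero hr.ne' h
    have hn : ‖y.1 - x.1‖ ≠ 0 := norm_ne_zero_iff.2 h
    simp only [bound, scalePt, e0, e1, h, h', dite_false, ExtHalfSpace.dilate, HalfSpace.dilate,
      Sum.inl.injEq, Prod.mk.injEq]
    constructor
    · refine Subtype.ext ?_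
      change ‖r • (y.1 - x.1)‖⁻¹ • r • (y.1 - x.1) = ‖y.1 - x.1‖⁻¹ • (y.1 - x.1)
      rw [norm_smul, Real.norm_eq_abs, abs_of_pos hr, smul_smul]
      congr 1
      field_simp
    · rw [norm_smul, Real.norm_eq_abs, abs_of_pos hr]
      field_simp

theorem mem_toSet_dilate (hr : 0 < r) (H : ExtHalfSpace d) (w : Vec d) :
    r • w ∈ (H.dilate r).toSet ↔ w ∈ H.toSet := by
  rcases H with ⟨u, t⟩ | b
  · change inner ℝ (r • w) (u : Vec d) ≤ r * t ↔ inner ℝ w (u : Vec d) ≤ t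
    rw [real_inner_smul_left]
    exact mul_le_mul_iff_right₀ hr
  · cases b <;> exact Iff.rfl

theorem iInter_toSet_dilate (hr : 0 < r) (H : Fin n → ExtHalfSpace d) :
    ⋂ i, ((H i).dilate r).toSet = r • ⋂ i, (H i).toSet := by
  ext w
  rw [mem_smul_set_iff_inv_smul_mem₀ hr.ne', mem_iInter, mem_iInter]
  refine forall_congr' fun i => ?_
  rw [← mem_toSet_dilate hr (H i) (r⁻¹ • w), smul_inv_smul₀ hr.ne']

theorem dilate_mem_facetFamilies (hr : 0 < r) {H : Fin n → HalfSpace d} (hH : H ∈ facetFamilies d n) :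
    (fun i => (H i).dilate r) ∈ facetFamilies d n := by
  have hlt : ∀ i w, inner ℝ (r • w) (((H i).dilate r).1 : Vec d) < ((H i).dilate r).2 ↔
      inner ℝ w ((H i).1 : Vec d) < (H i).2 := fun i w => by
    change inner ℝ (r • w) ((H i).1 : Vec d) < r * (H i).2 ↔ _
    rw [real_inner_smul_left]
    exact mul_lt_mul_iff_right₀ hr
  have hgt : ∀ i w, ((H i).dilate r).2 < inner ℝ (r • w) (((H i).dilate r).1 : Vec d) ↔
      (H i).2 < inner ℝ w ((H i).1 : Vec d) := fun i w => by
    change r * (H i).2 < inner ℝ (r • w) ((H i).1 : Vec d) ↔ _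
    rw [real_inner_smul_left]
    exact mul_lt_mul_iff_right₀ hr
  obtain ⟨h1, ⟨w, hw⟩, h3⟩ := hH
  refine ⟨?_, ⟨r • w, fun i => (hlt i w).2 (hw i)⟩, fun i => ?_⟩
  · have e : polyInter (fun i => (H i).dilate r) = r • polyInter H :=
      iInter_toSet_dilate hr fun i => Sum.inl (H i)
    rw [e]
    exact h1.smul₀ r
  · obtain ⟨w, hw1, hw2⟩ := h3 i
    exact ⟨r • w, fun j hj => (hlt j w).2 (hw1 j hj), (hgt i w).2 hw2⟩

theorem smul_mem_polytopes (hn : 2 ≤ n) (hr : 0 < r) {K : ConvexBody (Vec d)}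
    (hK : K ∈ polytopes d n) : r • K ∈ polytopes d n := by
  obtain ⟨H, hH⟩ := hK.1
  refine mem_polytopes_of_facetFamilies
    (dilate_mem_facetFamilies hr (facetFamilies_of_polytopes hn hK hH)) ?_
  rw [ConvexBody.coe_smul, hH]
  exact (iInter_toSet_dilate hr fun i => Sum.inl (H i)).symm

theorem smul_mem_polytopes_iff (hn : 2 ≤ n) (hr : 0 < r) {K : ConvexBody (Vec d)} :
    r • K ∈ polytopes d n ↔ K ∈ polytopes d n := by
  refine ⟨fun h => ?_, smul_mem_polytopes hn hr⟩
  have := smul_mem_polytopes hn (inv_pos.2 hr) h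
  rwa [inv_smul_smul₀ hr.ne'] at this

theorem ExtHalfSpace.dilate_inv (hr : 0 < r) (H : ExtHalfSpace d) :
    (H.dilate r).dilate r⁻¹ = H := by
  rcases H with ⟨u, t⟩ | b
  · simp [ExtHalfSpace.dilate, HalfSpace.dilate, inv_mul_cancel_left₀ hr.ne']
  · rfl

theorem dilate_mem_goodFamilies (hn : 2 ≤ n) (hr : 0 < r) {H : Fin n → ExtHalfSpace d}
    (hH : H ∈ goodFamilies d n) : (fun i => (H i).dilate r) ∈ goodFamilies d n := by
  obtain ⟨K, hK, hKH⟩ := hH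
  exact ⟨r • K, smul_mem_polytopes hn hr hK, by
    rw [ConvexBody.coe_smul, hKH, iInter_toSet_dilate hr]⟩

theorem dilate_mem_goodFamilies_iff (hn : 2 ≤ n) (hr : 0 < r) {H : Fin n → ExtHalfSpace d} :
    (fun i => (H i).dilate r) ∈ goodFamilies d n ↔ H ∈ goodFamilies d n := by
  refine ⟨fun h => ?_, dilate_mem_goodFamilies hn hr⟩
  have := dilate_mem_goodFamilies hn (inv_pos.2 hr) h
  simpa only [ExtHalfSpace.dilate_inv hr] using this

theorem bound_tuple_scale (hr : 0 < r) (h : ℝ) (y : Fin n → Pt d) :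
    (fun i => bound ((0 : Vec d), r ^ 2 * h) (scalePt r (y i))) =
      fun i => (bound ((0 : Vec d), h) (y i)).dilate r := by
  funext i
  rw [← bound_scalePt hr]
  simp [scalePt]

theorem scale_mem_goodTuples (hn : 2 ≤ n) (hr : 0 < r) (h : ℝ) (y : Fin n → Pt d) :
    (r ^ 2 * h, fun i => scalePt r (y i)) ∈ goodTuples d n ↔ (h, y) ∈ goodTuples d n := by
  change (fun i => bound ((0 : Vec d), r ^ 2 * h) (scalePt r (y i))) ∈ goodFamilies d n ↔ _
  rw [bound_tuple_scale hr]
  exact dilate_mem_goodFamilies_iff hn hr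

theorem originMark_scale (hn : 2 ≤ n) (hr : 0 < r) {h : ℝ} {y : Fin n → Pt d}
    (hy : (h, y) ∈ goodTuples d n) :
    originMark (r ^ 2 * h, fun i => scalePt r (y i)) = (originMark (h, y)).dilate r := by
  have h1 : (((0 : Vec d), r ^ 2 * h) : Pt d) = scalePt r ((0 : Vec d), h) := by simp [scalePt]
  refine Prod.ext h1 (SetLike.coe_injective ?_)
  change (polyBody (fun i => bound ((0 : Vec d), r ^ 2 * h) (scalePt r (y i))) : Set (Vec d)) =
    ((r • polyBody fun i => bound ((0 : Vec d), h) (y i) : ConvexBody (Vec d)) : Set (Vec d))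
  rw [bound_tuple_scale hr, coe_polyBody (dilate_mem_goodFamilies hn hr hy), ConvexBody.coe_smul,
    coe_polyBody hy, iInter_toSet_dilate hr]

theorem openFlower_dilate (hr : 0 < r) (p : Marked d) :
    scalePt r ⁻¹' openFlower (p.dilate r) = openFlower p := by
  ext y
  have key : ∀ w : Vec d, (‖r • w - (scalePt r y).1‖ ^ 2 + (scalePt r y).2 <
      ‖r • w - (p.dilate r).1.1‖ ^ 2 + (p.dilate r).1.2) ↔
      ‖w - y.1‖ ^ 2 + y.2 < ‖w - p.1.1‖ ^ 2 + p.1.2 := by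
    intro w
    have h2 : 0 < r ^ 2 := by positivity
    simp only [scalePt, Marked.dilate, ← smul_sub, norm_smul, Real.norm_eq_abs, mul_pow, sq_abs,
      ← mul_add]
    exact mul_lt_mul_iff_right₀ h2
  constructor
  · rintro ⟨z, ⟨w, hw, rfl⟩, hz⟩
    exact ⟨w, hw, (key w).1 hz⟩
  · rintro ⟨w, hw, h⟩
    exact ⟨r • w, ⟨w, hw, rfl⟩, (key w).2 h⟩

theorem measurableSet_openFlower_apply (p : Marked d) : MeasurableSet (openFlower p) :=
  measurable_prodMk_left (measurableSet_openFlower d)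

/-- The flower of the dilated body is the dilate of the flower, since both power distances are
multiplied by r². -/
theorem phiContent_dilate (hr : 0 < r) (p : Marked d) :
    phiContent M β γ (p.dilate r) = ENNReal.ofReal (r ^ scaleExp M d β) * phiContent M β γ p := by
  have h := Measure.map_apply (μ := intensity M d β γ) (measurable_scalePt r)
    (measurableSet_openFlower_apply (p.dilate r))
  rw [intensity_map_scalePt M d β γ hr, openFlower_dilate hr, Measure.smul_apply, smul_eq_mul] at h
  rw [phiContent_eq, phiContent_eq, ← h, ← mul_assoc, ← ENNReal.ofReal_mul (by positivity),
    ← Real.rpow_add hr, add_neg_cancel, Real.rpow_zero, ENNReal.ofReal_one, one_mul]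

theorem shape_dilate (hr : 0 < r) (p : Marked d) : shape M (p.dilate r) = shape M p := by
  have e : M.kappa * (r ^ 2 * p.1.2) = r ^ 2 * (M.kappa * p.1.2) := by ring
  simp only [shape, Marked.dilate, scalePt, e]
  rw [Real.sqrt_mul (by positivity), Real.sqrt_sq hr.le, mul_inv, smul_smul, mul_comm r⁻¹,
    mul_assoc, inv_mul_cancel₀ hr.ne', mul_one]

theorem dilate_mem_markedPolytopes (hn : 2 ≤ n) (hr : 0 < r) (p : Marked d) :
    p.dilate r ∈ markedPolytopes M d n ↔ p ∈ markedPolytopes M d n := by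
  have h2 : 0 < r ^ 2 := by positivity
  have h1 : r • p.1.1 = 0 ↔ p.1.1 = 0 := by simp [hr.ne']
  cases M with
  | beta =>
    change (r • p.1.1 = 0 ∧ 0 ≤ r ^ 2 * p.1.2 ∧ r • p.2 ∈ polytopes d n) ↔
      (p.1.1 = 0 ∧ 0 ≤ p.1.2 ∧ p.2 ∈ polytopes d n)
    rw [h1, smul_mem_polytopes_iff hn hr, mul_nonneg_iff_of_pos_left h2]
  | betaPrime =>
    change (r • p.1.1 = 0 ∧ r ^ 2 * p.1.2 < 0 ∧ r • p.2 ∈ polytopes d n ∧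
        ((r • p.2 : ConvexBody (Vec d)) : Set (Vec d)) ⊆ Metric.ball 0 (Real.sqrt (-(r ^ 2 * p.1.2)))) ↔
      (p.1.1 = 0 ∧ p.1.2 < 0 ∧ p.2 ∈ polytopes d n ∧
        (p.2 : Set (Vec d)) ⊆ Metric.ball 0 (Real.sqrt (-p.1.2)))
    have h3 : r ^ 2 * p.1.2 < 0 ↔ p.1.2 < 0 := by
      constructor
      · intro h; by_contra hc; push Not at hc; nlinarith
      · intro h; nlinarith
    have h4 : Metric.ball (0 : Vec d) (Real.sqrt (-(r ^ 2 * p.1.2))) =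
        r • Metric.ball 0 (Real.sqrt (-p.1.2)) := by
      rw [smul_ball hr.ne', smul_zero, Real.norm_eq_abs, abs_of_pos hr, ← mul_neg,
        Real.sqrt_mul h2.le, Real.sqrt_sq hr.le]
    rw [h1, h3, smul_mem_polytopes_iff hn hr, ConvexBody.coe_smul, h4, smul_set_subset_smul_set_iff₀ hr.ne']

/-! ### Homogeneity of ν -/

theorem prodPow_smul {α : Type*} [MeasurableSpace α] (m : Measure α) [SFinite m] (c : ℝ≥0∞) :
    ∀ n, prodPow (c • m) n = c ^ n • prodPow m n
  | 0 => by rw [prodPow, prodPow, pow_zero, one_smul]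
  | n + 1 => by
    rw [prodPow, prodPow, prodPow_smul m c n, Measure.prod_smul_left, Measure.prod_smul_right,
      Measure.map_smul, Measure.map_smul, smul_smul, pow_succ']

theorem scaleExp_mul_gammaShape (hd : 1 ≤ d) (hβ : M.Admissible d β) :
    scaleExp M d β * gammaShape M d β n = scaleExp M d β * n + (2 * M.kappa * β + 2) := by
  have h := scaleExp_ne_zero hβ hd
  have e : gammaShape M d β n = n + (2 * M.kappa * β + 2) / scaleExp M d β := rfl
  rw [e, mul_add, mul_div_cancel₀ _ h]

/-- Change of variables in all n + 1 arguments: each point contributes r^{-δ} with δ = `scaleExp M d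
β`, and the height contributes r^{-(2κβ+2)}. The sum of the exponents is -δq, which is where q comes
from. -/
theorem cellIntegral_dilate (hd : 1 ≤ d) (hn : 2 ≤ n) (hβ : M.Admissible d β) (hr : 0 < r)
    {f : Marked d → ℝ≥0∞} (hf : Measurable f) :
    cellIntegral M β γ n (fun p => f (p.dilate r)) =
      ENNReal.ofReal (r ^ (-(scaleExp M d β * gammaShape M d β n))) * cellIntegral M β γ n f := by
  set G := (goodTuples d n).indicator fun p => f (originMark p) with hG
  have hGm : Measurable G := measurable_cellIntegrand hd hn hf
  set J : ℝ → ℝ≥0∞ := fun h => ∫⁻ y, G (h, y) ∂(prodPow (intensity M d β γ) n) with hJ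
  have hJm : Measurable J := hGm.lintegral_prod_right'
  have hsc : Measurable fun (y : Fin n → Pt d) i => scalePt r (y i) :=
    measurable_pi_lambda _ fun i => (measurable_scalePt _).comp (measurable_pi_apply i)
  have h1 : ∀ h : ℝ, ∫⁻ y, (goodTuples d n).indicator
      (fun p => f ((originMark p).dilate r)) (h, y) ∂(prodPow (intensity M d β γ) n) =
      ENNReal.ofReal (r ^ (-scaleExp M d β)) ^ n * J (r ^ 2 * h) := by
    intro h
    have e : ∀ y : Fin n → Pt d, (goodTuples d n).indicator
        (fun p => f ((originMark p).dilate r)) (h, y) = G (r ^ 2 * h, fun i => scalePt r (y i)) := by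
      intro y
      by_cases hy : (h, y) ∈ goodTuples d n
      · rw [indicator_of_mem hy, hG, indicator_of_mem ((scale_mem_goodTuples hn hr h y).2 hy),
          originMark_scale hn hr hy]
      · rw [indicator_of_notMem hy, hG,
          indicator_of_notMem fun h' => hy ((scale_mem_goodTuples hn hr h y).1 h')]
    simp only [e]
    have hGy : Measurable fun y : Fin n → Pt d => G (r ^ 2 * h, y) := hGm.comp measurable_prodMk_left
    rw [← lintegral_map hGy hsc, ← prodPow_map _ (measurable_scalePt r),
      intensity_map_scalePt M d β γ hr, prodPow_smul, lintegral_smul_measure, smul_eq_mul]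
  have hJr : Measurable fun h : ℝ => J (r ^ 2 * h) := hJm.comp (by fun_prop)
  have h2 : ∫⁻ h, J (r ^ 2 * h) ∂(heightMeasure M β) =
      ENNReal.ofReal ((r ^ 2) ^ (-(M.kappa * β + 1))) * ∫⁻ h, J h ∂(heightMeasure M β) := by
    rw [← smul_eq_mul, ← lintegral_smul_measure, ← heightMeasure_map M β (by positivity : 0 < r ^ 2),
      lintegral_map hJm (by fun_prop)]
  have hc : ENNReal.ofReal (r ^ (-(scaleExp M d β * gammaShape M d β n))) =
      ENNReal.ofReal (r ^ (-scaleExp M d β)) ^ n * ENNReal.ofReal ((r ^ 2) ^ (-(M.kappa * β + 1))) := by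
    rw [← ENNReal.ofReal_pow (by positivity), ← ENNReal.ofReal_mul (by positivity),
      ← Real.rpow_natCast (r ^ (-scaleExp M d β)) n, ← Real.rpow_mul hr.le,
      ← Real.rpow_natCast r 2, ← Real.rpow_mul hr.le, ← Real.rpow_add hr,
      scaleExp_mul_gammaShape hd hβ]
    congr 2
    push_cast
    ring
  have h3 : cellIntegral M β γ n f = (n.factorial : ℝ≥0∞)⁻¹ * ∫⁻ h, J h ∂(heightMeasure M β) := by
    rw [cellIntegral, lintegral_const_mul _ hJm]
  rw [cellIntegral]
  simp only [h1]
  rw [lintegral_const_mul _ (hJr.const_mul _), lintegral_const_mul _ hJr, h2, h3, hc]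
  ring

/-- The scaling property of the measure `ν`. -/
theorem nu_scaling (hd : 1 ≤ d) (hn : 2 ≤ n) (hβ : M.Admissible d β) (Λ : ℝ≥0∞)
    {S : Set (ConvexBody (Vec d))} (hS : MeasurableSet S) {t : ℝ} (ht : 0 < t) :
    nu M d β γ n Λ {p | phiContent M β γ p < ENNReal.ofReal t ∧ shape M p ∈ S} =
      ENNReal.ofReal (t ^ gammaShape M d β n) *
        nu M d β γ n Λ {p | phiContent M β γ p < 1 ∧ shape M p ∈ S} := by
  have hδ := scaleExp_ne_zero hβ hd
  -- The dilation that multiplies Φ by t; the exponent is nonzero, though negative in the β'-model.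
  set r := t ^ (scaleExp M d β)⁻¹ with hrdef
  have hr : 0 < r := Real.rpow_pos_of_pos ht _
  have hrt : r ^ scaleExp M d β = t := by
    rw [hrdef, ← Real.rpow_mul ht.le, inv_mul_cancel₀ hδ, Real.rpow_one]
  have hms : ∀ a : ℝ≥0∞, MeasurableSet {p : Marked d | phiContent M β γ p < a ∧ shape M p ∈ S} := by
    intro a
    have h1 : MeasurableSet {p : Marked d | phiContent M β γ p < a} :=
      measurable_phiContent M d β γ measurableSet_Iio
    have h2 : MeasurableSet {p : Marked d | shape M p ∈ S} := measurable_shape M d hS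
    exact h1.inter h2
  have hnu : ∀ a : ℝ≥0∞, nu M d β γ n Λ {p | phiContent M β γ p < a ∧ shape M p ∈ S} =
      ENNReal.ofReal (γ * M.normConst d β) / Λ * cellIntegral M β γ n
        ((markedPolytopes M d n).indicator
          ({p | phiContent M β γ p < a ∧ shape M p ∈ S}.indicator 1)) := by
    intro a
    rw [← lintegral_indicator_one (hms a), lintegral_nu hd hn _ (measurable_one.indicator (hms a))]
  have hcell := cellIntegral_dilate (γ := γ) hd hn hβ hr
    ((measurable_one.indicator (hms (ENNReal.ofReal t))).indicator
      (measurableSet_markedPolytopes M d hn))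
  have hfun : (fun p : Marked d => (markedPolytopes M d n).indicator
      ({p | phiContent M β γ p < ENNReal.ofReal t ∧ shape M p ∈ S}.indicator
        (1 : Marked d → ℝ≥0∞)) (p.dilate r)) = (markedPolytopes M d n).indicator
          ({p | phiContent M β γ p < 1 ∧ shape M p ∈ S}.indicator 1) := by
    classical
    funext p
    have hphi : phiContent M β γ (p.dilate r) < ENNReal.ofReal t ↔ phiContent M β γ p < 1 := by
      rw [phiContent_dilate hr, hrt]
      have h0 : ENNReal.ofReal t ≠ 0 := by simpa using ht
      conv_lhs => rhs; rw [← mul_one (ENNReal.ofReal t)]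
      exact ENNReal.mul_lt_mul_iff_right h0 ENNReal.ofReal_ne_top
    simp only [indicator_apply, mem_ofPred_eq, dilate_mem_markedPolytopes hn hr, hphi,
      shape_dilate hr, Pi.one_apply]
  rw [hfun, Real.rpow_neg hr.le, Real.rpow_mul hr.le, hrt] at hcell
  rw [hnu, hnu, hcell, mul_left_comm, ← mul_assoc (ENNReal.ofReal (t ^ _)),
    ← ENNReal.ofReal_mul (by positivity), mul_inv_cancel₀ (by positivity), ENNReal.ofReal_one, one_mul]

/-- In the fraction, numerator and denominator are both positive in the β-model and both negative in
the β'-model. -/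
theorem gammaShape_pos (hβ : M.Admissible d β) (hn : 1 ≤ n) : 0 < gammaShape M d β n := by
  have h1 : (1 : ℝ) ≤ n := by exact_mod_cast hn
  have hd : (0 : ℝ) ≤ d := Nat.cast_nonneg d
  have : 0 ≤ (2 * M.kappa * β + 2) / (2 * M.kappa * β + d + 2) := by
    cases M with
    | beta =>
      have : -1 < β := hβ
      simp only [Model.kappa]
      exact div_nonneg (by linarith) (by linarith)
    | betaPrime =>
      have : (d : ℝ) / 2 + 1 < β := hβ
      simp only [Model.kappa]
      exact div_nonneg_of_nonpos (by linarith) (by linarith)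
  unfold gammaShape
  linarith

/-- The height 0, admitted in the β-model, is null for ν; the normalising factor would degenerate
there. -/
theorem ae_nu_shape_mem (hd : 1 ≤ d) (hn : 2 ≤ n) (Λ : ℝ≥0∞) :
    ∀ᵐ p ∂(nu M d β γ n Λ), shape M p ∈ shapes M d n := by
  have h1 : ∀ᵐ p ∂(nu M d β γ n Λ), p ∈ markedPolytopes M d n := by
    rw [ae_iff]; exact nu_compl_markedPolytopes hn Λ
  filter_upwards [h1, ae_nu_height hd hn Λ] with p hp hh
  have hs : 0 < Real.sqrt (M.kappa * p.1.2) := Real.sqrt_pos.2 hh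
  cases M with
  | beta => exact smul_mem_polytopes hn (inv_pos.2 hs) hp.2.2
  | betaPrime =>
    obtain ⟨-, -, hp1, hp2⟩ := hp
    refine ⟨smul_mem_polytopes hn (inv_pos.2 hs) hp1, ?_⟩
    have e : -p.1.2 = Model.betaPrime.kappa * p.1.2 := by simp [Model.kappa]
    rw [e] at hp2
    rw [shape, ConvexBody.coe_smul]
    rintro _ ⟨w, hw, rfl⟩
    have hw' := hp2 hw
    rw [mem_ball_zero_iff] at hw' ⊢
    change ‖(Real.sqrt (Model.betaPrime.kappa * p.1.2))⁻¹ • w‖ < 1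
    rw [norm_smul, Real.norm_eq_abs, abs_of_pos (inv_pos.2 hs), inv_mul_lt_iff₀ hs, mul_one]
    exact hw'

end

end

/-! ### Gamma distributions from power laws -/

/-- The measure on `(0, ∞)` with distribution function `t ↦ t ^ q`. -/
noncomputable def powMeasure (q : ℝ) : Measure ℝ :=
  (volume.restrict (Ioi 0)).withDensity fun x => ENNReal.ofReal (q * x ^ (q - 1))

theorem powMeasure_Iio {q : ℝ} (hq : 0 < q) (t : ℝ) :
    powMeasure q (Iio t) = if 0 < t then ENNReal.ofReal (t ^ q) else 0 := by
  rw [powMeasure, withDensity_apply _ measurableSet_Iio, Measure.restrict_restrict measurableSet_Iio,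
    inter_comm, Ioi_inter_Iio]
  split_ifs with ht
  · have hint : IntervalIntegrable (fun x : ℝ => q * x ^ (q - 1)) volume 0 t :=
      (intervalIntegral.intervalIntegrable_rpow' (by linarith)).const_mul q
    rw [intervalIntegrable_iff_integrableOn_Ioc_of_le ht.le] at hint
    rw [setLIntegral_congr Ioo_ae_eq_Ioc, ← ofReal_integral_eq_lintegral_ofReal hint,
      ← intervalIntegral.integral_of_le ht.le, intervalIntegral.integral_const_mul,
      integral_rpow (Or.inl (by linarith)), sub_add_cancel, Real.zero_rpow hq.ne', sub_zero,
      mul_div_cancel₀ _ hq.ne']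
    filter_upwards [ae_restrict_mem measurableSet_Ioc] with x hx
    exact mul_nonneg hq.le (Real.rpow_nonneg hx.1.le _)
  · rw [Ioo_eq_empty ht]; simp

section

variable {E : Type*} [MeasurableSpace E] {ν : Measure E} {φ : E → ℝ≥0∞} {A : Set E} {c : ℝ≥0∞}
  {q : ℝ}

theorem measurableSet_finite_part (hφ : Measurable φ) (hA : MeasurableSet A) :
    MeasurableSet {p | φ p < ∞ ∧ p ∈ A} := by
  have h1 : MeasurableSet {p | φ p < ∞} := hφ measurableSet_Iio
  have h2 : MeasurableSet {p | p ∈ A} := hA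
  exact h1.inter h2

/-- The two measures agree and are finite on the half-lines (-∞, t), which generate. The restriction
to φ < ∞ matters because `toReal` sends ∞ to 0. -/
theorem map_toReal_eq_powMeasure (hq : 0 < q) (hφ : Measurable φ) (hA : MeasurableSet A)
    (hc : c ≠ ∞)
    (h : ∀ t : ℝ, 0 < t → ν {p | φ p < ENNReal.ofReal t ∧ p ∈ A} = ENNReal.ofReal (t ^ q) * c) :
    (ν.restrict {p | φ p < ∞ ∧ p ∈ A}).map (fun p => (φ p).toReal) = c • powMeasure q := by
  have hAm := measurableSet_finite_part hφ hA
  have heq : ∀ t : ℝ, (ν.restrict {p | φ p < ∞ ∧ p ∈ A}).map (fun p => (φ p).toReal) (Iio t) =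
      (c • powMeasure q) (Iio t) := by
    intro t
    have hp : MeasurableSet ((fun p => (φ p).toReal) ⁻¹' Iio t) := hφ.ennreal_toReal measurableSet_Iio
    rw [Measure.map_apply hφ.ennreal_toReal measurableSet_Iio, Measure.restrict_apply hp,
      Measure.smul_apply, powMeasure_Iio hq, smul_eq_mul]
    split_ifs with ht
    · rw [mul_comm c, ← h t ht]
      congr 1
      ext p
      constructor
      · rintro ⟨h1, h2, h3⟩
        exact ⟨(ENNReal.lt_ofReal_iff_toReal_lt h2.ne).2 h1, h3⟩
      · rintro ⟨h1, h3⟩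
        have h2 : φ p < ∞ := h1.trans ENNReal.ofReal_lt_top
        exact ⟨(ENNReal.lt_ofReal_iff_toReal_lt h2.ne).1 h1, h2, h3⟩
    · have : (fun p => (φ p).toReal) ⁻¹' Iio t = ∅ := by
        refine eq_empty_of_forall_notMem fun p hp => ht ?_
        exact ENNReal.toReal_nonneg.trans_lt hp
      rw [this, empty_inter, measure_empty, mul_zero]
  refine Measure.ext_of_generateFrom_of_iUnion (range Iio) (fun k : ℕ => Iio (k : ℝ)) ?_
    isPiSystem_Iio ?_ (fun k => ⟨k, rfl⟩) (fun k => ?_) ?_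
  · rw [← borel_eq_generateFrom_Iio]; exact BorelSpace.measurable_eq
  · exact iUnion_eq_univ_iff.2 fun x => exists_nat_gt x
  · rw [heq, Measure.smul_apply, powMeasure_Iio hq, smul_eq_mul]
    refine ENNReal.mul_ne_top hc ?_
    split_ifs <;> simp
  · rintro _ ⟨t, rfl⟩
    exact heq t

/-- Since Γ(q + 1) = qΓ(q), multiplying the Gamma density by Γ(q + 1) gives q x^{q-1} e^{-x}. -/
theorem gammaMeasure_map_ofReal (hq : 0 < q) {T : Set ℝ≥0∞} (hT : MeasurableSet T) :
    ENNReal.ofReal (Real.Gamma (q + 1)) * (gammaMeasure q 1).map ENNReal.ofReal T =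
      ∫⁻ x, T.indicator 1 (ENNReal.ofReal x) * ENNReal.ofReal (Real.exp (-x)) ∂(powMeasure q) := by
  have hΓ : 0 < Real.Gamma q := Real.Gamma_pos_of_pos hq
  have hTm : Measurable fun x : ℝ => T.indicator (1 : ℝ≥0∞ → ℝ≥0∞) (ENNReal.ofReal x) :=
    (measurable_one.indicator hT).comp ENNReal.measurable_ofReal
  have hgm : Measurable fun x : ℝ => T.indicator (1 : ℝ≥0∞ → ℝ≥0∞) (ENNReal.ofReal x) *
      ENNReal.ofReal (Real.exp (-x)) := hTm.mul (by fun_prop)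
  have hpdf : Measurable (gammaPDF q 1) := (measurable_gammaPDFReal q 1).ennreal_ofReal
  have hTo : MeasurableSet (ENNReal.ofReal ⁻¹' T) := ENNReal.measurable_ofReal hT
  rw [Measure.map_apply ENNReal.measurable_ofReal hT, gammaMeasure, withDensity_apply _ hTo,
    ← lintegral_indicator hTo, ← lintegral_const_mul _ (hpdf.indicator hTo), powMeasure,
    lintegral_withDensity_eq_lintegral_mul _ (by fun_prop) hgm, ← lintegral_indicator measurableSet_Ioi]
  refine lintegral_congr_ae ?_
  filter_upwards [compl_mem_ae_iff.2 (measure_singleton (μ := (volume : Measure ℝ)) 0)] with x hx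
  rcases lt_trichotomy x 0 with h | h | h
  · rw [indicator_of_notMem (s := Ioi (0 : ℝ)) (by simpa using h.le)]
    simp [gammaPDF_of_neg h]
  · exact absurd h hx
  · rw [indicator_of_mem (s := Ioi (0 : ℝ)) h, Pi.mul_apply]
    by_cases hxT : ENNReal.ofReal x ∈ T
    · rw [indicator_of_mem (show x ∈ ENNReal.ofReal ⁻¹' T from hxT), indicator_of_mem hxT,
        Pi.one_apply, one_mul, gammaPDF_of_nonneg h.le,
        ← ENNReal.ofReal_mul (Real.Gamma_pos_of_pos (by linarith)).le,
        ← ENNReal.ofReal_mul (mul_nonneg hq.le (Real.rpow_nonneg h.le _)), Real.Gamma_add_one hq.ne',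
        Real.one_rpow, one_mul]
      congr 1
      field_simp
    · rw [indicator_of_notMem (show x ∉ ENNReal.ofReal ⁻¹' T from hxT), indicator_of_notMem hxT]
      simp

/-- Points with φ = ∞ contribute nothing because e^{-∞} = 0; on the rest the power law turns the
integral into a one-dimensional one. -/
theorem lintegral_expNeg_of_power (hq : 0 < q) (hφ : Measurable φ) (hA : MeasurableSet A)
    (hc : c ≠ ∞)
    (h : ∀ t : ℝ, 0 < t → ν {p | φ p < ENNReal.ofReal t ∧ p ∈ A} = ENNReal.ofReal (t ^ q) * c)
    {T : Set ℝ≥0∞} (hT : MeasurableSet T) :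
    ∫⁻ p in {p | p ∈ A ∧ φ p ∈ T}, expNeg (φ p) ∂ν =
      c * (ENNReal.ofReal (Real.Gamma (q + 1)) * (gammaMeasure q 1).map ENNReal.ofReal T) := by
  have hAm := measurableSet_finite_part hφ hA
  have hTm : Measurable fun x : ℝ => T.indicator (1 : ℝ≥0∞ → ℝ≥0∞) (ENNReal.ofReal x) :=
    (measurable_one.indicator hT).comp ENNReal.measurable_ofReal
  have hgm : Measurable fun x : ℝ => T.indicator (1 : ℝ≥0∞ → ℝ≥0∞) (ENNReal.ofReal x) *
      ENNReal.ofReal (Real.exp (-x)) := hTm.mul (by fun_prop)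
  have hAT : MeasurableSet {p | p ∈ A ∧ φ p ∈ T} := by
    have h1 : MeasurableSet {p | p ∈ A} := hA
    have h2 : MeasurableSet {p | φ p ∈ T} := hφ hT
    exact h1.inter h2
  rw [gammaMeasure_map_ofReal hq hT, ← smul_eq_mul c, ← lintegral_smul_measure,
    ← map_toReal_eq_powMeasure hq hφ hA hc h, lintegral_map hgm hφ.ennreal_toReal,
    ← lintegral_indicator hAm, ← lintegral_indicator hAT]
  refine lintegral_congr fun p => ?_
  by_cases htop : φ p = ∞
  · rw [indicator_of_notMem (s := {p | φ p < ∞ ∧ p ∈ A}) fun h => h.1.ne htop]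
    exact (indicator_apply_eq_zero.2 fun _ => by rw [htop, expNeg_top]).trans rfl
  · classical
    have hlt : φ p < ∞ := lt_top_iff_ne_top.2 htop
    simp only [indicator_apply, mem_ofPred_eq, hlt, true_and, ENNReal.ofReal_toReal htop, expNeg,
      htop, if_false, Pi.one_apply]
    by_cases h1 : p ∈ A <;> by_cases h2 : φ p ∈ T <;> simp [h1, h2]

/-- A power law with positive exponent has no atom at 0. -/
theorem measure_zero_of_power (hq : 0 < q) (hφ : Measurable φ) (hA : MeasurableSet A) (hc : c ≠ ∞)
    (h : ∀ t : ℝ, 0 < t → ν {p | φ p < ENNReal.ofReal t ∧ p ∈ A} = ENNReal.ofReal (t ^ q) * c) :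
    ν {p | φ p = 0 ∧ p ∈ A} = 0 := by
  have hAm := measurableSet_finite_part hφ hA
  have h0 : (c • powMeasure q) {0} = 0 := by
    rw [Measure.smul_apply, powMeasure, withDensity_absolutelyContinuous _ _ (by simp), smul_zero]
  rw [← map_toReal_eq_powMeasure hq hφ hA hc h,
    Measure.map_apply hφ.ennreal_toReal (measurableSet_singleton 0),
    Measure.restrict_apply (hφ.ennreal_toReal (measurableSet_singleton 0))] at h0
  refine measure_mono_null ?_ h0
  rintro p ⟨h1, h2⟩
  have h3 : (φ p).toReal = 0 := by rw [h1]; rfl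
  exact ⟨h3, by rw [h1]; exact ENNReal.zero_lt_top, h2⟩

end

/-! ### The complementary theorem -/

section

variable {M : Model} {d n : ℕ} {β γ : ℝ} {Ω Ω' : Type*} [MeasurableSpace Ω] [MeasurableSpace Ω']
  {Pr : Measure Ω} {Pr' : Measure Ω'} {X : Ω → Set (Pt d)} {C : Ω' → Marked d}

/-- Where Φ < 1 the density e^{-Φ} is at least e^{-1}, and its integral against ν is a probability.
-/
theorem nu_phiContent_lt_one_ne_top [IsProbabilityMeasure Pr] [IsProbabilityMeasure Pr']
    (hd : 1 ≤ d) (hn : 2 ≤ n) (hβ : M.Admissible d β) (hγ : 0 < γ)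
    (hX : IsPoissonProcess X (intensity M d β γ) Pr) (hC : IsTypicalCell X Pr C Pr')
    (S : Set (ConvexBody (Vec d))) :
    nu M d β γ n (vertexDensity X Pr) {p | phiContent M β γ p < 1 ∧ shape M p ∈ S} ≠ ∞ := by
  set ν := nu M d β γ n (vertexDensity X Pr) with hν
  have hT : MeasurableSet {p : Marked d | phiContent M β γ p < 1} :=
    measurable_phiContent M d β γ measurableSet_Iio
  have h := hC.measure_eq_lintegral_nu (n := n) hd hn hβ hγ hX hT
  have h1 : ν {p | phiContent M β γ p < 1} * ENNReal.ofReal (Real.exp (-1)) ≤ 1 := by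
    calc ν {p | phiContent M β γ p < 1} * ENNReal.ofReal (Real.exp (-1))
        = ∫⁻ _p in {p : Marked d | phiContent M β γ p < 1}, ENNReal.ofReal (Real.exp (-1)) ∂ν := by
          rw [setLIntegral_const, mul_comm]
      _ ≤ ∫⁻ p in {p : Marked d | phiContent M β γ p < 1}, expNeg (phiContent M β γ p) ∂ν := by
          refine setLIntegral_mono' hT fun p hp => ?_
          have hp' : phiContent M β γ p < 1 := hp
          rw [expNeg, if_neg (hp'.trans ENNReal.one_lt_top).ne]
          refine ENNReal.ofReal_le_ofReal (Real.exp_le_exp.2 (neg_le_neg ?_))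
          exact ENNReal.toReal_le_of_le_ofReal zero_le_one (by simpa using hp'.le)
      _ ≤ 1 := by rw [← h]; exact prob_le_one
  have h2 : ν {p | phiContent M β γ p < 1} ≠ ∞ := by
    intro htop
    rw [htop, ENNReal.top_mul (by simpa using Real.exp_pos (-1))] at h1
    exact absurd h1 (by simp)
  exact ne_top_of_le_ne_top h2 (measure_mono fun p hp => hp.1)

/-- The joint law of the shape and the `Φ`-content of the typical cell on polytopes. -/
theorem IsTypicalCell.joint_law [IsProbabilityMeasure Pr] [IsProbabilityMeasure Pr']
    (hd : 1 ≤ d) (hn : 2 ≤ n) (hβ : M.Admissible d β) (hγ : 0 < γ)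
    (hX : IsPoissonProcess X (intensity M d β γ) Pr) (hC : IsTypicalCell X Pr C Pr')
    {S : Set (ConvexBody (Vec d))} (hS : MeasurableSet S) {T : Set ℝ≥0∞} (hT : MeasurableSet T) :
    Pr' {ω | (C ω).2 ∈ polytopes d n ∧ shape M (C ω) ∈ S ∧ phiContent M β γ (C ω) ∈ T} =
      nu M d β γ n (vertexDensity X Pr) {p | phiContent M β γ p < 1 ∧ shape M p ∈ S} *
        (ENNReal.ofReal (Real.Gamma (gammaShape M d β n + 1)) *
          (gammaMeasure (gammaShape M d β n) 1).map ENNReal.ofReal T) := by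
  have hSm : MeasurableSet {p : Marked d | shape M p ∈ S} := measurable_shape M d hS
  have hTm : MeasurableSet {p : Marked d | phiContent M β γ p ∈ T} := measurable_phiContent M d β γ hT
  refine (hC.measure_eq_lintegral_nu (n := n) hd hn hβ hγ hX (hSm.inter hTm)).trans ?_
  exact lintegral_expNeg_of_power (gammaShape_pos hβ (by omega)) (measurable_phiContent M d β γ) hSm
    (nu_phiContent_lt_one_ne_top hd hn hβ hγ hX hC S)
    (fun t ht => nu_scaling hd hn hβ _ hS ht) hT

/-- The definition requires Φ > 0, but the power law makes the set Φ = 0 null for ν. -/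
theorem nuTilde_apply [IsProbabilityMeasure Pr] [IsProbabilityMeasure Pr']
    (hd : 1 ≤ d) (hn : 2 ≤ n) (hβ : M.Admissible d β) (hγ : 0 < γ)
    (hX : IsPoissonProcess X (intensity M d β γ) Pr) (hC : IsTypicalCell X Pr C Pr')
    {S : Set (ConvexBody (Vec d))} (hS : MeasurableSet S) :
    nuTilde M d β γ n (vertexDensity X Pr) S =
      nu M d β γ n (vertexDensity X Pr) {p | phiContent M β γ p < 1 ∧ shape M p ∈ S} := by
  have hSm : MeasurableSet {p : Marked d | shape M p ∈ S} := measurable_shape M d hS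
  have h0 := measure_zero_of_power (gammaShape_pos hβ (by omega)) (measurable_phiContent M d β γ) hSm
    (nu_phiContent_lt_one_ne_top (n := n) hd hn hβ hγ hX hC S)
    (fun t ht => nu_scaling hd hn hβ _ hS ht)
  have hSp : MeasurableSet ((fun p : Marked d => shape M p) ⁻¹' S) := hSm
  rw [nuTilde, Measure.map_apply (measurable_shape M d) hS, Measure.restrict_apply hSp]
  refine le_antisymm (measure_mono fun p hp => ⟨hp.2.2, hp.1⟩) ?_
  refine (measure_mono (t := (_ ∩ _) ∪ {p : Marked d | phiContent M β γ p = 0 ∧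
    p ∈ {p : Marked d | shape M p ∈ S}}) fun p hp => ?_).trans
    ((measure_union_le _ _).trans (by rw [h0, add_zero]))
  rcases eq_or_ne (phiContent M β γ p) 0 with h | h
  · exact Or.inr ⟨h, hp.2⟩
  · exact Or.inl ⟨hp.2, pos_iff_ne_zero.2 h, hp.1⟩

end

end BetaVoronoi

theorem mainTheorem1 (M : Model) (d : ℕ) (hd : 1 ≤ d) (β γ : ℝ) (hβ : M.Admissible d β)
    (hγ : 0 < γ) {Ω Ω' : Type*} [MeasurableSpace Ω] [MeasurableSpace Ω']
    (Pr : Measure Ω) [IsProbabilityMeasure Pr] (Pr' : Measure Ω') [IsProbabilityMeasure Pr']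
    (X : Ω → Set (Pt d)) (hX : IsPoissonProcess X (intensity M d β γ) Pr)
    (C : Ω' → Marked d) (hC : IsTypicalCell X Pr C Pr') (n : ℕ) (hn : d + 1 ≤ n) :
    (∀ S : Set (ConvexBody (Vec d)), MeasurableSet S → S ⊆ shapes M d n →
      Pr' {ω | (C ω).2 ∈ polytopes d n ∧ shape M (C ω) ∈ S} =
        ENNReal.ofReal (Real.Gamma (gammaShape M d β n + 1)) *
          ∫⁻ p in markedPolytopes M d n,
            {q | shape M q ∈ S}.indicator 1 p * {q | phiContent M β γ q < 1}.indicator 1 p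
              ∂(nu M d β γ n (vertexDensity X Pr))) ∧
    (Pr' {ω | (C ω).2 ∈ polytopes d n} ≠ 0 →
      IndepFun (fun ω => shape M (C ω)) (fun ω => phiContent M β γ (C ω))
        (ProbabilityTheory.cond Pr' {ω | (C ω).2 ∈ polytopes d n}) ∧
      (ProbabilityTheory.cond Pr' {ω | (C ω).2 ∈ polytopes d n}).map
          (fun ω => phiContent M β γ (C ω)) =
        (gammaMeasure (gammaShape M d β n) 1).map ENNReal.ofReal ∧
      (ProbabilityTheory.cond Pr' {ω | (C ω).2 ∈ polytopes d n}).map (fun ω => shape M (C ω)) =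
        (nuTilde M d β γ n (vertexDensity X Pr) (shapes M d n))⁻¹ •
          nuTilde M d β γ n (vertexDensity X Pr)) := by
  have hn2 : 2 ≤ n := by omega
  have hq : 0 < gammaShape M d β n := gammaShape_pos hβ (by omega)
  set ν := nu M d β γ n (vertexDensity X Pr) with hν
  set G := ENNReal.ofReal (Real.Gamma (gammaShape M d β n + 1)) with hG
  set g := (gammaMeasure (gammaShape M d β n) 1).map ENNReal.ofReal with hg
  set c : Set (ConvexBody (Vec d)) → ℝ≥0∞ :=
    fun S => ν {p | phiContent M β γ p < 1 ∧ shape M p ∈ S} with hc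
  have hprob : IsProbabilityMeasure g := by
    have := isProbabilityMeasure_gammaMeasure hq one_pos
    exact Measure.isProbabilityMeasure_map ENNReal.measurable_ofReal.aemeasurable
  -- The joint law is a function of S times a function of T. Since g is a probability measure,
  -- taking T or S to be everything gives both marginals.
  have hjoint : ∀ S, MeasurableSet S → ∀ T, MeasurableSet T →
      Pr' {ω | (C ω).2 ∈ polytopes d n ∧ shape M (C ω) ∈ S ∧ phiContent M β γ (C ω) ∈ T} =
        c S * (G * g T) := fun S hS T hT => hC.joint_law hd hn2 hβ hγ hX hS hT
  have hshape : ∀ S, MeasurableSet S →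
      Pr' {ω | (C ω).2 ∈ polytopes d n ∧ shape M (C ω) ∈ S} = c S * G := by
    intro S hS
    have h := hjoint S hS univ MeasurableSet.univ
    simpa only [mem_univ, and_true, measure_univ, mul_one] using h
  have hphi : ∀ T, MeasurableSet T →
      Pr' {ω | (C ω).2 ∈ polytopes d n ∧ phiContent M β γ (C ω) ∈ T} = c univ * (G * g T) := by
    intro T hT
    have h := hjoint univ MeasurableSet.univ T hT
    simpa only [mem_univ, true_and] using h
  have hall : Pr' {ω | (C ω).2 ∈ polytopes d n} = c univ * G := by
    have h := hshape univ MeasurableSet.univ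
    simpa only [mem_univ, and_true] using h
  refine ⟨fun S hS _ => ?_, fun hpos => ?_⟩
  · have hm : MeasurableSet {p : Marked d | phiContent M β γ p < 1 ∧ shape M p ∈ S} := by
      have h1 : MeasurableSet {p : Marked d | phiContent M β γ p < 1} :=
        measurable_phiContent M d β γ measurableSet_Iio
      have h2 : MeasurableSet {p : Marked d | shape M p ∈ S} := measurable_shape M d hS
      exact h1.inter h2
    rw [hshape S hS, mul_comm, hν, nu_restrict_markedPolytopes hn2]
    congr 1
    rw [hc]
    simp only
    rw [← lintegral_indicator_one hm]
    refine lintegral_congr fun p => ?_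
    by_cases h1 : phiContent M β γ p < 1 <;> by_cases h2 : shape M p ∈ S <;>
      simp [h1, h2]
  · rw [hall] at hpos
    have hCm : Measurable C := hC.measurable
    have hsm : Measurable fun ω => shape M (C ω) := (measurable_shape M d).comp hCm
    have hpm : Measurable fun ω => phiContent M β γ (C ω) := (measurable_phiContent M d β γ).comp hCm
    have hEm : MeasurableSet {ω | (C ω).2 ∈ polytopes d n} := hCm (measurableSet_mem_polytopes hn2)
    have hfin : c univ * G ≠ ∞ := by rw [← hall]; exact measure_ne_top _ _
    have hc0 : c univ ≠ 0 := left_ne_zero_of_mul hpos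
    have hG0 : G ≠ 0 := right_ne_zero_of_mul hpos
    have hGt : G ≠ ∞ := ENNReal.ofReal_ne_top
    have hct : c univ ≠ ∞ := nu_phiContent_lt_one_ne_top hd hn2 hβ hγ hX hC univ
    -- Conditioning divides by c(univ) G; both factors are nonzero and finite, so G cancels and
    -- c(S)/c(univ) remains for the shape.
    have hinv : (c univ * G)⁻¹ = (c univ)⁻¹ * G⁻¹ :=
      ENNReal.mul_inv (Or.inl hc0) (Or.inl hct)
    have hGG : G⁻¹ * G = 1 := ENNReal.inv_mul_cancel hG0 hGt
    have hcc : (c univ)⁻¹ * c univ = 1 := ENNReal.inv_mul_cancel hc0 hct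
    have hcondS : ∀ S, MeasurableSet S → ProbabilityTheory.cond Pr' {ω | (C ω).2 ∈ polytopes d n}
        ((fun ω => shape M (C ω)) ⁻¹' S) = (c univ)⁻¹ * c S := by
      intro S hS
      have e : {ω | (C ω).2 ∈ polytopes d n} ∩ (fun ω => shape M (C ω)) ⁻¹' S =
        {ω | (C ω).2 ∈ polytopes d n ∧ shape M (C ω) ∈ S} := rfl
      rw [cond_apply hEm, hall, e, hshape S hS, hinv]
      calc (c univ)⁻¹ * G⁻¹ * (c S * G) = (c univ)⁻¹ * c S * (G⁻¹ * G) := by ring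
        _ = _ := by rw [hGG, mul_one]
    have hcondT : ∀ T, MeasurableSet T → ProbabilityTheory.cond Pr' {ω | (C ω).2 ∈ polytopes d n}
        ((fun ω => phiContent M β γ (C ω)) ⁻¹' T) = g T := by
      intro T hT
      have e : {ω | (C ω).2 ∈ polytopes d n} ∩ (fun ω => phiContent M β γ (C ω)) ⁻¹' T =
        {ω | (C ω).2 ∈ polytopes d n ∧ phiContent M β γ (C ω) ∈ T} := rfl
      rw [cond_apply hEm, hall, e, hphi T hT, hinv]
      calc (c univ)⁻¹ * G⁻¹ * (c univ * (G * g T)) = ((c univ)⁻¹ * c univ) * (G⁻¹ * G) * g T := by ring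
        _ = _ := by rw [hGG, hcc, one_mul, one_mul]
    refine ⟨?_, ?_, ?_⟩
    · rw [indepFun_iff_measure_inter_preimage_eq_mul]
      intro S T hS hT
      have e : {ω | (C ω).2 ∈ polytopes d n} ∩ ((fun ω => shape M (C ω)) ⁻¹' S ∩
        (fun ω => phiContent M β γ (C ω)) ⁻¹' T) = {ω | (C ω).2 ∈ polytopes d n ∧
          shape M (C ω) ∈ S ∧ phiContent M β γ (C ω) ∈ T} := rfl
      rw [hcondS S hS, hcondT T hT, cond_apply hEm, hall, e, hjoint S hS T hT, hinv]
      calc (c univ)⁻¹ * G⁻¹ * (c S * (G * g T)) = (c univ)⁻¹ * c S * g T * (G⁻¹ * G) := by ring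
        _ = _ := by rw [hGG, mul_one]
    · refine Measure.ext fun T hT => ?_
      rw [Measure.map_apply hpm hT, hcondT T hT]
    -- Almost every shape under ν lies in `shapes M d n`, so normalising by this set agrees with
    -- normalising by the total mass.
    · have hshapes : nuTilde M d β γ n (vertexDensity X Pr) (shapes M d n) = c univ := by
        rw [nuTilde_apply hd hn2 hβ hγ hX hC (measurableSet_shapes M d hn2)]
        refine measure_congr (Filter.eventuallyEq_set.2 ?_)
        filter_upwards [ae_nu_shape_mem (M := M) (β := β) (γ := γ) hd hn2 (vertexDensity X Pr)]
          with p hp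
        simp [hp]
      refine Measure.ext fun S hS => ?_
      rw [Measure.map_apply hsm hS, hcondS S hS, Measure.smul_apply, hshapes, smul_eq_mul,
        nuTilde_apply hd hn2 hβ hγ hX hC hS]
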